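/- There is an absolute constant $c$ such that, for every integer $t \geq 1$, there is an algorithm (a program of a unit-cost random access machine with addition and subtraction as its only arithmetic operations) which, given the adjacency matrix of any $n$-vertex graph $G$ that does not contain the friendship graph $K_1 + tK_2$ as an induced minor, outputs a maximum independent set of $G$ in at most $\max(n,2)^{c\,t^5}$ steps. In other words, Maximum Independent Set can be solved in polynomial time $n^{O(t^5)}$ on $n$-vertex $K_1+tK_2$-induced-minor-free graphs. Here all graphs are finite and simple; $K_1 + tK_2$ consists of $t$ pairwise disjoint and pairwise non-adjacent edges together with one further vertex adjacent to all of their $2t$ endpoints; and a graph $H$ is an induced minor of $G$ if $H$ can be obtained from $G$ by vertex deletions and edge contractions, that is, if there are pairwise disjoint vertex sets $B_x \subseteq V(G)$ ($x \in V(H)$), each inducing a connected nonempty subgraph of $G$, such that distinct $x, y \in V(H)$ are adjacent in $H$ if and only if $G$ has an edge between $B_x$ and $B_y$. -/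

import Mathlib

/-! ### Graphs -/

/-- `t` pairwise disjoint, pairwise non-adjacent copies of `G`, the graph `tG`. -/
def graphCopies {V : Type} (t : ℕ) (G : SimpleGraph V) : SimpleGraph (Fin t × V) where
  Adj x y := x.1 = y.1 ∧ G.Adj x.2 y.2
  symm := ⟨fun _ _ h => ⟨h.1.symm, h.2.symm⟩⟩
  loopless := ⟨fun _ h => h.2.ne rfl⟩

/-- The join `G + H`: the disjoint union of `G` and `H` together with all edges between them. -/
def graphJoin {V W : Type} (G : SimpleGraph V) (H : SimpleGraph W) : SimpleGraph (V ⊕ W) :=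
  (G ⊕g H) ⊔ completeBipartiteGraph V W

/-- The friendship graph `K₁ + tK₂`. -/
def friendshipGraph (t : ℕ) : SimpleGraph (Fin 1 ⊕ Fin t × Fin 2) :=
  graphJoin (⊤ : SimpleGraph (Fin 1)) (graphCopies t (⊤ : SimpleGraph (Fin 2)))

/-- `H` is an induced minor of `G`: there are pairwise disjoint vertex sets of `G`, one for each
vertex of `H`, each inducing a connected (in particular nonempty) subgraph, such that two distinct
vertices of `H` are adjacent if and only if some edge of `G` joins their sets. Vertices of `G` in
none of the sets are the deleted ones; the edges inside the sets are the contracted ones. -/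
def IsInducedMinor {V W : Type} (H : SimpleGraph W) (G : SimpleGraph V) : Prop :=
  ∃ B : W → Set V,
    (∀ i, (G.induce (B i)).Connected) ∧
    (∀ i j, i ≠ j → Disjoint (B i) (B j)) ∧
    (∀ i j, i ≠ j → (H.Adj i j ↔ ∃ u ∈ B i, ∃ v ∈ B j, G.Adj u v))

/-! ### Random access machines

The machine model is the random access machine with unit cost. Memory cells hold natural numbers.
The only arithmetic operations are addition and truncated subtraction (there is no multiplication),
so this model and the multitape Turing machine simulate each other with polynomial overhead. Control
flow is structured. Every constant, memory access, arithmetic operation, comparison, assignment and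
branch costs one step. -/

namespace RAM

/-- The memory: registers `reg x`, and arrays `arr a` of cells `arr a i`. A program mentions only
finitely many registers and arrays. -/
structure Memory where
  reg : ℕ → ℕ
  arr : ℕ → ℕ → ℕ

/-- Arithmetic expressions. -/
inductive Expr where
  | const (k : ℕ)
  | reg (x : ℕ)
  | arr (a : ℕ) (i : Expr)
  | add (e f : Expr)
  | sub (e f : Expr)

/-- The value of an expression. -/
def Expr.eval (σ : Memory) : Expr → ℕ
  | .const k => k
  | .reg x => σ.reg x
  | .arr a i => σ.arr a (i.eval σ)
  | .add e f => e.eval σ + f.eval σ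
  | .sub e f => e.eval σ - f.eval σ

/-- The number of steps needed to evaluate an expression. -/
def Expr.cost : Expr → ℕ
  | .const _ => 1
  | .reg _ => 1
  | .arr _ i => i.cost + 1
  | .add e f => e.cost + f.cost + 1
  | .sub e f => e.cost + f.cost + 1

/-- Programs. The tests are of the form `e < f`. -/
inductive Program where
  | skip
  | assign (x : ℕ) (e : Expr)
  | store (a : ℕ) (i e : Expr)
  | seq (P Q : Program)
  | ite (e f : Expr) (P Q : Program)
  | while (e f : Expr) (P : Program)

/-- Write the value `v` into register `x`. -/
def Memory.setReg (σ : Memory) (x v : ℕ) : Memory :=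
  { σ with reg := Function.update σ.reg x v }

/-- Write the value `v` into cell `i` of array `a`. -/
def Memory.setArr (σ : Memory) (a i v : ℕ) : Memory :=
  { σ with arr := Function.update σ.arr a (Function.update (σ.arr a) i v) }

/-- `Exec P σ τ k`: started in memory `σ`, the program `P` halts in memory `τ` after exactly `k`
steps. -/
inductive Exec : Program → Memory → Memory → ℕ → Prop where
  | skip (σ : Memory) : Exec .skip σ σ 1
  | assign (x : ℕ) (e : Expr) (σ : Memory) :
      Exec (.assign x e) σ (σ.setReg x (e.eval σ)) (e.cost + 1)
  | store (a : ℕ) (i e : Expr) (σ : Memory) :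
      Exec (.store a i e) σ (σ.setArr a (i.eval σ) (e.eval σ)) (i.cost + e.cost + 1)
  | seq {P Q : Program} {σ ρ τ : Memory} {k l : ℕ} :
      Exec P σ ρ k → Exec Q ρ τ l → Exec (.seq P Q) σ τ (k + l)
  | ite_true {e f : Expr} {P Q : Program} {σ τ : Memory} {k : ℕ} :
      e.eval σ < f.eval σ → Exec P σ τ k → Exec (.ite e f P Q) σ τ (e.cost + f.cost + 1 + k)
  | ite_false {e f : Expr} {P Q : Program} {σ τ : Memory} {k : ℕ} :
      ¬ e.eval σ < f.eval σ → Exec Q σ τ k → Exec (.ite e f P Q) σ τ (e.cost + f.cost + 1 + k)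
  | while_true {e f : Expr} {P : Program} {σ ρ τ : Memory} {k l : ℕ} :
      e.eval σ < f.eval σ → Exec P σ ρ k → Exec (.while e f P) ρ τ l →
      Exec (.while e f P) σ τ (e.cost + f.cost + 1 + k + l)
  | while_false {e f : Expr} {P : Program} {σ : Memory} :
      ¬ e.eval σ < f.eval σ → Exec (.while e f P) σ σ (e.cost + f.cost + 1)

open Classical in
/-- The initial memory on input a graph with vertices `0, …, n - 1`: register `0` holds `n`, array
`0` holds the adjacency matrix row by row, and every other cell holds `0`. -/
noncomputable def input {n : ℕ} (G : SimpleGraph (Fin n)) : Memory where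
  reg x := if x = 0 then n else 0
  arr a p := if a = 0 ∧ ∃ u v : Fin n, G.Adj u v ∧ p = u * n + v then 1 else 0

/-- The set of vertices output by a halted program: the `v` such that cell `v` of array `1` holds
the value `1`. -/
def output (n : ℕ) (τ : Memory) : Finset (Fin n) :=
  Finset.univ.filter fun v => τ.arr 1 v = 1

/-- On input `G`, the program `P` halts after at most `T` steps and outputs a maximum independent
set of `G`. -/
def SolvesMISWithin (P : Program) {n : ℕ} (G : SimpleGraph (Fin n)) (T : ℕ) : Prop :=
  ∃ τ k, Exec P (input G) τ k ∧ k ≤ T ∧ G.IsMaximumIndepSet (output n τ)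

end RAM

/-! The graph `K₁ + tK₂` is an induced minor as soon as some connected set `X` has `t` pairwise
anticomplete connected pieces outside it, each with two distinct vertices seeing `X`: every piece
splits into two adjacent connected halves, both seeing `X`. The structural part uses only the
absence of such fans (`FanFree`).

Structure. Put m = 288t⁴. A 2-connected set with an induced matching of m edges contains a long
geodesic, since otherwise too many matching edges would hang on one ball
(`FanFree.card_attached_lt`, `FanFree.exists_geodesic`). Without fans, all but a few stretches of
the geodesic are clean, and a clean stretch yields an ear `W` with a middle vertex `c`
(`FanFree.exists_ear`): `W` is attached at two vertices only, its removal leaves a connected set,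
and every 2-connected set that avoids `c` and still has m matching edges avoids all of `W`.
Descending into such a set after the deletion of `c` keeps `W` as a future piece of a fan, so t
nested failures would produce t pieces (`FanFree.not_partialFan`). Hence blocks can be destroyed
recursively to depth t, one vertex per block and level, until no induced matching with m edges is
left (`FanFree.cls_univ`).

Algorithm. Leaf blocks are peeled off one by one; for a leaf block with cut vertex `c` it suffices
to solve the block without `c` and the block without `c` and its neighbours (`PeelState.step`).
Inside a block, the vertex to be destroyed is guessed together with its status in the solution. At
the bottom, where induced matchings have at most j = m − 1 edges, every maximal independent set is
the greedy one after at most 2j deletions, each described by two vertices (`exists_prune_isLex`),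
and these are guessed too. Guessing means trying everything and keeping the largest independent set
found, so nothing about the structure has to be recognised; `Cls.levelGood` says that some sequence
of guesses is right. The exponent of the running time is linear in j + t (`RAM.solves_levels`),
hence at most a multiple of t⁵. -/

/-! ### Connected sets, components and fans -/

section Connectivity

variable {V : Type} {G : SimpleGraph V}

/-- The vertex set `S` is nonempty and induces a connected subgraph, stated through cuts. -/
def Conn (G : SimpleGraph V) (S : Set V) : Prop :=
  S.Nonempty ∧ ∀ A ⊆ S, A.Nonempty → (∀ x ∈ A, ∀ y ∈ S, G.Adj x y → y ∈ A) → A = S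

/-- The sets `A` and `B` are disjoint and no edge joins them. -/
def Anticomplete (G : SimpleGraph V) (A B : Set V) : Prop :=
  Disjoint A B ∧ ∀ a ∈ A, ∀ b ∈ B, ¬ G.Adj a b

/-- The vertex set `B` has at least two elements and induces a connected subgraph without cut
vertices. -/
def TwoConn (G : SimpleGraph V) (B : Set V) : Prop :=
  B.Nontrivial ∧ Conn G B ∧ ∀ x ∈ B, Conn G (B \ {x})

theorem Anticomplete.symm {A B : Set V} (h : Anticomplete G A B) : Anticomplete G B A :=
  ⟨h.1.symm, fun a ha b hb e => h.2 b hb a ha e.symm⟩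

theorem Anticomplete.mono {A B A' B' : Set V} (h : Anticomplete G A B) (hA : A' ⊆ A)
    (hB : B' ⊆ B) : Anticomplete G A' B' :=
  ⟨h.1.mono hA hB, fun a ha b hb => h.2 a (hA ha) b (hB hb)⟩

theorem Anticomplete.union_left {A A' B : Set V} (h : Anticomplete G A B)
    (h' : Anticomplete G A' B) : Anticomplete G (A ∪ A') B :=
  ⟨Set.disjoint_union_left.2 ⟨h.1, h'.1⟩, by
    rintro a (ha | ha) b hb
    exacts [h.2 a ha b hb, h'.2 a ha b hb]⟩

theorem Anticomplete.union_right {A B B' : Set V} (h : Anticomplete G A B)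
    (h' : Anticomplete G A B') : Anticomplete G A (B ∪ B') :=
  (h.symm.union_left h'.symm).symm

theorem Conn.nonempty {S : Set V} (h : Conn G S) : S.Nonempty := h.1

theorem conn_singleton (x : V) : Conn G {x} := by
  refine ⟨⟨x, rfl⟩, fun A hA hne _ => ?_⟩
  rcases Set.subset_singleton_iff_eq.1 hA with h | h
  · exact absurd h hne.ne_empty
  · exact h

/-- A connected set meeting a closed set lies in it. -/
theorem Conn.subset_of_closed {K A : Set V} (hK : Conn G K) (hne : (K ∩ A).Nonempty)
    (hA : ∀ x ∈ A, ∀ y ∈ K, x ∈ K → G.Adj x y → y ∈ A) : K ⊆ A := by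
  have := hK.2 (K ∩ A) Set.inter_subset_left hne
    (fun x hx y hy e => ⟨hy, hA x hx.2 y hy hx.1 e⟩)
  exact Set.inter_eq_left.1 this

/-- The main tool for proving connectivity: a nonempty closed part `A` of `T` reaches `S` through
the set covering one of its points, so it contains `S` and then every covering set. -/
theorem conn_of_cover {S T : Set V} (hS : Conn G S) (hST : S ⊆ T)
    (h : ∀ x ∈ T, ∃ K ⊆ T, Conn G K ∧ x ∈ K ∧ (K ∩ S).Nonempty) : Conn G T := by
  refine ⟨hS.1.mono hST, fun A hAT ⟨a, ha⟩ hcl => hAT.antisymm fun x hx => ?_⟩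
  have key : ∀ K ⊆ T, Conn G K → (K ∩ A).Nonempty → K ⊆ A := fun K hKT hK hne =>
    hK.subset_of_closed hne fun x hx y hy _ e => hcl x hx y (hKT hy) e
  have hSA : S ⊆ A := by
    obtain ⟨K, hKT, hK, haK, z, hzK, hzS⟩ := h a (hAT ha)
    exact key S hST hS ⟨z, hzS, key K hKT hK ⟨a, haK, ha⟩ hzK⟩
  obtain ⟨K, hKT, hK, hxK, z, hzK, hzS⟩ := h x hx
  exact key K hKT hK ⟨z, hzK, hSA hzS⟩ hxK

theorem Conn.union {S K : Set V} (hS : Conn G S) (hK : Conn G K) (h : (S ∩ K).Nonempty) :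
    Conn G (S ∪ K) := by
  refine conn_of_cover hS Set.subset_union_left ?_
  rintro x (hx | hx)
  · exact ⟨S, Set.subset_union_left, hS, hx, x, hx, hx⟩
  · exact ⟨K, Set.subset_union_right, hK, hx, by rwa [Set.inter_comm]⟩

theorem conn_pair {x y : V} (h : G.Adj x y) : Conn G {x, y} := by
  refine ⟨⟨x, by simp⟩, fun A hA ⟨a, ha⟩ hcl => hA.antisymm ?_⟩
  have hx : x ∈ A := by
    rcases hA ha with rfl | rfl
    · exact ha
    · exact hcl _ ha _ (by simp) h.symm
  rintro z (rfl | rfl)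
  · exact hx
  · exact hcl _ hx _ (by simp) h

theorem Conn.union_adj {S K : Set V} (hS : Conn G S) (hK : Conn G K) {s k : V} (hs : s ∈ S)
    (hk : k ∈ K) (h : G.Adj s k) : Conn G (S ∪ K) := by
  have h1 : Conn G (S ∪ {s, k}) := hS.union (conn_pair h) ⟨s, hs, by simp⟩
  have h2 := h1.union hK ⟨k, by simp, hk⟩
  have : S ∪ {s, k} ∪ K = S ∪ K := by
    ext z; simp only [Set.mem_union, Set.mem_insert_iff, Set.mem_singleton_iff]
    constructor
    · rintro ((h | rfl | rfl) | h) <;> simp [*]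
    · rintro (h | h) <;> simp [*]
  rwa [this] at h2

theorem Conn.insert_adj {S : Set V} (hS : Conn G S) {s k : V} (hs : s ∈ S)
    (h : G.Adj s k) : Conn G (insert k S) := by
  have := hS.union_adj (conn_singleton k) hs rfl h
  rwa [Set.union_singleton] at this

/-- A connected set has an edge leaving any nonempty proper part. -/
theorem Conn.exists_adj {S A : Set V} (hS : Conn G S) {a b : V} (ha : a ∈ S) (haA : a ∈ A)
    (hb : b ∈ S) (hbA : b ∉ A) : ∃ x ∈ S, x ∈ A ∧ ∃ y ∈ S, y ∉ A ∧ G.Adj x y := by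
  by_contra! hcon
  exact hbA (hS.subset_of_closed ⟨a, ha, haA⟩
    (fun x hx y hy hxS e => by_contra fun h => hcon x hxS hx y hy h e) hb)

theorem Conn.induce_connected {S : Set V} (hS : Conn G S) : (G.induce S).Connected := by
  obtain ⟨s, hs⟩ := hS.1
  have key : S ⊆ {y | ∃ h : y ∈ S, (G.induce S).Reachable ⟨s, hs⟩ ⟨y, h⟩} := by
    refine hS.subset_of_closed ⟨s, hs, hs, SimpleGraph.Reachable.refl _⟩ ?_
    rintro x ⟨hx, hr⟩ y hy _ e
    refine ⟨hy, hr.trans (SimpleGraph.Adj.reachable ?_)⟩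
    simpa using e
  rw [SimpleGraph.connected_iff_exists_forall_reachable]
  exact ⟨⟨s, hs⟩, fun ⟨y, hy⟩ => (key hy).2⟩

/-- The connected component of `x` in the subgraph induced by `S`. -/
def compIn (G : SimpleGraph V) (S : Set V) (x : V) : Set V :=
  {y | ∃ K ⊆ S, Conn G K ∧ x ∈ K ∧ y ∈ K}

theorem compIn_subset (S : Set V) (x : V) : compIn G S x ⊆ S :=
  fun _ ⟨_, hK, _, _, hy⟩ => hK hy

theorem mem_compIn_self {S : Set V} {x : V} (h : x ∈ S) : x ∈ compIn G S x :=
  ⟨{x}, by simpa using h, conn_singleton x, rfl, rfl⟩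

theorem conn_compIn {S : Set V} {x : V} (h : x ∈ S) : Conn G (compIn G S x) := by
  refine conn_of_cover (conn_singleton x) (by simpa using mem_compIn_self h) ?_
  rintro y ⟨K, hKS, hK, hx, hy⟩
  exact ⟨K, fun z hz => ⟨K, hKS, hK, hx, hz⟩, hK, hy, x, hx, rfl⟩

theorem compIn_of_conn {S K : Set V} {x : V} (hK : Conn G K) (hKS : K ⊆ S)
    (h : (K ∩ compIn G S x).Nonempty) : K ⊆ compIn G S x := by
  obtain ⟨z, hz, L, hLS, hL, hx, hzL⟩ := h
  exact fun y hy => ⟨L ∪ K, Set.union_subset hLS hKS, hL.union hK ⟨z, hzL, hz⟩, Or.inl hx,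
    Or.inr hy⟩

theorem compIn_closed {S : Set V} {x y z : V} (hy : y ∈ compIn G S x) (hz : z ∈ S)
    (h : G.Adj y z) : z ∈ compIn G S x :=
  compIn_of_conn (conn_pair h) (by
    rintro w (rfl | rfl)
    exacts [compIn_subset _ _ hy, hz]) ⟨y, by simp, hy⟩ (by simp)

theorem compIn_eq {S : Set V} {x y : V} (hy : y ∈ compIn G S x) :
    compIn G S y = compIn G S x := by
  have hyS := compIn_subset _ _ hy
  have hxS : x ∈ S := by obtain ⟨K, hK, _, hx, _⟩ := hy; exact hK hx
  have h1 : compIn G S y ⊆ compIn G S x :=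
    compIn_of_conn (conn_compIn hyS) (compIn_subset _ _) ⟨y, mem_compIn_self hyS, hy⟩
  refine h1.antisymm (compIn_of_conn (conn_compIn hxS) (compIn_subset _ _) ?_)
  exact ⟨y, hy, mem_compIn_self hyS⟩

theorem compIn_anticomplete {S : Set V} {x y : V} (h : compIn G S x ≠ compIn G S y) :
    Anticomplete G (compIn G S x) (compIn G S y) := by
  constructor
  · rw [Set.disjoint_left]
    intro z hx hy
    exact h ((compIn_eq hx).symm.trans (compIn_eq hy))
  · intro a ha b hb e
    exact h ((compIn_eq (compIn_closed ha (compIn_subset _ _ hb) e)).symm.trans (compIn_eq hb))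

/-- A path-like sequence of adjacent vertices has connected image. -/
theorem conn_image_Icc {p : ℕ → V} {a b : ℕ} (hab : a ≤ b)
    (h : ∀ i, a ≤ i → i < b → G.Adj (p i) (p (i + 1))) : Conn G (p '' Set.Icc a b) := by
  induction b, hab using Nat.le_induction with
  | base => simpa using conn_singleton (p a)
  | succ b hab ih =>
    have h1 := ih fun i hi hib => h i hi (by omega)
    have h2 := h1.insert_adj (Set.mem_image_of_mem p (Set.right_mem_Icc.2 hab)) (h b hab (by omega))
    have : p '' Set.Icc a (b + 1) = insert (p (b + 1)) (p '' Set.Icc a b) := by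
      rw [← Set.image_insert_eq]
      congr 1
      ext i; simp only [Set.mem_Icc, Set.mem_insert_iff]; omega
    rwa [this]

/-- `C` is a connected set disjoint from `X` with two vertices that have neighbours in `X`. -/
structure IsPiece (G : SimpleGraph V) (X C : Set V) : Prop where
  conn : Conn G C
  disj : Disjoint X C
  two : ∃ u ∈ C, ∃ v ∈ C, u ≠ v ∧ (∃ x ∈ X, G.Adj x u) ∧ ∃ x ∈ X, G.Adj x v

/-- No connected set has `t` pairwise separated pieces. -/
def FanFree (G : SimpleGraph V) (t : ℕ) : Prop :=
  ∀ (ι : Type) (s : Finset ι) (X : Set V) (C : ι → Set V), Conn G X →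
    (∀ i ∈ s, IsPiece G X (C i)) → (∀ i ∈ s, ∀ j ∈ s, i ≠ j → Anticomplete G (C i) (C j)) →
    s.card < t

/-- Removing one component left by the deletion of a vertex keeps a set connected. -/
theorem Conn.sdiff_compIn {C : Set V} (hC : Conn G C) {a b : V} (ha : a ∈ C) (hb : b ∈ C \ {a}) :
    Conn G (C \ compIn G (C \ {a}) b) := by
  set B := compIn G (C \ {a}) b with hB
  have haB : a ∉ B := fun h => (compIn_subset _ _ h).2 rfl
  refine conn_of_cover (conn_singleton a) (by simp [ha, haB]) ?_
  rintro x ⟨hx, hxB⟩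
  by_cases hxa : x = a
  · subst hxa
    exact ⟨{x}, by simp [ha, haB], conn_singleton x, rfl, x, rfl, rfl⟩
  have hxS : x ∈ C \ {a} := ⟨hx, hxa⟩
  -- A component of `C \ {a}` can be left only through `a`, so every component other than `B` hangs
  -- directly on `a`.
  obtain ⟨u, -, hu, v, hv, hvn, e⟩ := hC.exists_adj hx (mem_compIn_self hxS) ha
    (fun h => (compIn_subset _ _ h).2 rfl : a ∉ compIn G (C \ {a}) x)
  have hva : v = a := by
    by_contra hva
    exact hvn (compIn_closed hu ⟨hv, hva⟩ e)
  subst hva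
  refine ⟨insert v (compIn G (C \ {v}) x), ?_, (conn_compIn hxS).insert_adj hu e,
    Or.inr (mem_compIn_self hxS), v, by simp, rfl⟩
  rintro w (rfl | hw)
  · exact ⟨ha, haB⟩
  · refine ⟨(compIn_subset _ _ hw).1, fun hwB => hxB ?_⟩
    have := (compIn_eq hw).symm.trans (compIn_eq hwB)
    rw [hB, ← this]
    exact mem_compIn_self hxS

/-- A connected set splits into two adjacent connected sets separating two given vertices. -/
theorem Conn.exists_split {C : Set V} (hC : Conn G C) {a b : V} (ha : a ∈ C) (hb : b ∈ C)
    (hab : a ≠ b) : ∃ A B : Set V, A ∪ B = C ∧ Disjoint A B ∧ Conn G A ∧ Conn G B ∧ a ∈ A ∧ b ∈ B ∧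
      ∃ u ∈ A, ∃ v ∈ B, G.Adj u v := by
  have hbS : b ∈ C \ {a} := ⟨hb, hab.symm⟩
  set B := compIn G (C \ {a}) b with hB
  have hBC : B ⊆ C \ {a} := compIn_subset _ _
  have haB : a ∉ B := fun h => (hBC h).2 rfl
  refine ⟨C \ B, B, Set.sdiff_union_of_subset fun x hx => (hBC hx).1, Set.disjoint_sdiff_left, ?_,
    conn_compIn hbS, ⟨ha, haB⟩, mem_compIn_self hbS, ?_⟩
  · exact hC.sdiff_compIn ha hbS
  · obtain ⟨u, hu, huB, v, hv, hvB, e⟩ := hC.exists_adj hb (mem_compIn_self hbS) ha haB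
    exact ⟨v, ⟨hv, hvB⟩, u, huB, e.symm⟩

/-- Each piece is split between its two contact vertices; the two halves are the branch sets of one
edge of `tK₂`, and `X` is the branch set of the centre. -/
theorem fanFree_of_not_isInducedMinor {t : ℕ} (h : ¬ IsInducedMinor (friendshipGraph t) G) :
    FanFree G t := by
  intro ι s X C hX hp hsep
  by_contra hcard
  push Not at hcard
  apply h
  obtain ⟨f⟩ : Nonempty (Fin t ↪ s) := Function.Embedding.nonempty_of_card_le (by simpa using hcard)
  have hp' : ∀ i : Fin t, IsPiece G X (C (f i)) := fun i => hp _ (f i).2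
  have hsep' : ∀ i j : Fin t, i ≠ j → Anticomplete G (C (f i)) (C (f j)) := fun i j hij =>
    hsep _ (f i).2 _ (f j).2 fun e => hij (f.injective (Subtype.ext e))
  choose u hu v hv huv hxu hxv using fun i => (hp' i).two
  choose A B hAB hdis hA hB huA hvB a ha b hb hab using
    fun i => (hp' i).conn.exists_split (hu i) (hv i) (huv i)
  have hAC : ∀ i, A i ⊆ C (f i) := fun i => hAB i ▸ Set.subset_union_left
  have hBC : ∀ i, B i ⊆ C (f i) := fun i => hAB i ▸ Set.subset_union_right
  let D : Fin t × Fin 2 → Set V := fun q => if q.2 = 0 then A q.1 else B q.1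
  have hDC : ∀ q, D q ⊆ C (f q.1) := by
    intro q; dsimp only [D]; split_ifs
    exacts [hAC _, hBC _]
  have hDX : ∀ q, ∃ x ∈ X, ∃ y ∈ D q, G.Adj x y := by
    intro q; dsimp only [D]; split_ifs
    · obtain ⟨x, hx, e⟩ := hxu q.1; exact ⟨x, hx, _, huA _, e⟩
    · obtain ⟨x, hx, e⟩ := hxv q.1; exact ⟨x, hx, _, hvB _, e⟩
  have hDD : ∀ q r, q ≠ r → Disjoint (D q) (D r) ∧
      (q.1 = r.1 ↔ ∃ u ∈ D q, ∃ v ∈ D r, G.Adj u v) := by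
    rintro ⟨i, q⟩ ⟨j, r⟩ hqr
    by_cases hij : i = j
    · subst hij
      have hqr' : q ≠ r := fun e => hqr (by rw [e])
      have : (q = 0 ∧ r = 1) ∨ (q = 1 ∧ r = 0) := by
        fin_cases q <;> fin_cases r <;> simp_all
      rcases this with ⟨rfl, rfl⟩ | ⟨rfl, rfl⟩
      · simp only [D, ite_true, one_ne_zero, ite_false, true_iff]
        exact ⟨hdis i, _, ha i, _, hb i, hab i⟩
      · simp only [D, ite_true, one_ne_zero, ite_false, true_iff]
        exact ⟨(hdis i).symm, _, hb i, _, ha i, (hab i).symm⟩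
    · have := (hsep' i j hij).mono (hDC (i, q)) (hDC (j, r))
      refine ⟨this.1, fun h => absurd h hij, ?_⟩
      rintro ⟨x, hx, y, hy, e⟩
      exact absurd e (this.2 x hx y hy)
  refine ⟨Sum.elim (fun _ => X) D, ?_, ?_, ?_⟩
  · rintro (i | q)
    · exact hX.induce_connected
    · refine Conn.induce_connected ?_
      simp only [Sum.elim_inr, D]
      split_ifs
      exacts [hA _, hB _]
  · rintro (i | q) (j | r) hij
    · exact absurd (congrArg Sum.inl (Subsingleton.elim i j)) hij
    · exact (hp' r.1).disj.mono_right (hDC r)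
    · exact ((hp' q.1).disj.mono_right (hDC q)).symm
    · exact (hDD q r fun e => hij (by rw [e])).1
  · rintro (i | q) (j | r) hij
    · exact absurd (congrArg Sum.inl (Subsingleton.elim i j)) hij
    · simp only [friendshipGraph, graphJoin, SimpleGraph.sup_adj, Sum.elim_inl, Sum.elim_inr]
      refine ⟨fun _ => hDX r, fun _ => Or.inr (by simp)⟩
    · simp only [friendshipGraph, graphJoin, SimpleGraph.sup_adj, Sum.elim_inl, Sum.elim_inr]
      obtain ⟨x, hx, y, hy, e⟩ := hDX q
      refine ⟨fun _ => ⟨y, hy, x, hx, e.symm⟩, fun _ => Or.inr (by simp)⟩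
    · have hqr : q ≠ r := fun e => hij (by rw [e])
      rw [Sum.elim_inr, Sum.elim_inr, ← (hDD q r hqr).2]
      simp only [friendshipGraph, graphJoin, SimpleGraph.sup_adj, graphCopies]
      constructor
      · rintro (h | h)
        · simpa using h.1
        · simp at h
      · intro h
        refine Or.inl ⟨h, ?_⟩
        rw [SimpleGraph.top_adj]
        exact fun h' => hqr (Prod.ext h h')

end Connectivity

/-! ### Sets attached to a connected set inside a 2-connected set -/

section ManyAttachments

variable {V : Type} {G : SimpleGraph V}

/-- A digraph of small out-degree has a large independent set. -/
theorem exists_independent_of_outdegree_le {ι : Type} [DecidableEq ι] (r : ι → ι → Prop)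
    [∀ i, DecidablePred (r i)] (d t : ℕ) (s : Finset ι)
    (hd : ∀ i ∈ s, (s.filter fun j => r i j).card ≤ d) (hs : (2 * d + 1) * t ≤ s.card) :
    ∃ J ⊆ s, J.card = t ∧ ∀ i ∈ J, ∀ j ∈ J, i ≠ j → ¬ r i j := by
  induction t generalizing s with
  | zero => exact ⟨∅, by simp, rfl, by simp⟩
  | succ t ih =>
    have hpos : 0 < s.card := by nlinarith
    -- In-degrees and out-degrees have the same sum, so some `v` has in-degree at most `d`. Choosing
    -- `v` costs at most `2 * d + 1` elements: itself and its neighbours in both directions.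
    obtain ⟨v, hv, hin⟩ : ∃ v ∈ s, (s.filter fun i => r i v).card ≤ d := by
      by_contra! hcon
      have h1 : ∑ v ∈ s, (s.filter fun i => r i v).card =
          ∑ i ∈ s, (s.filter fun j => r i j).card := by
        simp only [Finset.card_filter]
        exact Finset.sum_comm
      have h2 : ∑ i ∈ s, (s.filter fun j => r i j).card ≤ s.card * d := by
        simpa using Finset.sum_le_card_nsmul s _ d hd
      have h3 : s.card * (d + 1) ≤ ∑ v ∈ s, (s.filter fun i => r i v).card := by
        simpa using Finset.card_nsmul_le_sum s _ (d + 1) fun v hv => hcon v hv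
      nlinarith
    let bad := insert v ((s.filter fun i => r i v) ∪ s.filter fun j => r v j)
    have hbad : bad.card ≤ 2 * d + 1 := by
      have h1 := Finset.card_insert_le v ((s.filter fun i => r i v) ∪ s.filter fun j => r v j)
      have h2 := Finset.card_union_le (s.filter fun i => r i v) (s.filter fun j => r v j)
      have h3 := hd v hv
      show (insert v _ : Finset ι).card ≤ _
      omega
    have hsd : s.card - bad.card ≤ (s \ bad).card := Finset.le_card_sdiff bad s
    obtain ⟨J, hJs, hJc, hJ⟩ := ih (s \ bad)
      (fun i hi => (Finset.card_le_card (Finset.filter_subset_filter _ Finset.sdiff_subset)).trans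
        (hd i (Finset.sdiff_subset hi))) (by
          have : (2 * d + 1) * (t + 1) = (2 * d + 1) * t + (2 * d + 1) := by ring
          omega)
    have hvJ : v ∉ J := fun h => (Finset.mem_sdiff.1 (hJs h)).2 (Finset.mem_insert_self _ _)
    have hJv : ∀ j ∈ J, ¬ r v j ∧ ¬ r j v := by
      intro j hj
      obtain ⟨h1, h2⟩ := Finset.mem_sdiff.1 (hJs hj)
      constructor <;> intro h <;> apply h2 <;> simp [bad, h1, h]
    refine ⟨insert v J, Finset.insert_subset hv (hJs.trans Finset.sdiff_subset), by
      rw [Finset.card_insert_of_notMem hvJ, hJc], ?_⟩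
    intro i hi j hj hij
    rcases Finset.mem_insert.1 hi with hi' | hi' <;> rcases Finset.mem_insert.1 hj with hj' | hj'
    · exact absurd (hi'.trans hj'.symm) hij
    · exact hi' ▸ (hJv j hj').1
    · exact hj' ▸ (hJv i hi').2
    · exact hJ i hi' j hj' hij

/-- In a graph without fans, few pairwise anticomplete nontrivial connected sets of a 2-connected
part can be adjacent to a given connected set. -/
theorem FanFree.card_attached_lt {t : ℕ} (hG : FanFree G t) (ht : 1 ≤ t) {B X : Set V}
    (hB : TwoConn G B) (hX : Conn G X) (hXB : X ⊆ B) {ι : Type} (s : Finset ι) (Y : ι → Set V)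
    (hY : ∀ i ∈ s, Conn G (Y i)) (hYB : ∀ i ∈ s, Y i ⊆ B) (hYX : ∀ i ∈ s, Disjoint X (Y i))
    (hnt : ∀ i ∈ s, (Y i).Nontrivial) (hadj : ∀ i ∈ s, ∃ x ∈ X, ∃ y ∈ Y i, G.Adj x y)
    (hsep : ∀ i ∈ s, ∀ j ∈ s, i ≠ j → Anticomplete G (Y i) (Y j)) : s.card < 4 * t ^ 2 := by
  classical
  by_contra! hcard
  let two : ι → Prop := fun i =>
    ∃ u ∈ Y i, ∃ v ∈ Y i, u ≠ v ∧ (∃ x ∈ X, G.Adj x u) ∧ ∃ x ∈ X, G.Adj x v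
  have htwo : (s.filter two).card < t := by
    refine hG ι _ X Y hX (fun i hi => ?_) (fun i hi j hj => ?_)
    · obtain ⟨hi, h⟩ := Finset.mem_filter.1 hi
      exact ⟨hY i hi, hYX i hi, h⟩
    · exact hsep i (Finset.mem_filter.1 hi).1 j (Finset.mem_filter.1 hj).1
  -- Sets with two contacts form a fan by themselves, so there are fewer than `t`. The others see
  -- `X` in one vertex only and need a second contact by way of the rest of `B`.
  let I := s \ s.filter two
  have hIs : ∀ i ∈ I, i ∈ s := fun i hi => (Finset.mem_sdiff.1 hi).1
  have hIcard : (2 * t + 1) * t ≤ I.card := by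
    have : s.card - (s.filter two).card ≤ I.card := Finset.le_card_sdiff _ _
    have h2 : t ≤ t ^ 2 := by nlinarith
    have h3 : (2 * t + 1) * t = 2 * t ^ 2 + t := by ring
    omega
  -- the unique contact vertices
  have hy : ∀ i, ∃ y, i ∈ I → y ∈ Y i ∧ (∃ x ∈ X, G.Adj x y) ∧
      ∀ z ∈ Y i, z ≠ y → ∀ x ∈ X, ¬ G.Adj x z := by
    intro i
    by_cases hi : i ∈ I
    · obtain ⟨x, hx, y, hy, e⟩ := hadj i (hIs i hi)
      refine ⟨y, fun _ => ⟨hy, ⟨x, hx, e⟩, fun z hz hzy x' hx' e' => ?_⟩⟩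
      exact (Finset.mem_sdiff.1 hi).2 (Finset.mem_filter.2
        ⟨hIs i hi, z, hz, y, hy, hzy, ⟨x', hx', e'⟩, x, hx, e⟩)
    · obtain ⟨x, hx⟩ := hX.nonempty
      exact ⟨x, fun h => absurd h hi⟩
  choose y hy using hy
  have hyY : ∀ i ∈ I, y i ∈ Y i := fun i hi => (hy i hi).1
  have hyX : ∀ i ∈ I, ∃ x ∈ X, G.Adj x (y i) := fun i hi => (hy i hi).2.1
  have hyn : ∀ i ∈ I, ∀ z ∈ Y i, z ≠ y i → ∀ x ∈ X, ¬ G.Adj x z := fun i hi => (hy i hi).2.2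
  let O : Set V := {v | v ∈ B ∧ v ∉ X ∧ ∀ i ∈ I, v ∉ Y i}
  -- each set has an exit through a component of the rest
  have hex : ∀ i, ∃ w o q, i ∈ I → w ∈ Y i ∧ w ≠ y i ∧ o ∈ O ∧ G.Adj w o ∧
      q ∈ B ∧ q ∉ Y i ∧ q ∉ O ∧ ∃ d ∈ compIn G O o, G.Adj d q := by
    intro i
    by_cases hi : i ∈ I
    swap
    · obtain ⟨x, hx⟩ := hX.nonempty
      exact ⟨x, x, x, fun h => absurd h hi⟩
    have his := hIs i hi
    by_contra! hcon
    obtain ⟨z, hz, hzy⟩ : ∃ z ∈ Y i, z ≠ y i := (hnt i his).exists_ne (y i)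
    have hBy := hB.2.2 (y i) (hYB i his (hyY i hi))
    -- Without an exit, `Y i` minus its contact vertex together with the components of `O` reached
    -- from there would be closed in the connected set `B \ {y i}`, and would therefore contain `X`.
    let S : Set V := (Y i \ {y i}) ∪ {d | ∃ w o, w ∈ Y i ∧ w ≠ y i ∧ o ∈ O ∧ G.Adj w o ∧
      d ∈ compIn G O o}
    obtain ⟨x, hx⟩ := hX.nonempty
    have hxY : x ∉ Y i := fun h => (Set.disjoint_left.1 (hYX i his)) hx h
    have hcl : B \ {y i} ⊆ S := by
      refine hBy.subset_of_closed ⟨z, ⟨hYB i his hz, hzy⟩, Or.inl ⟨hz, hzy⟩⟩ ?_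
      rintro u (⟨hu, huy⟩ | ⟨w, o, hw, hwy, ho, e', hu⟩) v ⟨hv, hvy⟩ - e
      · by_cases hvY : v ∈ Y i
        · exact Or.inl ⟨hvY, hvy⟩
        · have hvO : v ∈ O := by
            refine ⟨hv, fun h => hyn i hi u hu huy v h e.symm, fun j hj hvj => ?_⟩
            have hij : i ≠ j := by rintro rfl; exact hvY hvj
            exact (hsep i his j (hIs j hj) hij).2 u hu v hvj e
          exact Or.inr ⟨u, v, hu, huy, hvO, e, mem_compIn_self hvO⟩
      · by_cases hvO : v ∈ O
        · exact Or.inr ⟨w, o, hw, hwy, ho, e', compIn_closed hu hvO e⟩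
        · by_cases hvY : v ∈ Y i
          · exact Or.inl ⟨hvY, hvy⟩
          · exact absurd e ((hcon w o v).2 hw hwy ho e' hv hvY hvO u hu)
    rcases hcl ⟨hXB hx, fun h => hxY (h ▸ hyY i hi)⟩ with h | ⟨w, o, -, -, -, -, h⟩
    · exact hxY h.1
    · exact (compIn_subset _ _ h).2.1 hx
  choose w o q hw using hex
  let D : ι → Set V := fun i => compIn G O (o i)
  -- An arc from `i` to `j` means that the exit component of `i` offers `Y j` a second contact.
  let touch : ι → ι → Prop := fun i j => ∃ v ∈ Y j, v ≠ y j ∧ ∃ d ∈ D i, G.Adj d v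
  have hDO : ∀ i, D i ⊆ O := fun i => compIn_subset _ _
  have hDX : ∀ i, Disjoint X (D i) := fun i => Set.disjoint_left.2 fun x hx hd => (hDO i hd).2.1 hx
  have hDY : ∀ i, ∀ j ∈ I, Disjoint (D i) (Y j) := fun i j hj =>
    Set.disjoint_left.2 fun x hd => (hDO i hd).2.2 j hj
  have hDconn : ∀ i ∈ I, Conn G (D i) := fun i hi => conn_compIn (hw i hi).2.2.1
  have hself : ∀ i ∈ I, touch i i := fun i hi =>
    ⟨w i, (hw i hi).1, (hw i hi).2.1, o i, mem_compIn_self (hw i hi).2.2.1, (hw i hi).2.2.2.1.symm⟩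
  -- More than `t` arcs from `i`, one being the loop, would make `t` sets `Y j` pieces attached to
  -- `X ∪ Y i ∪ D i`, with `y j` and the touched vertex as contacts.
  have hdeg : ∀ i ∈ I, (I.filter fun j => touch i j).card ≤ t := by
    intro i hi
    by_contra! hlt
    have hii : i ∈ I.filter fun j => touch i j := Finset.mem_filter.2 ⟨hi, hself i hi⟩
    have hlt' : t ≤ ((I.filter fun j => touch i j).erase i).card := by
      rw [Finset.card_erase_of_mem hii]; omega
    have hXY : Conn G (X ∪ Y i) := by
      obtain ⟨x, hx, v, hv, e⟩ := hadj i (hIs i hi)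
      exact hX.union_adj (hY i (hIs i hi)) hx hv e
    have hXYD : Conn G (X ∪ Y i ∪ D i) := by
      obtain ⟨v, hv, -, d, hd, e⟩ := hself i hi
      exact hXY.union_adj (hDconn i hi) (Or.inr hv) hd e.symm
    refine absurd (hG ι _ _ Y hXYD ?_ ?_) (not_lt.2 hlt')
    · intro j hj
      obtain ⟨hji, hj⟩ := Finset.mem_erase.1 hj
      obtain ⟨hj, v, hv, hvy, d, hd, e⟩ := Finset.mem_filter.1 hj
      obtain ⟨x, hx, e'⟩ := hyX j hj
      refine ⟨hY j (hIs j hj), ?_, y j, hyY j hj, v, hv, hvy.symm, ⟨x, Or.inl (Or.inl hx), e'⟩,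
        d, Or.inr hd, e⟩
      rw [Set.disjoint_union_left, Set.disjoint_union_left]
      exact ⟨⟨hYX j (hIs j hj), (hsep i (hIs i hi) j (hIs j hj) hji.symm).1⟩, hDY i j hj⟩
    · intro j hj k hk
      exact hsep j (hIs j (Finset.mem_filter.1 (Finset.mem_erase.1 hj).2).1) k
        (hIs k (Finset.mem_filter.1 (Finset.mem_erase.1 hk).2).1)
  obtain ⟨J, hJI, hJc, hJ⟩ := exists_independent_of_outdegree_le touch t t I hdeg hIcard
  -- the final fan
  let X' : Set V := X ∪ {v | ∃ i ∈ J, v = y i} ∪ {v | ∃ i ∈ I, i ∉ J ∧ v ∈ Y i}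
  have hX' : Conn G X' := by
    refine conn_of_cover hX (fun x hx => Or.inl (Or.inl hx)) ?_
    rintro v ((hv | ⟨i, hi, rfl⟩) | ⟨i, hi, hiJ, hv⟩)
    · exact ⟨X, fun x hx => Or.inl (Or.inl hx), hX, hv, v, hv, hv⟩
    · obtain ⟨x, hx, e⟩ := hyX i (hJI hi)
      refine ⟨{x, y i}, ?_, conn_pair e, by simp, x, by simp, hx⟩
      rintro z (rfl | rfl)
      exacts [Or.inl (Or.inl hx), Or.inl (Or.inr ⟨i, hi, rfl⟩)]
    · obtain ⟨x, hx, e⟩ := hyX i hi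
      refine ⟨insert x (Y i), ?_, (hY i (hIs i hi)).insert_adj (hyY i hi) e.symm, Or.inr hv, x,
        by simp, hx⟩
      rintro z (rfl | hz)
      exacts [Or.inl (Or.inl hx), Or.inr ⟨i, hi, hiJ, hz⟩]
  let W : ι → Set V := fun i => compIn G (Y i \ {y i}) (w i)
  have hWY : ∀ i, W i ⊆ Y i \ {y i} := fun i => compIn_subset _ _
  have hwS : ∀ i ∈ I, w i ∈ Y i \ {y i} := fun i hi => ⟨(hw i hi).1, (hw i hi).2.1⟩
  -- The piece of `i` sees `X'` from `W i` at `y i` and from `D i` at `q i`. Independence of `J`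
  -- puts `q i` into `X'` and keeps different pieces apart.
  refine absurd (hG ι J X' (fun i => W i ∪ D i) hX' ?_ ?_) (by omega)
  · intro i hiJ
    have hi := hJI hiJ
    obtain ⟨hwi, hwy, ho, e, hqB, hqY, hqO, d, hd, e'⟩ := hw i hi
    refine ⟨(conn_compIn (hwS i hi)).union_adj (hDconn i hi) (mem_compIn_self (hwS i hi))
      (mem_compIn_self ho) e, ?_, ?_⟩
    · rw [Set.disjoint_union_right]
      constructor <;> rw [Set.disjoint_right]
      · rintro v hv ((h | ⟨j, hj, rfl⟩) | ⟨j, hj, hjJ, h⟩)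
        · exact Set.disjoint_left.1 (hYX i (hIs i hi)) h (hWY i hv).1
        · by_cases hij : i = j
          · subst hij; exact (hWY i hv).2 rfl
          · exact Set.disjoint_left.1 (hsep i (hIs i hi) j (hIs j (hJI hj)) hij).1 (hWY i hv).1
              (hyY j (hJI hj))
        · have hij : i ≠ j := by rintro rfl; exact hjJ hiJ
          exact Set.disjoint_left.1 (hsep i (hIs i hi) j (hIs j hj) hij).1 (hWY i hv).1 h
      · rintro v hv ((h | ⟨j, hj, rfl⟩) | ⟨j, hj, hjJ, h⟩)
        · exact (hDO i hv).2.1 h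
        · exact (hDO i hv).2.2 j (hJI hj) (hyY j (hJI hj))
        · exact (hDO i hv).2.2 j hj h
    · obtain ⟨u, -, hu, v, hv, hvn, e2⟩ := (hY i (hIs i hi)).exists_adj hwi
        (mem_compIn_self (hwS i hi)) (hyY i hi)
        (fun h => (compIn_subset _ _ h).2 rfl : y i ∉ compIn G (Y i \ {y i}) (w i))
      have hvy : v = y i := by
        by_contra hne
        exact hvn (compIn_closed hu ⟨hv, hne⟩ e2)
      subst hvy
      refine ⟨u, Or.inl hu, d, Or.inr hd, ?_, ⟨y i, Or.inl (Or.inr ⟨i, hiJ, rfl⟩), e2.symm⟩,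
        q i, ?_, e'.symm⟩
      · rintro rfl
        exact (hDO i hd).2.2 i hi (hWY i hu).1
      · by_cases hqX : q i ∈ X
        · exact Or.inl (Or.inl hqX)
        obtain ⟨j, hj, hqj⟩ : ∃ j ∈ I, q i ∈ Y j := by
          by_contra! hcon
          exact hqO ⟨hqB, hqX, hcon⟩
        by_cases hjJ : j ∈ J
        · refine Or.inl (Or.inr ⟨j, hjJ, ?_⟩)
          by_contra hne
          have hij : i ≠ j := by rintro rfl; exact hqY hqj
          exact hJ i hiJ j hjJ hij ⟨q i, hqj, hne, d, hd, e'⟩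
        · exact Or.inr ⟨j, hj, hjJ, hqj⟩
  · intro i hiJ j hjJ hij
    have hi := hJI hiJ
    have hj := hJI hjJ
    have hDW : ∀ i ∈ J, ∀ j ∈ J, i ≠ j → Anticomplete G (D i) (W j) := fun i hi j hj hij =>
      ⟨(hDY i j (hJI hj)).mono_right fun v hv => (hWY j hv).1, fun a ha b hb e =>
        hJ i hi j hj hij ⟨b, (hWY j hb).1, (hWY j hb).2, a, ha, e⟩⟩
    have hDD : D i ≠ D j := by
      intro h
      obtain ⟨v, hv, hvy, d, hd, e⟩ := hself j hj
      exact hJ i hiJ j hjJ hij ⟨v, hv, hvy, d, h ▸ hd, e⟩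
    have hWW : Anticomplete G (W i) (W j) := (hsep i (hIs i hi) j (hIs j hj) hij).mono
      (fun v hv => (hWY i hv).1) fun v hv => (hWY j hv).1
    exact (hWW.union_right (hDW j hjJ i hiJ hij.symm).symm).union_left
      ((hDW i hiJ j hjJ hij).union_right (compIn_anticomplete hDD))

end ManyAttachments

/-! ### Large induced matchings force long geodesics -/

section Geodesics

variable {V : Type} {G : SimpleGraph V}

/-- The subgraph induced by `B` has an induced matching with `m` edges. -/
def HasIndMatching (G : SimpleGraph V) (B : Set V) (m : ℕ) : Prop :=
  ∃ x y : Fin m → V, (∀ i, x i ∈ B ∧ y i ∈ B ∧ G.Adj (x i) (y i)) ∧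
    ∀ i j, i ≠ j → ¬ G.Adj (x i) (x j) ∧ ¬ G.Adj (x i) (y j) ∧ ¬ G.Adj (y i) (y j)

theorem HasIndMatching.mono {B B' : Set V} {m : ℕ} (h : HasIndMatching G B m) (hB : B ⊆ B') :
    HasIndMatching G B' m := by
  obtain ⟨x, y, h1, h2⟩ := h
  exact ⟨x, y, fun i => ⟨hB (h1 i).1, hB (h1 i).2.1, (h1 i).2.2⟩, h2⟩

/-- The ball of radius `r` around `v` in the subgraph induced by `B`. -/
def ballIn (G : SimpleGraph V) (B : Set V) (v : V) : ℕ → Set V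
  | 0 => {v}
  | r + 1 => ballIn G B v r ∪ {y | y ∈ B ∧ ∃ x ∈ ballIn G B v r, G.Adj x y}

theorem conn_ballIn (B : Set V) (v : V) (r : ℕ) : Conn G (ballIn G B v r) := by
  induction r with
  | zero => exact conn_singleton v
  | succ r ih =>
    refine conn_of_cover ih Set.subset_union_left ?_
    rintro y (hy | ⟨hy, x, hx, e⟩)
    · exact ⟨_, Set.subset_union_left, ih, hy, y, hy, hy⟩
    · refine ⟨{x, y}, ?_, conn_pair e, by simp, x, by simp, hx⟩
      rintro z (rfl | rfl)
      exacts [Or.inl hx, Or.inr ⟨hy, x, hx, e⟩]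

theorem ballIn_subset {B : Set V} {v : V} (hv : v ∈ B) (r : ℕ) : ballIn G B v r ⊆ B := by
  induction r with
  | zero => simpa [ballIn] using hv
  | succ r ih =>
    rintro y (hy | hy)
    exacts [ih hy, hy.1]

theorem exists_mem_ballIn {B : Set V} (hB : Conn G B) {v x : V} (hv : v ∈ B) (hx : x ∈ B) :
    ∃ r, x ∈ ballIn G B v r := by
  have : B ⊆ {x | ∃ r, x ∈ ballIn G B v r} := by
    refine hB.subset_of_closed ⟨v, hv, 0, rfl⟩ ?_
    rintro x ⟨r, hr⟩ y hy - e
    exact ⟨r + 1, Or.inr ⟨hy, x, hr, e⟩⟩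
  exact this hx

/-- The sequence `p 0, …, p R` is a geodesic of the subgraph induced by `B`, certified by the
function `d`. -/
structure IsGeodesic (G : SimpleGraph V) (B : Set V) (R : ℕ) (d : V → ℕ) (p : ℕ → V) : Prop where
  lip : ∀ x ∈ B, ∀ y ∈ B, G.Adj x y → d y ≤ d x + 1
  mem : ∀ i ≤ R, p i ∈ B
  dist : ∀ i ≤ R, d (p i) = i
  adj : ∀ i < R, G.Adj (p i) (p (i + 1))

/-- If all distances from `v` were below `R`, the nearer ends of `4 * t ^ 2` matching edges would
lie in one layer `r`. For `r > 0` these edges hang on the ball of radius `r - 1`, against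
`FanFree.card_attached_lt`. -/
theorem FanFree.exists_geodesic {t : ℕ} (hG : FanFree G t) (ht : 1 ≤ t) {B : Set V}
    (hB : TwoConn G B) {R m : ℕ} (hR : 0 < R) (hm : R * (4 * t ^ 2) ≤ m)
    (hM : HasIndMatching G B m) : ∃ d p, IsGeodesic G B R d p := by
  classical
  obtain ⟨v, hv⟩ := hB.1.nonempty
  have hex : ∀ x, x ∈ B → ∃ r, x ∈ ballIn G B v r := fun x hx => exists_mem_ballIn hB.2.1 hv hx
  let d : V → ℕ := fun x => if hx : x ∈ B then Nat.find (hex x hx) else 0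
  have hd : ∀ x ∈ B, x ∈ ballIn G B v (d x) := by
    intro x hx
    simp only [d, dif_pos hx]
    exact Nat.find_spec (hex x hx)
  have hmin : ∀ x ∈ B, ∀ r, x ∈ ballIn G B v r → d x ≤ r := by
    intro x hx r hr
    simp only [d, dif_pos hx]
    exact Nat.find_min' _ hr
  have hlip : ∀ x ∈ B, ∀ y ∈ B, G.Adj x y → d y ≤ d x + 1 := fun x hx y hy e =>
    hmin y hy _ (Or.inr ⟨hy, x, hd x hx, e⟩)
  have hpath : ∀ r, ∀ x ∈ B, d x = r → ∃ p : ℕ → V, p r = x ∧ (∀ i ≤ r, p i ∈ B) ∧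
      (∀ i ≤ r, d (p i) = i) ∧ ∀ i < r, G.Adj (p i) (p (i + 1)) := by
    intro r
    induction r with
    | zero =>
      intro x hx hr
      refine ⟨fun _ => x, rfl, fun _ _ => hx, fun i hi => by simp [hr]; omega, by simp⟩
    | succ r ih =>
      intro x hx hr
      have h1 := hd x hx
      rw [hr] at h1
      rcases h1 with h1 | ⟨-, y, hy, e⟩
      · have := hmin x hx _ h1
        omega
      have hyB := ballIn_subset hv _ hy
      have hdy : d y = r := by
        have h2 := hmin y hyB _ hy
        have h3 := hlip y hyB x hx e
        omega
      obtain ⟨p, hp, h1, h2, h3⟩ := ih y hyB hdy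
      refine ⟨Function.update p (r + 1) x, by simp, fun i hi => ?_, fun i hi => ?_, fun i hi => ?_⟩
      · by_cases hir : i = r + 1
        · subst hir; simpa using hx
        · rw [Function.update_of_ne hir]; exact h1 i (by omega)
      · by_cases hir : i = r + 1
        · subst hir; simpa using hr
        · rw [Function.update_of_ne hir]; exact h2 i (by omega)
      · rw [Function.update_of_ne (by omega)]
        by_cases hir : i = r
        · subst hir; simpa [hp] using e
        · rw [Function.update_of_ne (by omega)]; exact h3 i (by omega)
  by_cases hfar : ∃ x ∈ B, R ≤ d x
  · obtain ⟨x, hx, hRx⟩ := hfar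
    obtain ⟨p, -, h1, h2, h3⟩ := hpath _ x hx rfl
    exact ⟨d, p, hlip, fun i hi => h1 i (by omega), fun i hi => h2 i (by omega),
      fun i hi => h3 i (by omega)⟩
  exfalso
  push Not at hfar
  obtain ⟨x, y, hxy, hne⟩ := hM
  let f : Fin m → ℕ := fun i => min (d (x i)) (d (y i))
  obtain ⟨r, hr, hcard⟩ := Finset.exists_le_card_fiber_of_mul_le_card_of_maps_to
    (s := (Finset.univ : Finset (Fin m))) (t := Finset.range R) (f := f) (n := 4 * t ^ 2)
    (fun i _ => Finset.mem_range.2 ((min_le_left _ _).trans_lt (hfar _ (hxy i).1)))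
    ⟨0, Finset.mem_range.2 hR⟩ (by simpa using hm)
  have hdis : ∀ i j, i ≠ j → x i ≠ x j ∧ x i ≠ y j ∧ y i ≠ y j := by
    intro i j hij
    refine ⟨fun h => (hne i j hij).2.1 (h ▸ (hxy j).2.2), fun h => (hne i j hij).1 ?_,
      fun h => (hne i j hij).2.1 (h ▸ (hxy i).2.2)⟩
    rw [h]; exact (hxy j).2.2.symm
  have hanti : ∀ i j, i ≠ j → Anticomplete G {x i, y i} {x j, y j} := by
    intro i j hij
    have h1 := hne i j hij
    have h2 := hne j i hij.symm
    have h3 := hdis i j hij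
    have h4 := hdis j i hij.symm
    constructor
    · rw [Set.disjoint_left]
      rintro z (rfl | rfl) (h | h)
      exacts [h3.1 h, h3.2.1 h, h4.2.1 h.symm, h3.2.2 h]
    · rintro a (rfl | rfl) b (rfl | rfl) e
      exacts [h1.1 e, h1.2.1 e, h2.2.1 e.symm, h1.2.2 e]
  rcases Nat.eq_zero_or_pos r with rfl | hr0
  -- Layer 0 is the single vertex `v`, which lies on at most one matching edge.
  · have h4 : 1 < (Finset.univ.filter fun i => f i = 0).card := by nlinarith
    obtain ⟨i, hi, j, hj, hij⟩ := Finset.one_lt_card.1 h4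
    have hz : ∀ i, f i = 0 → v ∈ ({x i, y i} : Set V) := by
      intro i hi
      rcases Nat.min_eq_zero_iff.1 hi with h | h
      · have := hd _ (hxy i).1
        rw [h] at this
        exact Or.inl (Set.mem_singleton_iff.1 this).symm
      · have := hd _ (hxy i).2.1
        rw [h] at this
        exact Or.inr (Set.mem_singleton_iff.1 this).symm
    exact Set.disjoint_left.1 (hanti i j hij).1 (hz i (Finset.mem_filter.1 hi).2)
      (hz j (Finset.mem_filter.1 hj).2)
  · obtain ⟨r, rfl⟩ : ∃ k, r = k + 1 := ⟨r - 1, by omega⟩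
    refine absurd (hG.card_attached_lt ht hB (conn_ballIn B v r) (ballIn_subset hv r)
      (Finset.univ.filter fun i => f i = r + 1) (fun i => {x i, y i})
      (fun i _ => conn_pair (hxy i).2.2) (fun i _ => ?_) (fun i hi => ?_) (fun i _ => ?_)
      (fun i hi => ?_) (fun i _ j _ hij => hanti i j hij)) (not_lt.2 hcard)
    · rintro z (rfl | rfl)
      exacts [(hxy i).1, (hxy i).2.1]
    · have hi := (Finset.mem_filter.1 hi).2
      rw [Set.disjoint_right]
      rintro z (rfl | rfl) hz
      · have h1 := hmin _ (hxy i).1 _ hz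
        have h2 : f i ≤ d (x i) := min_le_left _ _
        omega
      · have h1 := hmin _ (hxy i).2.1 _ hz
        have h2 : f i ≤ d (y i) := min_le_right _ _
        omega
    · exact Set.nontrivial_pair (hxy i).2.2.ne
    · have hi := (Finset.mem_filter.1 hi).2
      have hstep : ∀ z ∈ B, d z = r + 1 → ∃ u ∈ ballIn G B v r, G.Adj u z := by
        intro z hz hdz
        have h1 := hd z hz
        rw [hdz] at h1
        rcases h1 with h1 | ⟨-, h1⟩
        · have := hmin z hz _ h1
          omega
        · exact h1
      rcases min_choice (d (x i)) (d (y i)) with h | h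
      · obtain ⟨u, hu, e⟩ := hstep _ (hxy i).1 (h.symm.trans hi)
        exact ⟨u, hu, _, by simp, e⟩
      · obtain ⟨u, hu, e⟩ := hstep _ (hxy i).2.1 (h.symm.trans hi)
        exact ⟨u, hu, _, by simp, e⟩

namespace IsGeodesic

variable {B : Set V} {R : ℕ} {d : V → ℕ} {p : ℕ → V}

theorem inj (h : IsGeodesic G B R d p) {i j : ℕ} (hi : i ≤ R) (hj : j ≤ R) (e : p i = p j) :
    i = j := by
  rw [← h.dist i hi, ← h.dist j hj, e]

theorem le_of_adj (h : IsGeodesic G B R d p) {i j : ℕ} (hi : i ≤ R) (hj : j ≤ R)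
    (e : G.Adj (p i) (p j)) : j ≤ i + 1 := by
  have := h.lip _ (h.mem i hi) _ (h.mem j hj) e
  rwa [h.dist i hi, h.dist j hj] at this

theorem near (h : IsGeodesic G B R d p) {x : V} (hx : x ∈ B) {i : ℕ} (hi : i ≤ R)
    (e : G.Adj x (p i)) : i ≤ d x + 1 ∧ d x ≤ i + 1 := by
  have h1 := h.lip _ hx _ (h.mem i hi) e
  have h2 := h.lip _ (h.mem i hi) _ hx e.symm
  rw [h.dist i hi] at h1 h2
  exact ⟨h1, h2⟩

theorem anticomplete_segments (h : IsGeodesic G B R d p) {a b a' b' : ℕ} (h1 : b + 2 ≤ a')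
    (h2 : b' ≤ R) : Anticomplete G (p '' Set.Icc a b) (p '' Set.Icc a' b') := by
  constructor
  · rw [Set.disjoint_left]
    rintro _ ⟨i, hi, rfl⟩ ⟨j, hj, e⟩
    have := h.inj (by have := hj.2; omega) (by have := hi.2; have := hj.1; have := hj.2; omega) e
    have := hi.2; have := hj.1; omega
  · rintro _ ⟨i, hi, rfl⟩ _ ⟨j, hj, rfl⟩ e
    have := h.le_of_adj (by have := hi.2; have := hj.1; have := hj.2; omega)
      (by have := hj.2; omega) e
    have := hi.2; have := hj.1; omega

end IsGeodesic

end Geodesics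

/-! ### Clean windows on a geodesic -/

section Windows

variable {V : Type} {G : SimpleGraph V}

/-- The vertices of `B` outside `P` all of whose neighbours in `B` lie in `P`. -/
def pendants (G : SimpleGraph V) (B P : Set V) : Set V :=
  {x | x ∈ B ∧ x ∉ P ∧ ∀ y ∈ B, G.Adj x y → y ∈ P}

/-- If only one vertex `u` of the component saw `P`, then `u` would be a cut vertex of `B` unless
the component is just `{u}`; in that case `x = u` is a pendant. -/
theorem isPiece_compIn {B P : Set V} (hB : TwoConn G B) (hP : Conn G P) (hPB : P ⊆ B)
    {x : V} (hx : x ∈ B \ P) (hxs : x ∉ pendants G B P) :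
    IsPiece G P (compIn G (B \ P) x) := by
  have hDs := compIn_subset (G := G) (B \ P) x
  refine ⟨conn_compIn hx, Set.disjoint_left.2 fun y hy hyD => (hDs hyD).2 hy, ?_⟩
  obtain ⟨q, hq⟩ := hP.nonempty
  have hqD : q ∉ compIn G (B \ P) x := fun h => (hDs h).2 hq
  obtain ⟨u, -, hu, v, hv, hvn, e⟩ := hB.2.1.exists_adj hx.1 (mem_compIn_self hx) (hPB hq) hqD
  have hvP : v ∈ P := by
    by_contra hvP
    exact hvn (compIn_closed hu ⟨hv, hvP⟩ e)
  by_contra hcon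
  have hno : ∀ w ∈ compIn G (B \ P) x, w ≠ u → ∀ y ∈ P, ¬ G.Adj w y := fun w hw hwu y hy e' =>
    hcon ⟨w, hw, u, hu, hwu, ⟨y, hy, e'.symm⟩, v, hvP, e.symm⟩
  have huB := (hDs hu).1
  have hall : ∀ w ∈ compIn G (B \ P) x, w = u := by
    intro w hw
    by_contra hwu
    have hqu : q ≠ u := fun h => hqD (h ▸ hu)
    obtain ⟨a, ha, haD, b, hb, hbD, e'⟩ := (hB.2.2 u huB).exists_adj ⟨(hDs hw).1, hwu⟩ hw
      ⟨hPB hq, hqu⟩ hqD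
    by_cases hbP : b ∈ P
    · exact hno a haD ha.2 b hbP e'
    · exact hbD (compIn_closed haD ⟨hb.1, hbP⟩ e')
  have hxu := hall x (mem_compIn_self hx)
  refine hxs ⟨hx.1, hx.2, fun y hy e' => ?_⟩
  by_contra hyP
  have := hall y (compIn_closed (mem_compIn_self hx) ⟨hy, hyP⟩ e')
  rw [this, hxu] at e'
  exact e'.ne rfl

/-- The position `i` lies in the window with number `j`. -/
def InWindow (j i : ℕ) : Prop := 12 * j + 1 ≤ i ∧ i ≤ 12 * j + 10

namespace IsGeodesic

variable {B : Set V} {N t : ℕ} {d : V → ℕ} {p : ℕ → V}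

theorem conn_path {R : ℕ} (h : IsGeodesic G B R d p) : Conn G (p '' Set.Icc 0 R) :=
  conn_image_Icc (Nat.zero_le R) fun i _ hi => h.adj i hi

/-- Few windows have neighbours off the path that are not pendant. -/
theorem card_touched_lt (hG : FanFree G t) (ht : 1 ≤ t) (hB : TwoConn G B)
    (h : IsGeodesic G B (12 * N) d p) (J : Finset ℕ) (hJN : ∀ j ∈ J, j < N)
    (hJ : ∀ j ∈ J, ∃ i, InWindow j i ∧ ∃ x ∈ B, x ∉ p '' Set.Icc 0 (12 * N) ∧
      x ∉ pendants G B (p '' Set.Icc 0 (12 * N)) ∧ G.Adj x (p i)) : J.card < 2 * t * t := by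
  classical
  set P := p '' Set.Icc 0 (12 * N) with hPdef
  have hP : Conn G P := h.conn_path
  have hPB : P ⊆ B := by
    rintro _ ⟨i, hi, rfl⟩
    exact h.mem i hi.2
  have hpP : ∀ i ≤ 12 * N, p i ∈ P := fun i hi => ⟨i, ⟨Nat.zero_le _, hi⟩, rfl⟩
  have : Nonempty V := ⟨p 0⟩
  choose! i hi x hxB hxP hxs hxi using hJ
  let D : ℕ → Set V := fun j => compIn G (B \ P) (x j)
  -- The components in question are pieces attached to the path.
  have himg : (J.image D).card < t := by
    refine hG (Set V) _ P id hP ?_ ?_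
    · intro C hC
      obtain ⟨j, hj, rfl⟩ := Finset.mem_image.1 hC
      exact isPiece_compIn hB hP hPB ⟨hxB j hj, hxP j hj⟩ (hxs j hj)
    · intro C hC C' hC' hne
      obtain ⟨j, hj, rfl⟩ := Finset.mem_image.1 hC
      obtain ⟨k, hk, rfl⟩ := Finset.mem_image.1 hC'
      exact compIn_anticomplete hne
  by_contra! hcard
  have hJne : J.Nonempty := Finset.card_pos.1 (by nlinarith)
  -- Some component is seen from `2 * t` windows. Pairing these contacts in order cuts out `t`
  -- segments of the path, which are pieces attached to that component.
  obtain ⟨C, hC, hfib⟩ := Finset.exists_le_card_fiber_of_mul_le_card_of_maps_to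
    (s := J) (t := J.image D) (f := D) (n := 2 * t) (fun j hj => Finset.mem_image_of_mem _ hj)
    (hJne.image D) (by nlinarith)
  obtain ⟨K, hKs, hKc⟩ := Finset.exists_subset_card_eq hfib
  have hKJ : ∀ j ∈ K, j ∈ J ∧ D j = C := fun j hj => by simpa using hKs hj
  let e := K.orderEmbOfFin hKc
  have heK : ∀ k, e k ∈ K := fun k => Finset.orderEmbOfFin_mem K hKc k
  let a : ℕ → ℕ := fun k => if hk : k < 2 * t then i (e ⟨k, hk⟩) else 0
  have haC : ∀ k < 2 * t, a k ≤ 12 * N ∧ ∃ y ∈ C, G.Adj y (p (a k)) := by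
    intro k hk
    obtain ⟨h1, h2⟩ := hKJ _ (heK ⟨k, hk⟩)
    simp only [a, dif_pos hk]
    have h3 := (hi _ h1).2
    have h4 := hJN _ h1
    refine ⟨by omega, x (e ⟨k, hk⟩), h2 ▸ mem_compIn_self ⟨hxB _ h1, hxP _ h1⟩, hxi _ h1⟩
  have hmono : ∀ k l, k < l → l < 2 * t → a k + 2 ≤ a l := by
    intro k l hkl hl
    have hk : k < 2 * t := by omega
    simp only [a, dif_pos hk, dif_pos hl]
    have h1 := (hi _ (hKJ _ (heK ⟨k, hk⟩)).1).2
    have h2 := (hi _ (hKJ _ (heK ⟨l, hl⟩)).1).1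
    have h3 : e ⟨k, hk⟩ < e ⟨l, hl⟩ := e.strictMono hkl
    omega
  obtain ⟨j0, hj0, rfl⟩ := Finset.mem_image.1 hC
  have hsepP : ∀ k l, k < l → l < t → Anticomplete G (p '' Set.Icc (a (2 * k)) (a (2 * k + 1)))
      (p '' Set.Icc (a (2 * l)) (a (2 * l + 1))) := fun k l hkl hl =>
    h.anticomplete_segments (hmono _ _ (by omega) (by omega)) (haC _ (by omega)).1
  refine absurd (hG ℕ (Finset.range t) (D j0)
    (fun k => p '' Set.Icc (a (2 * k)) (a (2 * k + 1)))
    (conn_compIn ⟨hxB _ hj0, hxP _ hj0⟩) ?_ ?_) (by simp)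
  · intro k hk
    have hk := Finset.mem_range.1 hk
    have h1 := haC (2 * k) (by omega)
    have h2 := haC (2 * k + 1) (by omega)
    have h3 := hmono (2 * k) (2 * k + 1) (by omega) (by omega)
    refine ⟨conn_image_Icc (by omega) fun l hl1 hl2 => h.adj l (by omega), ?_,
      _, ⟨a (2 * k), ⟨le_rfl, by omega⟩, rfl⟩, _, ⟨a (2 * k + 1), ⟨by omega, le_rfl⟩, rfl⟩, ?_,
      h1.2, h2.2⟩
    · rw [Set.disjoint_left]
      rintro _ hD ⟨l, hl, rfl⟩
      exact (compIn_subset _ _ hD).2 (hpP l (by have := hl.2; omega))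
    · intro e'
      have := h.inj h1.1 h2.1 e'
      omega
  · intro k hk l hl hkl
    have hk := Finset.mem_range.1 hk
    have hl := Finset.mem_range.1 hl
    rcases lt_or_gt_of_ne hkl with h' | h'
    · exact hsepP k l h' hl
    · exact (hsepP l k h' hk).symm

/-- Few windows are close to a given set. -/
theorem card_near_le (h : IsGeodesic G B (12 * N) d p) (F : Finset V) (hFB : ∀ f ∈ F, f ∈ B)
    (J : Finset ℕ) (hJN : ∀ j ∈ J, j < N)
    (hJ : ∀ j ∈ J, ∃ i, InWindow j i ∧ ∃ f ∈ F, f = p i ∨ G.Adj f (p i)) :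
    J.card ≤ F.card := by
  have : Nonempty V := ⟨p 0⟩
  choose! i hi f hf hfi using hJ
  refine Finset.card_le_card_of_injOn f hf fun j hj k hk e => ?_
  -- Positions close to the same `f` differ by at most 2, whereas positions in different windows
  -- differ by at least 3; so `f` determines the window.
  have key : ∀ j ∈ J, i j ≤ d (f j) + 1 ∧ d (f j) ≤ i j + 1 := by
    intro j hj
    have hij : i j ≤ 12 * N := by
      have := (hi j hj).2
      have := hJN j hj
      omega
    rcases hfi j hj with h1 | h1
    · rw [h1, h.dist _ hij]; omega
    · exact h.near (hFB _ (hf j hj)) hij h1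
  have h1 := key j hj
  have h2 := key k hk
  have e : f j = f k := e
  rw [e] at h1
  have h3 := hi j hj
  have h4 := hi k hk
  simp only [InWindow] at h3 h4
  omega

/-- Few windows have two consecutive positions both bypassed by pendant vertices. -/
theorem card_bypassed_lt (hG : FanFree G t) (h : IsGeodesic G B (12 * N) d p)
    (J : Finset ℕ) (hJN : ∀ j ∈ J, j < N)
    (hJ : ∀ j ∈ J, ∃ i, 12 * j + 1 ≤ i ∧ i + 3 ≤ 12 * j + 10 ∧
      (∃ x ∈ pendants G B (p '' Set.Icc 0 (12 * N)), G.Adj x (p i) ∧ G.Adj x (p (i + 2))) ∧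
      ∃ x ∈ pendants G B (p '' Set.Icc 0 (12 * N)), G.Adj x (p (i + 1)) ∧ G.Adj x (p (i + 3))) :
    J.card < t := by
  classical
  have : Nonempty V := ⟨p 0⟩
  choose! i hi1 hi2 hx hy using hJ
  choose! x hx using hx
  choose! y hy using hy
  have hiN : ∀ j ∈ J, i j + 3 ≤ 12 * N := fun j hj => by
    have := hi2 j hj
    have := hJN j hj
    omega
  have hi3 : ∀ j ∈ J, (i j + 2) / 12 = j := fun j hj => by
    have := hi1 j hj; have := hi2 j hj; omega
  -- Neighbours at positions `i j` and `i j + 2` force `d (x j) = i j + 1`.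
  obtain hx' : ∀ j ∈ J, i j + 1 ≤ d (x j) + 0 ∧ d (x j) ≤ i j + 1 := fun j hj => by
    have h1 := h.near (hx j hj).1.1 (by have := hiN j hj; omega) (hx j hj).2.1
    have h2 := h.near (hx j hj).1.1 (by have := hiN j hj; omega) (hx j hj).2.2
    omega
  obtain hy' : ∀ j ∈ J, d (y j) = i j + 2 := fun j hj => by
    have h1 := h.near (hy j hj).1.1 (by have := hiN j hj; omega) (hy j hj).2.1
    have h2 := h.near (hy j hj).1.1 (by have := hiN j hj; omega) (hy j hj).2.2
    omega
  have hfar : ∀ j ∈ J, ∀ k ∈ J, j ≠ k → i j + 4 < i k ∨ i k + 4 < i j := by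
    intro j hj k hk hjk
    have := hi1 j hj; have := hi2 j hj; have := hi1 k hk; have := hi2 k hk
    omega
  have hpP : ∀ i ≤ 12 * N, p i ∈ p '' Set.Icc 0 (12 * N) :=
    fun i hi => ⟨i, ⟨Nat.zero_le _, hi⟩, rfl⟩
  -- The path is rerouted through `y j` instead of `p (i j + 2)`; division by 12 recovers the window
  -- from the position. The vertex thus freed forms a piece with `x j`, the contacts being at `p (i
  -- j + 1)` and `p (i j)`.
  let q : ℕ → V := fun l => if l / 12 ∈ J ∧ l = i (l / 12) + 2 then y (l / 12) else p l
  have hqy : ∀ j ∈ J, q (i j + 2) = y j := by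
    intro j hj
    have : (i j + 2) / 12 ∈ J ∧ i j + 2 = i ((i j + 2) / 12) + 2 := by
      rw [hi3 j hj]; exact ⟨hj, rfl⟩
    simp only [q, if_pos this, hi3 j hj]
  have hqp : ∀ l, (∀ j ∈ J, l ≠ i j + 2) → q l = p l := fun l hl =>
    if_neg fun h => hl _ h.1 h.2
  have hq : ∀ l, (∃ j ∈ J, l = i j + 2 ∧ q l = y j) ∨ (∀ j ∈ J, l ≠ i j + 2) ∧ q l = p l := by
    intro l
    by_cases hl : ∃ j ∈ J, l = i j + 2
    · obtain ⟨j, hj, rfl⟩ := hl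
      exact Or.inl ⟨j, hj, rfl, hqy j hj⟩
    · push Not at hl
      exact Or.inr ⟨hl, hqp l hl⟩
  have hX : Conn G (q '' Set.Icc 0 (12 * N)) := by
    refine conn_image_Icc (Nat.zero_le _) fun l _ hl => ?_
    rcases hq l with ⟨j, hj, rfl, e⟩ | ⟨h1, e⟩
    · rw [e]
      have : q (i j + 2 + 1) = p (i j + 3) := hqp _ fun k hk e' => by
        by_cases hjk : j = k
        · subst hjk; omega
        · have := hfar j hj k hk hjk; omega
      rw [this]
      exact (hy j hj).2.2
    · rw [e]
      rcases hq (l + 1) with ⟨j, hj, e', e''⟩ | ⟨h1, e'⟩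
      · rw [e'']
        have : l = i j + 1 := by omega
        subst this
        exact (hy j hj).2.1.symm
      · rw [e']
        exact h.adj l hl
  have hanti : ∀ j ∈ J, ∀ k ∈ J, j ≠ k →
      Anticomplete G {x j, p (i j + 2)} {x k, p (i k + 2)} := by
    intro j hj k hk hjk
    have hjN := hiN j hj
    have hkN := hiN k hk
    have h1 := hfar j hj k hk hjk
    have h2 := hx' j hj
    have h3 := hx' k hk
    constructor
    · rw [Set.disjoint_left]
      rintro z (rfl | rfl) (h4 | h4)
      · rw [h4] at h2; omega
      · rw [h4, h.dist _ (by omega)] at h2; omega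
      · rw [← h4, h.dist _ (by omega)] at h3; omega
      · have := h.inj (by omega) (by omega) h4; omega
    · rintro a (rfl | rfl) b (rfl | rfl) e
      · exact (hx k hk).1.2.1 ((hx j hj).1.2.2 _ (hx k hk).1.1 e)
      · have := h.near (hx j hj).1.1 (by omega) e; omega
      · have := h.near (hx k hk).1.1 (by omega) e.symm; omega
      · have := h.le_of_adj (by omega) (by omega) e
        have := h.le_of_adj (by omega) (by omega) e.symm
        omega
  refine hG ℕ J _ (fun j => {x j, p (i j + 2)}) hX (fun j hj => ?_) hanti
  have hjN := hiN j hj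
  have hq0 : q (i j) = p (i j) := hqp _ fun k hk e => by
    by_cases hjk : j = k
    · subst hjk; omega
    · have := hfar j hj k hk hjk; omega
  have hq1 : q (i j + 1) = p (i j + 1) := hqp _ fun k hk e => by
    by_cases hjk : j = k
    · subst hjk; omega
    · have := hfar j hj k hk hjk; omega
  refine ⟨conn_pair (hx j hj).2.2, ?_, x j, by simp, p (i j + 2), by simp, ?_,
    ⟨p (i j), ⟨i j, ⟨Nat.zero_le _, by omega⟩, hq0⟩, (hx j hj).2.1.symm⟩,
    ⟨p (i j + 1), ⟨i j + 1, ⟨Nat.zero_le _, by omega⟩, hq1⟩, h.adj _ (by omega)⟩⟩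
  · rw [Set.disjoint_right]
    rintro z hz ⟨l, hl, e⟩
    rcases hq l with ⟨k, hk, rfl, e'⟩ | ⟨h1, e'⟩
    · rw [e'] at e
      rcases hz with rfl | rfl
      · have h1 := hy' k hk
        have h2 := hx' j hj
        rw [e] at h1
        by_cases hjk : j = k
        · subst hjk; omega
        · have := hfar j hj k hk hjk; omega
      · exact (hy k hk).1.2.1 (e ▸ hpP _ (by omega))
    · rw [e'] at e
      rcases hz with rfl | rfl
      · exact (hx j hj).1.2.1 (e ▸ hpP _ hl.2)
      · exact h1 j hj (h.inj hl.2 (by omega) e)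
  · intro e
    exact (hx j hj).1.2.1 (e ▸ hpP _ (by omega))

end IsGeodesic

end Windows

/-! ### Ears cut out of clean windows -/

section Ears

variable {V : Type} {G : SimpleGraph V}

/-- `W` is a connected part of `B` attached to the rest, which is connected, at `a` and `b` only,
such that deleting `c` separates `W` from the 2-connected parts with large induced matchings. -/
structure IsEar (G : SimpleGraph V) (B W : Set V) (a b c : V) (m : ℕ) : Prop where
  sub : W ⊆ B
  conn : Conn G W
  mem_c : c ∈ W
  mem_a : a ∈ B \ W
  mem_b : b ∈ B \ W
  contact : ∃ u ∈ W, ∃ v ∈ W, u ≠ v ∧ G.Adj a u ∧ G.Adj b v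
  nbr : ∀ w ∈ W, ∀ y ∈ B, y ∉ W → G.Adj w y → y = a ∨ y = b
  rest : Conn G (B \ W)
  avoid : ∀ B' ⊆ B \ {c}, TwoConn G B' → HasIndMatching G B' m → Disjoint B' W

/-- Two edges of an induced matching cannot be covered by the same vertex, and there are only `b + 1
- a` covering positions. -/
theorem not_hasIndMatching_of_cover {B : Set V} {p : ℕ → V} {a b m : ℕ} (hm : b + 1 - a < m)
    (h : ∀ x ∈ B, ∀ y ∈ B, G.Adj x y → ∃ l, a ≤ l ∧ l ≤ b ∧ (x = p l ∨ y = p l)) :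
    ¬ HasIndMatching G B m := by
  classical
  rintro ⟨x, y, hxy, hne⟩
  choose l hal hlb hl using fun i => h _ (hxy i).1 _ (hxy i).2.1 (hxy i).2.2
  have : (Finset.univ : Finset (Fin m)).card ≤ (Finset.Icc a b).card := by
    refine Finset.card_le_card_of_injOn l (fun i _ => by simpa using ⟨hal i, hlb i⟩) ?_
    intro i _ j _ hij
    by_contra hne'
    have h1 := hne i j hne'
    have h2 := hne j i (Ne.symm hne')
    have hi := hl i
    have hj := hl j
    rw [hij] at hi
    have ei := (hxy i).2.2
    have ej := (hxy j).2.2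
    rcases hi with hi | hi <;> rcases hj with hj | hj
    · rw [hi, ← hj] at h1; exact h1.2.1 ej
    · rw [hi, ← hj] at h1; exact h1.1 ej.symm
    · rw [hi, ← hj] at ei; exact h1.1 ei
    · rw [hi, ← hj] at ei; exact h1.2.1 ei
  simp at this
  omega

/-- The ear is the path strictly between `a` and `b` with the pendants attached there. As no pendant
jumps over `a`, `b` or `c`, the vertex `p c` separates the ear into a left part `Wl`, attached
outside at `p a` only, and a right part `Wr`, attached at `p b` only. -/
theorem IsGeodesic.exists_ear {B F : Set V} {R : ℕ} {d : V → ℕ} {p : ℕ → V} (hB : TwoConn G B)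
    (h : IsGeodesic G B R d p) {a b c m : ℕ} (hac : a + 1 < c) (hcb : c + 1 < b) (hbR : b ≤ R)
    (hm : b + 1 - a < m)
    (hp : ∀ l, a < l → l < b → ∀ x ∈ B, x ∉ p '' Set.Icc 0 R → G.Adj x (p l) →
      x ∈ pendants G B (p '' Set.Icc 0 R))
    (hbr : ∀ l, l = a ∨ l = b ∨ l = c → ∀ x ∈ pendants G B (p '' Set.Icc 0 R), ∀ i < l, ∀ k > l,
      k ≤ R → G.Adj x (p i) → ¬ G.Adj x (p k))
    (hF : ∀ l, a < l → l < b → ∀ f ∈ F, f ∈ B → f ≠ p l ∧ ¬ G.Adj f (p l)) :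
    ∃ W a' b' c', IsEar G B W a' b' c' m ∧ Disjoint W F := by
  set P := p '' Set.Icc 0 R with hPdef
  have hpP : ∀ i ≤ R, p i ∈ P := fun i hi => ⟨i, ⟨Nat.zero_le _, hi⟩, rfl⟩
  let W : Set V := {v | ∃ l, a < l ∧ l < b ∧ v = p l} ∪
    {v | v ∈ pendants G B P ∧ ∃ l, a < l ∧ l < b ∧ G.Adj v (p l)}
  have hWB : W ⊆ B := by
    rintro v (⟨l, h1, h2, rfl⟩ | ⟨h1, -⟩)
    exacts [h.mem l (by omega), h1.1]
  have hpW : ∀ l ≤ R, p l ∈ W → a < l ∧ l < b := by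
    rintro l hl (⟨k, h1, h2, e⟩ | ⟨h1, -⟩)
    · have := h.inj hl (by omega) e
      omega
    · exact absurd (hpP l hl) h1.2.1
  have hWp : ∀ l, a < l → l < b → p l ∈ W := fun l h1 h2 => Or.inl ⟨l, h1, h2, rfl⟩
  have haW : p a ∉ W := fun h' => by have := hpW a (by omega) h'; omega
  have hbW : p b ∉ W := fun h' => by have := hpW b (by omega) h'; omega
  have haB := h.mem a (by omega)
  have hbB := h.mem b (by omega)
  let Wl : Set V := {v | v ∈ W ∧ v ≠ p c ∧ ∃ i < c, v = p i ∨ v ∉ P ∧ G.Adj v (p i)}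
  let Wr : Set V := {v | v ∈ W ∧ v ≠ p c ∧ v ∉ Wl}
  have hpl : ∀ l, a < l → l < c → p l ∈ Wl := fun l h1 h2 => by
    refine ⟨hWp l h1 (by omega), fun e => ?_, l, h2, Or.inl rfl⟩
    have := h.inj (by omega) (by omega) e
    omega
  have hpr : ∀ l, c < l → l < b → p l ∈ Wr := by
    refine fun l h1 h2 => ⟨hWp l (by omega) h2, fun e => ?_, ?_⟩
    · have := h.inj (by omega) (by omega) e
      omega
    · rintro ⟨-, -, i, hi, e | ⟨e, -⟩⟩
      · have := h.inj (by omega) (by omega) e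
        omega
      · exact e (hpP l (by omega))
  have hxl : ∀ x ∈ W, x ∉ P → ∀ i < c, G.Adj x (p i) → x ∈ Wl := fun x hx hxP i hi e =>
    ⟨hx, fun e' => hxP (e' ▸ hpP c (by omega)), i, hi, Or.inr ⟨hxP, e⟩⟩
  have hxr : ∀ x ∈ W, x ∈ pendants G B P → ∀ i, c < i → i ≤ R → G.Adj x (p i) → x ∈ Wr := by
    intro x hx hxp i hi hiR e
    refine ⟨hx, fun e' => hxp.2.1 (e' ▸ hpP c (by omega)), ?_⟩
    rintro ⟨-, -, k, hk, e' | ⟨-, e'⟩⟩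
    · exact hxp.2.1 (e' ▸ hpP k (by omega))
    · exact hbr c (by simp) x hxp k hk i hi hiR e' e
  have hcl : ∀ x ∈ Wl, ∀ y ∈ B, y ≠ p c → G.Adj x y → y ∈ Wl ∨ y = p a := by
    rintro x ⟨hxW, hxc, hxi⟩ y hy hyc e
    rcases hxW with ⟨i, hi1, hi2, rfl⟩ | ⟨hxp, l, hl1, hl2, el⟩
    · have hic : i < c := by
        obtain ⟨k, hk, e' | ⟨e', -⟩⟩ := hxi
        · have := h.inj (by omega) (by omega) e'; omega
        · exact absurd (hpP i (by omega)) e'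
      by_cases hyP : y ∈ P
      · obtain ⟨k, hk, rfl⟩ := hyP
        have h1 := h.le_of_adj (by omega) hk.2 e
        have h2 := h.le_of_adj hk.2 (by omega) e.symm
        have hkc : k ≠ c := fun e' => hyc (by rw [e'])
        rcases eq_or_ne k a with rfl | hka
        · exact Or.inr rfl
        · exact Or.inl (hpl k (by omega) (by omega))
      · exact Or.inl (hxl y (Or.inr ⟨hp i hi1 hi2 y hy hyP e.symm, i, hi1, hi2, e.symm⟩) hyP i hic
          e.symm)
    · obtain ⟨i, hi, e' | ⟨-, e'⟩⟩ := hxi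
      · exact absurd (e' ▸ hpP i (by omega)) hxp.2.1
      obtain ⟨k, hk, rfl⟩ := hxp.2.2 y hy e
      have hkc : k ≠ c := fun e' => hyc (by rw [e'])
      have h1 : k < c := by
        by_contra hlt
        exact hbr c (by simp) x hxp i hi k (by omega) hk.2 e' e
      have h2 : a ≤ k := by
        by_contra hlt
        exact hbr a (by simp) x hxp k (by omega) l hl1 (by omega) e el
      rcases eq_or_ne k a with rfl | hka
      · exact Or.inr rfl
      · exact Or.inl (hpl k (by omega) h1)
  have hcr : ∀ x ∈ Wr, ∀ y ∈ B, y ≠ p c → G.Adj x y → y ∈ Wr ∨ y = p b := by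
    rintro x ⟨hxW, hxc, hxi⟩ y hy hyc e
    have hxW' := hxW
    rcases hxW with ⟨i, hi1, hi2, rfl⟩ | ⟨hxp, l, hl1, hl2, el⟩
    · have hic : c < i := by
        by_contra hlt
        have : i ≠ c := fun e' => hxc (by rw [e'])
        exact hxi (hpl i hi1 (by omega))
      by_cases hyP : y ∈ P
      · obtain ⟨k, hk, rfl⟩ := hyP
        have h1 := h.le_of_adj (by omega) hk.2 e
        have h2 := h.le_of_adj hk.2 (by omega) e.symm
        have hkc : k ≠ c := fun e' => hyc (by rw [e'])
        rcases eq_or_ne k b with rfl | hkb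
        · exact Or.inr rfl
        · exact Or.inl (hpr k (by omega) (by omega))
      · have hyp := hp i hi1 hi2 y hy hyP e.symm
        exact Or.inl (hxr y (Or.inr ⟨hyp, i, hi1, hi2, e.symm⟩) hyp i hic (by omega) e.symm)
    · obtain ⟨k, hk, rfl⟩ := hxp.2.2 y hy e
      have hkc : k ≠ c := fun e' => hyc (by rw [e'])
      have h1 : c < k := by
        by_contra hlt
        exact hxi (hxl x hxW' hxp.2.1 k (by omega) e)
      have h2 : k ≤ b := by
        by_contra hlt
        exact hbr b (by simp) x hxp l hl2 k (by omega) hk.2 el e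
      rcases eq_or_ne k b with rfl | hkb
      · exact Or.inr rfl
      · exact Or.inl (hpr k h1 (by omega))
  have hcW := hWp c (by omega) (by omega)
  have hsplit : ∀ w ∈ W, w = p c ∨ w ∈ Wl ∨ w ∈ Wr := fun w hw => by
    by_cases h1 : w = p c
    · exact Or.inl h1
    · by_cases h2 : w ∈ Wl
      exacts [Or.inr (Or.inl h2), Or.inr (Or.inr ⟨hw, h1, h2⟩)]
  have hnbr : ∀ w ∈ W, ∀ y ∈ B, y ∉ W → G.Adj w y → y = p a ∨ y = p b := by
    intro w hw y hy hyW e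
    have hyc : y ≠ p c := fun e' => hyW (e' ▸ hcW)
    rcases hsplit w hw with rfl | hw' | hw'
    · exfalso
      by_cases hyP : y ∈ P
      · obtain ⟨k, hk, rfl⟩ := hyP
        have h1 := h.le_of_adj (by omega) hk.2 e
        have h2 := h.le_of_adj hk.2 (by omega) e.symm
        exact hyW (hWp k (by omega) (by omega))
      · exact hyW (Or.inr ⟨hp c (by omega) (by omega) y hy hyP e.symm, c, by omega, by omega,
          e.symm⟩)
    · rcases hcl w hw' y hy hyc e with h1 | h1
      exacts [absurd h1.1 hyW, Or.inl h1]
    · rcases hcr w hw' y hy hyc e with h1 | h1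
      exacts [absurd h1.1 hyW, Or.inr h1]
  have hal : ∀ y ∈ W, G.Adj (p a) y → y ∈ Wl := by
    intro y hy e
    by_cases hyP : y ∈ P
    · obtain ⟨k, hk, rfl⟩ := hyP
      have h1 := h.le_of_adj (by omega) hk.2 e
      have h2 := hpW k hk.2 hy
      exact hpl k (by omega) (by omega)
    · exact hxl y hy hyP a (by omega) e.symm
  have hbl : ∀ y ∈ W, G.Adj (p b) y → y ∈ Wr := by
    rintro y hy e
    have hy' := hy
    rcases hy with ⟨k, h1, h2, rfl⟩ | ⟨hyp, -⟩
    · have h3 := h.le_of_adj (by omega) (by omega) e.symm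
      exact hpr k (by omega) (by omega)
    · exact hxr y hy' hyp b (by omega) hbR e.symm
  have hpc := h.mem c (by omega)
  have hac' : p a ≠ p c := fun e => haW (e ▸ hcW)
  have hbc' : p b ≠ p c := fun e => hbW (e ▸ hcW)
  refine ⟨W, p a, p b, p c, ⟨hWB, ?_, hcW, ⟨haB, haW⟩, ⟨hbB, hbW⟩, ?_, hnbr, ?_, ?_⟩, ?_⟩
  · have hseg : Conn G (p '' Set.Icc (a + 1) (b - 1)) :=
      conn_image_Icc (by omega) fun i h1 h2 => h.adj i (by omega)
    refine conn_of_cover hseg ?_ ?_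
    · rintro _ ⟨l, hl, rfl⟩
      exact hWp l (by have := hl.1; omega) (by have := hl.2; omega)
    · rintro x (⟨l, h1, h2, rfl⟩ | ⟨hx, l, h1, h2, e⟩)
      · exact ⟨{p l}, by simpa using hWp l h1 h2, conn_singleton _, rfl, p l, rfl, l,
          ⟨by omega, by omega⟩, rfl⟩
      · refine ⟨{x, p l}, ?_, conn_pair e, by simp, p l, by simp, l, ⟨by omega, by omega⟩, rfl⟩
        rintro z (rfl | rfl)
        exacts [Or.inr ⟨hx, l, h1, h2, e⟩, hWp l h1 h2]
  · refine ⟨p (a + 1), hWp _ (by omega) (by omega), p (b - 1), hWp _ (by omega) (by omega),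
      fun e => ?_, h.adj a (by omega), ?_⟩
    · have := h.inj (by omega) (by omega) e
      omega
    · have := h.adj (b - 1) (by omega)
      rw [Nat.sub_add_cancel (by omega)] at this
      exact this.symm
  · refine ⟨⟨p a, haB, haW⟩, fun A hAs hAne hAcl => hAs.antisymm ?_⟩
    have hBc := hB.2.2 (p c) hpc
    -- With both ends in `A`, the set `A ∪ W` is closed in `B`. With one end, `A` and the adjacent
    -- side of the ear are closed in the connected set `B \ {p c}`, which contains the other end.
    -- With none, `A` itself is closed in `B`.
    by_cases haA : p a ∈ A <;> by_cases hbA : p b ∈ A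
    · have : B ⊆ A ∪ W := by
        refine hB.2.1.subset_of_closed ⟨p a, haB, Or.inl haA⟩ ?_
        rintro x (hx | hx) y hy - e <;> by_cases hyW : y ∈ W
        · exact Or.inr hyW
        · exact Or.inl (hAcl x hx y ⟨hy, hyW⟩ e)
        · exact Or.inr hyW
        · rcases hnbr x hx y hy hyW e with rfl | rfl
          exacts [Or.inl haA, Or.inl hbA]
      exact fun x hx => (this hx.1).resolve_right hx.2
    · have : B \ {p c} ⊆ A ∪ Wl := by
        refine hBc.subset_of_closed ⟨p a, ⟨haB, hac'⟩, Or.inl haA⟩ ?_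
        rintro x (hx | hx) y ⟨hy, hyc⟩ - e
        · by_cases hyW : y ∈ W
          · rcases hnbr y hyW x (hAs hx).1 (hAs hx).2 e.symm with rfl | rfl
            · exact Or.inr (hal y hyW e)
            · exact absurd hx hbA
          · exact Or.inl (hAcl x hx y ⟨hy, hyW⟩ e)
        · rcases hcl x hx y hy hyc e with h1 | rfl
          exacts [Or.inr h1, Or.inl haA]
      rcases this ⟨hbB, hbc'⟩ with h1 | h1
      exacts [absurd h1 hbA, absurd h1.1 hbW]
    · have : B \ {p c} ⊆ A ∪ Wr := by
        refine hBc.subset_of_closed ⟨p b, ⟨hbB, hbc'⟩, Or.inl hbA⟩ ?_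
        rintro x (hx | hx) y ⟨hy, hyc⟩ - e
        · by_cases hyW : y ∈ W
          · rcases hnbr y hyW x (hAs hx).1 (hAs hx).2 e.symm with rfl | rfl
            · exact absurd hx haA
            · exact Or.inr (hbl y hyW e)
          · exact Or.inl (hAcl x hx y ⟨hy, hyW⟩ e)
        · rcases hcr x hx y hy hyc e with h1 | rfl
          exacts [Or.inr h1, Or.inl hbA]
      rcases this ⟨haB, hac'⟩ with h1 | h1
      exacts [absurd h1 haA, absurd h1.1 haW]
    · obtain ⟨z, hz⟩ := hAne
      have : B ⊆ A := by
        refine hB.2.1.subset_of_closed ⟨z, (hAs hz).1, hz⟩ ?_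
        rintro x hx y hy - e
        by_cases hyW : y ∈ W
        · rcases hnbr y hyW x (hAs hx).1 (hAs hx).2 e.symm with rfl | rfl
          exacts [absurd hx haA, absurd hx hbA]
        · exact hAcl x hx y ⟨hy, hyW⟩ e
      exact absurd (this haB) haA
  · intro B' hB'B hB' hM
    by_contra hdis
    obtain ⟨z, hzB, hzW⟩ := Set.not_disjoint_iff.1 hdis
    -- Pendants are pairwise non-adjacent, so all edges of such a `B'` meet the path between `a` and
    -- `b`, which is too short for `m` matching edges.
    have hcover : ∀ S ⊆ W, ∀ q, (q = a ∨ q = b) → B' ⊆ insert (p q) S → False := by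
      intro S hS q hq hBS
      refine not_hasIndMatching_of_cover (p := p) hm ?_ hM
      have hcase : ∀ x ∈ B', (∃ l, a ≤ l ∧ l ≤ b ∧ x = p l) ∨ x ∈ pendants G B P := by
        intro x hx
        rcases hBS hx with rfl | hx
        · exact Or.inl ⟨q, by omega, by omega, rfl⟩
        · rcases hS hx with ⟨l, h1, h2, rfl⟩ | ⟨h1, -⟩
          exacts [Or.inl ⟨l, h1.le, h2.le, rfl⟩, Or.inr h1]
      intro x hx y hy e
      rcases hcase x hx with ⟨l, h1, h2, rfl⟩ | hx'
      · exact ⟨l, h1, h2, Or.inl rfl⟩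
      rcases hcase y hy with ⟨l, h1, h2, rfl⟩ | hy'
      · exact ⟨l, h1, h2, Or.inr rfl⟩
      exact absurd (hx'.2.2 y hy'.1 e) hy'.2.1
    have hside : ∀ S ⊆ W, ∀ q, (q = a ∨ q = b) → z ∈ S → p q ∉ W →
        (∀ x ∈ S, ∀ y ∈ B, y ≠ p c → G.Adj x y → y ∈ S ∨ y = p q) → False := by
      intro S hS q hq hzS hqW hS'
      -- `B'` remains connected without `p q` and avoids `p c`, so it cannot leave the side
      -- containing `z`.
      have hsub : B' \ {p q} ⊆ S := by
        have hconn : Conn G (B' \ {p q}) := by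
          by_cases hqB : p q ∈ B'
          · exact hB'.2.2 _ hqB
          · rw [Set.sdiff_singleton_eq_self hqB]
            exact hB'.2.1
        refine hconn.subset_of_closed ⟨z, ⟨hzB, fun e => hqW ?_⟩, hzS⟩ ?_
        · have e : z = p q := e
          exact e ▸ hzW
        · rintro x hx y ⟨hy, hyq⟩ - e
          exact (hS' x hx y (hB'B hy).1 (hB'B hy).2 e).resolve_right hyq
      refine hcover S hS q hq fun x hx => ?_
      by_cases hxq : x = p q
      exacts [Or.inl hxq, Or.inr (hsub ⟨hx, hxq⟩)]
    rcases hsplit z hzW with h1 | h1 | h1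
    · exact (hB'B hzB).2 h1
    · exact hside Wl (fun x hx => hx.1) a (Or.inl rfl) h1 haW hcl
    · exact hside Wr (fun x hx => hx.1) b (Or.inr rfl) h1 hbW hcr
  · rw [Set.disjoint_left]
    rintro x (⟨l, h1, h2, rfl⟩ | ⟨hx, l, h1, h2, e⟩) hxF
    · exact (hF l h1 h2 _ hxF (h.mem l (by omega))).1 rfl
    · exact (hF l h1 h2 _ hxF hx.1).2 e

/-- Of `6 * t ^ 2` windows, fewer than `2 * t ^ 2` are touched by non-pendants, at most `2 * t` are
near `F`, and fewer than `t` have two consecutive bypassed positions. Any other window contains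
three positions over which no pendant jumps, to serve as ends and middle of the ear. -/
theorem FanFree.exists_ear {t m : ℕ} (hG : FanFree G t) (ht : 1 ≤ t) {B : Set V}
    (hB : TwoConn G B) (hm : 288 * t ^ 4 ≤ m) (hM : HasIndMatching G B m) (F : Finset V)
    (hFB : ∀ f ∈ F, f ∈ B) (hF : F.card ≤ 2 * t) :
    ∃ W a b c, IsEar G B W a b c m ∧ Disjoint W (F : Set V) := by
  classical
  have ht2 : t ≤ t ^ 2 := by nlinarith
  -- The constant 288 is 12 · 6 · 4: window period, number of windows and edges per layer, the last
  -- two up to the factor `t ^ 2`.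
  obtain ⟨d, p, h⟩ := hG.exists_geodesic ht hB (R := 12 * (6 * t ^ 2)) (by nlinarith)
    (by calc 12 * (6 * t ^ 2) * (4 * t ^ 2) = 288 * t ^ 4 := by ring
          _ ≤ m := hm) hM
  set N := 6 * t ^ 2 with hN
  set P := p '' Set.Icc 0 (12 * N) with hPdef
  let touched : ℕ → Prop := fun j => ∃ i, InWindow j i ∧ ∃ x ∈ B, x ∉ P ∧ x ∉ pendants G B P ∧
    G.Adj x (p i)
  let near : ℕ → Prop := fun j => ∃ i, InWindow j i ∧ ∃ f ∈ F, f = p i ∨ G.Adj f (p i)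
  let by2 : ℕ → Prop := fun j => ∃ i, 12 * j + 1 ≤ i ∧ i + 3 ≤ 12 * j + 10 ∧
      (∃ x ∈ pendants G B P, G.Adj x (p i) ∧ G.Adj x (p (i + 2))) ∧
      ∃ x ∈ pendants G B P, G.Adj x (p (i + 1)) ∧ G.Adj x (p (i + 3))
  have h1 := h.card_touched_lt hG ht hB ((Finset.range N).filter touched)
    (fun j hj => Finset.mem_range.1 (Finset.mem_filter.1 hj).1)
    (fun j hj => (Finset.mem_filter.1 hj).2)
  have h2 := h.card_near_le F hFB ((Finset.range N).filter near)
    (fun j hj => Finset.mem_range.1 (Finset.mem_filter.1 hj).1)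
    (fun j hj => (Finset.mem_filter.1 hj).2)
  have h3 := h.card_bypassed_lt hG ((Finset.range N).filter by2)
    (fun j hj => Finset.mem_range.1 (Finset.mem_filter.1 hj).1)
    (fun j hj => (Finset.mem_filter.1 hj).2)
  obtain ⟨j, hjN, hj1, hj2, hj3⟩ : ∃ j < N, ¬ touched j ∧ ¬ near j ∧ ¬ by2 j := by
    by_contra! hcon
    have hsub : Finset.range N ⊆ (Finset.range N).filter touched ∪
        ((Finset.range N).filter near ∪ (Finset.range N).filter by2) := by
      intro j hj
      have := hcon j (Finset.mem_range.1 hj)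
      simp only [Finset.mem_union, Finset.mem_filter, hj, true_and]
      exact or_iff_not_imp_left.2 fun h4 => or_iff_not_imp_left.2 (this h4)
    have h4 := Finset.card_le_card hsub
    have h5 := Finset.card_union_le ((Finset.range N).filter touched)
      ((Finset.range N).filter near ∪ (Finset.range N).filter by2)
    have h6 := Finset.card_union_le ((Finset.range N).filter near) ((Finset.range N).filter by2)
    have h7 : 2 * t * t = 2 * t ^ 2 := by ring
    rw [Finset.card_range] at h4
    omega
  -- The position jumped over is `i + 1`, hence the shift by one when `a`, `b`, `c` are passed on.
  let Br : ℕ → Prop := fun i => ∃ x ∈ pendants G B P, G.Adj x (p i) ∧ G.Adj x (p (i + 2))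
  have hpick : ∀ i, 12 * j + 1 ≤ i → i + 3 ≤ 12 * j + 10 → ∃ l, i ≤ l ∧ l ≤ i + 1 ∧ ¬ Br l := by
    intro i hi1 hi2
    by_contra! hcon
    exact hj3 ⟨i, hi1, hi2, hcon i le_rfl (by omega), hcon (i + 1) (by omega) le_rfl⟩
  obtain ⟨a, ha1, ha2, ha⟩ := hpick (12 * j + 1) (by omega) (by omega)
  obtain ⟨c, hc1, hc2, hc⟩ := hpick (12 * j + 4) (by omega) (by omega)
  obtain ⟨b, hb1, hb2, hb⟩ := hpick (12 * j + 7) (by omega) (by omega)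
  have hm' : 288 ≤ m := by
    have : 1 ≤ t ^ 4 := Nat.one_le_pow _ _ ht
    omega
  have hbr : ∀ l, ¬ Br l → ∀ x ∈ pendants G B P, ∀ i < l + 1, ∀ k > l + 1, k ≤ 12 * N →
      G.Adj x (p i) → ¬ G.Adj x (p k) := by
    intro l hl x hx i hi k hk hkN e1 e2
    have h4 := h.near hx.1 (by omega) e1
    have h5 := h.near hx.1 hkN e2
    obtain rfl : i = l := by omega
    obtain rfl : k = i + 2 := by omega
    exact hl ⟨x, hx, e1, e2⟩
  refine h.exists_ear hB (a := a + 1) (b := b + 1) (c := c + 1) (by omega) (by omega) (by omega)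
    (by omega) ?_ ?_ ?_
  · intro l hl1 hl2 x hx hxP e
    by_contra hxp
    exact hj1 ⟨l, ⟨by omega, by omega⟩, x, hx, hxP, hxp, e⟩
  · rintro l (rfl | rfl | rfl)
    exacts [hbr a ha, hbr b hb, hbr c hc]
  · intro l hl1 hl2 f hf _
    constructor <;> intro e
    · exact hj2 ⟨l, ⟨by omega, by omega⟩, f, hf, Or.inl e⟩
    · exact hj2 ⟨l, ⟨by omega, by omega⟩, f, hf, Or.inr e⟩

end Ears

/-! ### Recursive destruction of blocks, and fans from nested ears -/

section Hierarchy

variable {V : Type} {G : SimpleGraph V}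

/-- The vertex sets whose 2-connected parts can be destroyed recursively, to depth `k`, by deleting
single vertices, until no induced matching with `m` edges is left. -/
def Cls (G : SimpleGraph V) (m : ℕ) : ℕ → Set V → Prop
  | 0, U => ¬ HasIndMatching G U m
  | k + 1, U => ∀ B ⊆ U, TwoConn G B → ∃ z ∈ B, Cls G m k (B \ {z})

theorem Cls.mono {m k : ℕ} {U U' : Set V} (h : Cls G m k U) (hU : U' ⊆ U) : Cls G m k U' := by
  cases k with
  | zero => exact fun hM => h (hM.mono hU)
  | succ k => exact fun B hB => h B (hB.trans hU)

theorem cls_of_not_hasIndMatching {m k : ℕ} {U : Set V} (h : ¬ HasIndMatching G U m) :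
    Cls G m k U := by
  induction k generalizing U with
  | zero => exact h
  | succ k ih =>
    intro B hB hB2
    obtain ⟨z, hz⟩ := hB2.1.nonempty
    exact ⟨z, hz, ih fun hM => h (hM.mono (Set.sdiff_subset.trans hB))⟩

/-- A connected set outside a maximal 2-connected set has at most one neighbour in it. -/
theorem TwoConn.unique_contact [Finite V] {S B : Set V} (hB : TwoConn G B)
    (hmax : ∀ B' ⊆ S, TwoConn G B' → B ⊆ B' → B' = B) (hBS : B ⊆ S) {K : Set V} (hK : Conn G K)
    (hKS : K ⊆ S \ B) {u v g g' : V} (hu : u ∈ K) (hv : v ∈ K) (hg : g ∈ B) (hg' : g' ∈ B)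
    (hug : G.Adj u g) (hvg : G.Adj v g') : g = g' := by
  by_contra hne
  -- In a minimal such set `L`, every component left by deleting a vertex sees `B`, since it could
  -- otherwise be dropped. Then `B ∪ L` is 2-connected, against the maximality of `B`.
  let Q : Set (Set V) := {K | Conn G K ∧ K ⊆ S \ B ∧ ∃ u ∈ K, ∃ v ∈ K, ∃ g ∈ B, ∃ g' ∈ B, g ≠ g' ∧
    G.Adj u g ∧ G.Adj v g'}
  obtain ⟨L, -, hL⟩ := (Set.toFinite Q).exists_le_minimal
    (show K ∈ Q from ⟨hK, hKS, u, hu, v, hv, g, hg, g', hg', hne, hug, hvg⟩)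
  obtain ⟨hLc, hLS, u, hu, v, hv, g, hg, g', hg', hne, hug, hvg⟩ := hL.prop
  have hcomp : ∀ x ∈ L, ∀ y ∈ L \ {x}, ∃ w ∈ compIn G (L \ {x}) y, ∃ z ∈ B, G.Adj w z := by
    intro x hx y hy
    by_contra! hcon
    have hin : ∀ w ∈ L, (∃ z ∈ B, G.Adj w z) → w ∈ L \ compIn G (L \ {x}) y :=
      fun w hw ⟨z, hz, e⟩ => ⟨hw, fun h => hcon w h z hz e⟩
    have h1 : L \ compIn G (L \ {x}) y ∈ Q := ⟨hLc.sdiff_compIn hx hy,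
      Set.sdiff_subset.trans hLS, u, hin u hu ⟨g, hg, hug⟩, v, hin v hv ⟨g', hg', hvg⟩, g, hg, g',
      hg', hne, hug, hvg⟩
    exact (hL.le_of_le h1 Set.sdiff_subset hy.1).2 (mem_compIn_self hy)
  have hBL : B ∪ L = B := by
    refine hmax _ (Set.union_subset hBS fun x hx => (hLS hx).1) ⟨hB.1.mono Set.subset_union_left,
      hB.2.1.union_adj hLc hg hu hug.symm, ?_⟩ Set.subset_union_left
    rintro x (hx | hx)
    · have hxL : x ∉ L := fun h => (hLS h).2 hx
      rw [Set.union_sdiff_distrib, Set.sdiff_singleton_eq_self hxL]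
      by_cases hgx : g = x
      · exact (hB.2.2 x hx).union_adj hLc ⟨hg', fun e => hne (hgx.trans e.symm)⟩ hv hvg.symm
      · exact (hB.2.2 x hx).union_adj hLc ⟨hg, hgx⟩ hu hug.symm
    · have hxB : x ∉ B := (hLS hx).2
      rw [Set.union_sdiff_distrib, Set.sdiff_singleton_eq_self hxB]
      refine conn_of_cover hB.2.1 Set.subset_union_left ?_
      rintro y (hy | hy)
      · exact ⟨B, Set.subset_union_left, hB.2.1, hy, y, hy, hy⟩
      · obtain ⟨w, hw, z, hz, e⟩ := hcomp x hx y hy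
        refine ⟨insert z (compIn G (L \ {x}) y), ?_, (conn_compIn hy).insert_adj hw e,
          Or.inr (mem_compIn_self hy), z, by simp, hz⟩
        rintro q (rfl | hq)
        exacts [Or.inl hz, Or.inr (compIn_subset _ _ hq)]
  exact (hLS hu).2 (hBL ▸ Or.inr hu)

/-- The sets `C 0, …, C (j - 1)` form a partial fan: they are attached to `F ∪ Y`, which becomes
connected when a connected part of `B` containing `F` is added. -/
structure PartialFan (G : SimpleGraph V) (B F Y : Set V) (j : ℕ) (C : ℕ → Set V) : Prop where
  sub : F ⊆ B
  disj : Disjoint B Y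
  conn : ∀ i < j, Conn G (C i)
  disjB : ∀ i < j, Disjoint B (C i)
  disjY : ∀ i < j, Disjoint Y (C i)
  anti : ∀ i < j, ∀ k < j, i ≠ k → Anticomplete G (C i) (C k)
  contact : ∀ i < j, ∃ u ∈ C i, ∃ v ∈ C i, u ≠ v ∧ (∃ x ∈ F ∪ Y, G.Adj x u) ∧ ∃ x ∈ F ∪ Y, G.Adj x v
  nbr : ∀ i < j, ∀ u ∈ C i, ∀ y ∈ B, G.Adj u y → y ∈ F
  ext : ∀ S ⊆ B, F ⊆ S → Conn G S → Conn G (S ∪ Y)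

variable {B F Y W : Set V} {j m : ℕ} {C : ℕ → Set V} {a b c : V}

/-- The old pieces see `B` only in `F`, and the ear avoids `F`. -/
theorem PartialFan.anti_update (h : PartialFan G B F Y j C) (hW : IsEar G B W a b c m)
    (hWF : Disjoint W F) : ∀ i < j + 1, ∀ k < j + 1, i ≠ k →
      Anticomplete G (Function.update C j W i) (Function.update C j W k) := by
  have key : ∀ i < j, Anticomplete G (C i) W := fun i hi =>
    ⟨((h.disjB i hi).mono_left hW.sub).symm, fun u hu w hw e =>
      Set.disjoint_left.1 hWF hw (h.nbr i hi u hu w (hW.sub hw) e)⟩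
  intro i hi k hk hik
  by_cases hij : i = j
  · subst hij
    rw [Function.update_self, Function.update_of_ne hik.symm]
    exact (key k (by omega)).symm
  · rw [Function.update_of_ne hij]
    by_cases hkj : k = j
    · subst hkj
      rw [Function.update_self]
      exact key i (by omega)
    · rw [Function.update_of_ne hkj]
      exact h.anti i (by omega) k (by omega) hik

/-- The ear is one more piece: `B \ W` is connected and contains `F`, so `(B \ W) ∪ Y` is connected
and carries a fan with `j + 1` pieces. -/
theorem PartialFan.lt_of_fanFree {t : ℕ} (hG : FanFree G t) (h : PartialFan G B F Y j C)
    (hW : IsEar G B W a b c m) (hWF : Disjoint W F) : j + 1 < t := by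
  have hFW : F ⊆ B \ W := fun x hx => ⟨h.sub hx, fun hw => Set.disjoint_left.1 hWF hw hx⟩
  have := hG ℕ (Finset.range (j + 1)) ((B \ W) ∪ Y) (Function.update C j W)
    (h.ext _ Set.sdiff_subset hFW hW.rest) ?_
    fun i hi k hk => h.anti_update hW hWF i (Finset.mem_range.1 hi) k (Finset.mem_range.1 hk)
  · simpa using this
  intro i hi
  have hi := Finset.mem_range.1 hi
  by_cases hij : i = j
  · subst hij
    rw [Function.update_self]
    obtain ⟨u, hu, v, hv, huv, e1, e2⟩ := hW.contact
    exact ⟨hW.conn, Set.disjoint_union_left.2 ⟨Set.disjoint_sdiff_left,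
      (h.disj.mono_left hW.sub).symm⟩, u, hu, v, hv, huv, ⟨a, Or.inl hW.mem_a, e1⟩, b,
      Or.inl hW.mem_b, e2⟩
  · rw [Function.update_of_ne hij]
    have hi : i < j := by omega
    obtain ⟨u, hu, v, hv, huv, ⟨x, hx, e1⟩, y, hy, e2⟩ := h.contact i hi
    have hsub : F ∪ Y ⊆ (B \ W) ∪ Y := Set.union_subset_union_left Y hFW
    exact ⟨h.conn i hi, Set.disjoint_union_left.2 ⟨(h.disjB i hi).mono_left Set.sdiff_subset,
      h.disjY i hi⟩, u, hu, v, hv, huv, ⟨x, hsub hx, e1⟩, y, hsub hy, e2⟩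

/-- What is left of `B` outside `W` and `B'` moves to `Y`. By maximality each of its components sees
at most one vertex of `B'`, its gate. Adding the gates of `a` and `b` to `F` is enough: a component
containing neither has gate `a`, as its gate would otherwise be a cut vertex of `B`. -/
theorem PartialFan.extend [Finite V] {F : Finset V} (hB : TwoConn G B)
    (h : PartialFan G B F Y j C) (hW : IsEar G B W a b c m) (hWF : Disjoint W F) {B' : Set V}
    (hB' : TwoConn G B') (hBB : B' ⊆ B \ {c})
    (hmax : ∀ B'' ⊆ B \ {c}, TwoConn G B'' → B' ⊆ B'' → B'' = B') (hBW : Disjoint B' W) :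
    ∃ (F' : Finset V) (Y' : Set V), F'.card ≤ F.card + 2 ∧
      PartialFan G B' F' Y' (j + 1) (Function.update C j W) := by
  classical
  set E := (B \ W) \ B' with hE
  have hEB : E ⊆ (B \ {c}) \ B' := fun x hx =>
    ⟨⟨hx.1.1, fun e => hx.1.2 (by rw [Set.mem_singleton_iff.1 e]; exact hW.mem_c)⟩, hx.2⟩
  have hB'W : B' ⊆ B \ W := fun x hx => ⟨(hBB hx).1, Set.disjoint_left.1 hBW hx⟩
  obtain ⟨z0, hz0⟩ := hB'.1.nonempty
  -- A vertex of `B'` is its own gate; `z0` is a dummy for components that do not see `B'`.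
  have hgate : ∀ e : V, ∃ g ∈ B', (e ∈ B' → g = e) ∧
      (e ∈ E → ∀ u ∈ compIn G E e, ∀ g' ∈ B', G.Adj u g' → g' = g) := by
    intro e
    by_cases he : e ∈ B'
    · exact ⟨e, he, fun _ => rfl, fun h => absurd he h.2⟩
    by_cases hex : ∃ u ∈ compIn G E e, ∃ g ∈ B', G.Adj u g
    · obtain ⟨u, hu, g, hg, hug⟩ := hex
      refine ⟨g, hg, fun h => absurd h he, fun heE v hv g' hg' hvg => ?_⟩
      exact hB'.unique_contact hmax hBB (conn_compIn heE) ((compIn_subset _ _).trans hEB) hv hu hg'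
        hg hvg hug
    · push Not at hex
      exact ⟨z0, hz0, fun h => absurd h he, fun _ u hu g' hg' e' => absurd e' (hex u hu g' hg')⟩
  obtain ⟨ga, hga, hga1, hga2⟩ := hgate a
  obtain ⟨gb, hgb, hgb1, hgb2⟩ := hgate b
  let F' : Finset V := (F.filter fun f => f ∈ B') ∪ {ga, gb}
  have hF' : ∀ x, x ∈ F' ↔ (x ∈ F ∧ x ∈ B') ∨ x = ga ∨ x = gb := by
    intro x
    simp only [F', Finset.mem_union, Finset.mem_filter, Finset.mem_insert, Finset.mem_singleton]
  have hFsub : (F : Set V) ∪ Y ⊆ (F' : Set V) ∪ (Y ∪ E) := by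
    rintro x (hx | hx)
    · by_cases hxB : x ∈ B'
      · exact Or.inl ((hF' x).2 (Or.inl ⟨hx, hxB⟩))
      · exact Or.inr (Or.inr ⟨⟨h.sub hx, fun hw => Set.disjoint_left.1 hWF hw hx⟩, hxB⟩)
    · exact Or.inr (Or.inl hx)
  have hin : ∀ x ∈ B \ W, (x ∈ B' → x ∈ F') → x ∈ (F' : Set V) ∪ (Y ∪ E) := fun x hx hx' => by
    by_cases hxB : x ∈ B'
    exacts [Or.inl (hx' hxB), Or.inr (Or.inr ⟨hx, hxB⟩)]
  have haF : a ∈ B' → a ∈ F' := fun ha => (hF' a).2 (Or.inr (Or.inl (hga1 ha).symm))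
  have hbF : b ∈ B' → b ∈ F' := fun hb => (hF' b).2 (Or.inr (Or.inr (hgb1 hb).symm))
  refine ⟨F', Y ∪ E, ?_, ?_⟩
  · have h1 := Finset.card_union_le (F.filter fun f => f ∈ B') {ga, gb}
    have h2 := Finset.card_filter_le F fun f => f ∈ B'
    have h3 : ({ga, gb} : Finset V).card ≤ 2 := Finset.card_le_two
    show ((F.filter fun f => f ∈ B') ∪ {ga, gb}).card ≤ _
    omega
  refine ⟨?_, ?_, ?_, ?_, ?_, h.anti_update hW hWF, ?_, ?_, ?_⟩
  · intro x hx
    rcases (hF' x).1 hx with hx | rfl | rfl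
    exacts [hx.2, hga, hgb]
  · exact Set.disjoint_union_right.2 ⟨h.disj.mono_left fun x hx => (hBB hx).1,
      Set.disjoint_sdiff_right⟩
  · intro i hi
    by_cases hij : i = j
    · subst hij; rw [Function.update_self]; exact hW.conn
    · rw [Function.update_of_ne hij]; exact h.conn i (by omega)
  · intro i hi
    by_cases hij : i = j
    · subst hij; rw [Function.update_self]; exact hBW
    · rw [Function.update_of_ne hij]
      exact (h.disjB i (by omega)).mono_left fun x hx => (hBB hx).1
  · intro i hi
    by_cases hij : i = j
    · subst hij; rw [Function.update_self]
      exact Set.disjoint_union_left.2 ⟨(h.disj.mono_left hW.sub).symm,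
        Set.disjoint_left.2 fun x hx hw => hx.1.2 hw⟩
    · rw [Function.update_of_ne hij]
      exact Set.disjoint_union_left.2 ⟨h.disjY i (by omega),
        (h.disjB i (by omega)).mono_left fun x hx => hx.1.1⟩
  · intro i hi
    by_cases hij : i = j
    · subst hij; rw [Function.update_self]
      obtain ⟨u, hu, v, hv, huv, e1, e2⟩ := hW.contact
      exact ⟨u, hu, v, hv, huv, ⟨a, hin a hW.mem_a haF, e1⟩, b, hin b hW.mem_b hbF, e2⟩
    · rw [Function.update_of_ne hij]
      obtain ⟨u, hu, v, hv, huv, ⟨x, hx, e1⟩, y, hy, e2⟩ := h.contact i (by omega)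
      exact ⟨u, hu, v, hv, huv, ⟨x, hFsub hx, e1⟩, y, hFsub hy, e2⟩
  · intro i hi
    by_cases hij : i = j
    · subst hij; rw [Function.update_self]
      intro u hu y hy e
      rcases hW.nbr u hu y (hBB hy).1 (Set.disjoint_left.1 hBW hy) e with rfl | rfl
      exacts [haF hy, hbF hy]
    · rw [Function.update_of_ne hij]
      intro u hu y hy e
      exact (hF' y).2 (Or.inl ⟨h.nbr i (by omega) u hu y (hBB hy).1 e, hy⟩)
  · intro S hSB hFS hS
    have hSE : Conn G (S ∪ E) := by
      refine conn_of_cover hS Set.subset_union_left ?_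
      rintro x (hx | hx)
      · exact ⟨S, Set.subset_union_left, hS, hx, x, hx, hx⟩
      obtain ⟨u, -, hu, g, hg, hgK, e⟩ := hW.rest.exists_adj hx.1 (mem_compIn_self hx) (hB'W hz0)
        (fun h => (compIn_subset _ _ h).2 hz0 : z0 ∉ compIn G E x)
      have hgB : g ∈ B' := by
        by_contra hgB
        exact hgK (compIn_closed hu ⟨hg, hgB⟩ e)
      have hgF : g ∈ F' := by
        rw [hF']
        right
        by_cases haK : a ∈ compIn G E x
        · left
          exact hga2 (compIn_subset _ _ haK) u (by rwa [compIn_eq haK]) g hgB e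
        by_cases hbK : b ∈ compIn G E x
        · right
          exact hgb2 (compIn_subset _ _ hbK) u (by rwa [compIn_eq hbK]) g hgB e
        by_cases hag : a = g
        · left
          rw [hga1 (hag ▸ hgB), hag]
        exfalso
        have hgB0 := (hBB hgB).1
        have hxg : x ≠ g := fun e' => hx.2 (e' ▸ hgB)
        obtain ⟨v, -, hv, y, hy, hyK, e'⟩ := (hB.2.2 g hgB0).exists_adj ⟨hx.1.1, hxg⟩
          (mem_compIn_self hx) ⟨hW.mem_a.1, hag⟩ haK
        have hvE := compIn_subset _ _ hv
        by_cases hyW : y ∈ W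
        · rcases hW.nbr y hyW v hvE.1.1 hvE.1.2 e'.symm with rfl | rfl
          exacts [haK hv, hbK hv]
        by_cases hyB : y ∈ B'
        · exact hy.2 (hB'.unique_contact hmax hBB (conn_compIn hx)
            ((compIn_subset _ _).trans hEB) hv hu hyB hgB e' e)
        · exact hyK (compIn_closed hv ⟨⟨hy.1, hyW⟩, hyB⟩ e')
      refine ⟨insert g (compIn G E x), ?_, (conn_compIn hx).insert_adj hu e,
        Or.inr (mem_compIn_self hx), g, by simp, hFS hgF⟩
      rintro q (rfl | hq)
      exacts [Or.inl (hFS hgF), Or.inr (compIn_subset _ _ hq)]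
    have := h.ext (S ∪ E) ?_ ?_ hSE
    · rwa [Set.union_assoc, Set.union_comm E Y] at this
    · rintro x (hx | hx)
      exacts [(hBB (hSB hx)).1, hx.1.1]
    · intro x hx
      by_cases hxB : x ∈ B'
      · exact Or.inl (hFS ((hF' x).2 (Or.inl ⟨hx, hxB⟩)))
      · exact Or.inr ⟨⟨h.sub hx, fun hw => Set.disjoint_left.1 hWF hw hx⟩, hxB⟩

/-- Failure for the middle vertex `c` of an ear yields a 2-connected set failing one level lower; it
is enlarged to a maximal one and the ear joins the fan. Each level adds at most two vertices to `F`,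
so `F` stays small enough for the next ear. At `k = 0` one more ear completes a fan with `j + 1 = t`
pieces. -/
theorem FanFree.not_partialFan [Finite V] {t m : ℕ} (hG : FanFree G t) (hm : 288 * t ^ 4 ≤ m)
    (k : ℕ) {B : Set V} (hB : TwoConn G B) (F : Finset V) (Y : Set V) (j : ℕ) (C : ℕ → Set V)
    (hFj : F.card ≤ 2 * j) (hjk : j + k + 1 = t) (h : PartialFan G B F Y j C)
    (hcls : ∀ z ∈ B, ¬ Cls G m k (B \ {z})) : False := by
  induction k generalizing B F Y j C with
  | zero =>
    obtain ⟨z, hz⟩ := hB.1.nonempty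
    obtain ⟨W, a, b, c, hW, hWF⟩ := hG.exists_ear (by omega) hB hm
      ((not_not.1 (hcls z hz)).mono Set.sdiff_subset) F h.sub (by omega)
    have := h.lt_of_fanFree hG hW hWF
    omega
  | succ k ih =>
    have hM : ∀ (B : Set V) (k : ℕ), TwoConn G B → (∀ z ∈ B, ¬ Cls G m k (B \ {z})) →
        HasIndMatching G B m := by
      intro B k hB hcls
      obtain ⟨z, hz⟩ := hB.1.nonempty
      by_contra hno
      exact hcls z hz (cls_of_not_hasIndMatching fun h => hno (h.mono Set.sdiff_subset))
    obtain ⟨W, a, b, c, hW, hWF⟩ := hG.exists_ear (by omega) hB hm (hM B _ hB hcls) F h.sub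
      (by omega)
    have hc := hcls c (hW.sub hW.mem_c)
    simp only [Cls] at hc
    push Not at hc
    obtain ⟨B0, hB0, hB02, hB0c⟩ := hc
    obtain ⟨B', hBB', hB'⟩ :=
      (Set.toFinite {B' : Set V | B' ⊆ B \ {c} ∧ TwoConn G B'}).exists_le_maximal
      (show B0 ∈ {B' : Set V | B' ⊆ B \ {c} ∧ TwoConn G B'} from ⟨hB0, hB02⟩)
    -- Failure is inherited from `B0` even for `z` outside it, because `B' \ {z}` then contains `B0`
    -- minus any of its vertices.
    have hB'c : ∀ z ∈ B', ¬ Cls G m k (B' \ {z}) := by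
      intro z _ hcl
      by_cases hz0 : z ∈ B0
      · exact hB0c z hz0 (hcl.mono fun x hx => ⟨hBB' hx.1, hx.2⟩)
      · obtain ⟨z0, hz0'⟩ := hB02.1.nonempty
        refine hB0c z0 hz0' (hcl.mono fun x hx => ⟨hBB' hx.1, fun e => hz0 ?_⟩)
        rw [← Set.mem_singleton_iff.1 e]
        exact hx.1
    obtain ⟨F', Y', hF', h'⟩ := h.extend hB hW hWF hB'.prop.2 hB'.prop.1
      (fun B'' h1 h2 h3 => hB'.eq_of_ge ⟨h1, h2⟩ h3)
      (hW.avoid B' hB'.prop.1 hB'.prop.2 (hM B' k hB'.prop.2 hB'c))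
    exact ih hB'.prop.2 F' Y' (j + 1) _ (by omega) (by omega) h' hB'c

theorem FanFree.cls_univ [Finite V] {t m : ℕ} (hG : FanFree G t) (ht : 1 ≤ t)
    (hm : 288 * t ^ 4 ≤ m) : Cls G m t Set.univ := by
  obtain ⟨k, rfl⟩ : ∃ k, t = k + 1 := ⟨t - 1, by omega⟩
  intro B _ hB
  by_contra! hcls
  refine hG.not_partialFan hm k hB ∅ ∅ 0 (fun _ => ∅) (by simp) (by omega) ?_ hcls
  exact ⟨by simp, by simp, by simp, by simp, by simp, by simp, by simp, by simp,
    fun S _ _ hS => by simpa using hS⟩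

end Hierarchy

/-! ### Short certificates for maximum independent sets -/

section Certificates

variable {n : ℕ} {G : SimpleGraph (Fin n)}

/-- `S` is a maximum independent subset of `U`. -/
def IsMaxIn (G : SimpleGraph (Fin n)) (U S : Finset (Fin n)) : Prop :=
  S ⊆ U ∧ G.IsIndepSet S ∧ ∀ T ⊆ U, G.IsIndepSet T → T.card ≤ S.card

theorem exists_isMaxIn (G : SimpleGraph (Fin n)) (U : Finset (Fin n)) : ∃ S, IsMaxIn G U S := by
  classical
  obtain ⟨S, hS, hmax⟩ := Finset.exists_max_image
    (U.powerset.filter fun S : Finset (Fin n) => G.IsIndepSet (S : Set (Fin n))) Finset.card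
    ⟨∅, by simp⟩
  simp only [Finset.mem_filter, Finset.mem_powerset] at hS hmax
  exact ⟨S, hS.1, hS.2, fun T hT hTi => hmax T ⟨hT, hTi⟩⟩

theorem IsMaxIn.mono {U U' S : Finset (Fin n)} (h : IsMaxIn G U S) (hU : U' ⊆ U) (hS : S ⊆ U') :
    IsMaxIn G U' S :=
  ⟨hS, h.2.1, fun T hT => h.2.2 T (hT.trans hU)⟩

theorem indep_iff {S : Finset (Fin n)} :
    G.IsIndepSet S ↔ ∀ x ∈ S, ∀ y ∈ S, ¬ G.Adj x y :=
  ⟨fun h _ hx _ hy e => h hx hy e.ne e, fun h x hx y hy _ => h x hx y hy⟩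

theorem IsMaxIn.exists_adj {U S : Finset (Fin n)} (h : IsMaxIn G U S) {x : Fin n} (hx : x ∈ U)
    (hxS : x ∉ S) : ∃ y ∈ S, G.Adj y x := by
  classical
  by_contra! hcon
  have h1 := indep_iff.1 h.2.1
  have h2 := h.2.2 (insert x S) (Finset.insert_subset hx h.1) (indep_iff.2 fun a ha b hb e => by
    rcases Finset.mem_insert.1 ha with rfl | ha' <;> rcases Finset.mem_insert.1 hb with rfl | hb'
    · exact e.ne rfl
    · exact hcon b hb' e.symm
    · exact hcon a ha' e
    · exact h1 a ha' b hb' e)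
  rw [Finset.card_insert_of_notMem hxS] at h2
  omega

/-- `M` is the lexicographically first maximal independent subset of `C`. -/
def IsLex (G : SimpleGraph (Fin n)) (C M : Finset (Fin n)) : Prop :=
  M ⊆ C ∧ ∀ x ∈ C, x ∈ M ↔ ∀ y ∈ M, y < x → ¬ G.Adj y x

theorem IsLex.indep {C M : Finset (Fin n)} (h : IsLex G C M) : G.IsIndepSet M := by
  rw [indep_iff]
  intro x hx y hy e
  rcases lt_trichotomy x y with h1 | h1 | h1
  · exact (h.2 y (h.1 hy)).1 hy x hx h1 e
  · exact e.ne h1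
  · exact (h.2 x (h.1 hx)).1 hx y hy h1 e.symm

theorem IsLex.unique {C M M' : Finset (Fin n)} (h : IsLex G C M) (h' : IsLex G C M') : M = M' := by
  have key : ∀ k, ∀ x : Fin n, x.1 = k → (x ∈ M ↔ x ∈ M') := by
    intro k
    induction k using Nat.strong_induction_on with
    | _ k ih =>
      rintro x rfl
      by_cases hx : x ∈ C
      · rw [h.2 x hx, h'.2 x hx]
        constructor
        · intro h1 y hy hyx
          exact h1 y ((ih y hyx y rfl).2 hy) hyx
        · intro h1 y hy hyx
          exact h1 y ((ih y hyx y rfl).1 hy) hyx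
      · exact ⟨fun h1 => absurd (h.1 h1) hx, fun h1 => absurd (h'.1 h1) hx⟩
  ext x
  exact key x x rfl

open Classical in
/-- The part of `C` left by the deletions encoded in the list `L`: a pair `(b, w)` deletes the
neighbours of `w` below `b`. -/
noncomputable def prune (G : SimpleGraph (Fin n)) (C : Finset (Fin n)) (L : List (Fin n × Fin n)) :
    Finset (Fin n) :=
  C.filter fun z => ∀ q ∈ L, ¬ (z < q.1 ∧ G.Adj q.2 z)

theorem mem_prune {C : Finset (Fin n)} {L : List (Fin n × Fin n)} {z : Fin n} :
    z ∈ prune G C L ↔ z ∈ C ∧ ∀ q ∈ L, ¬ (z < q.1 ∧ G.Adj q.2 z) := by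
  classical
  simp [prune]

/-- In the absence of large induced matchings, every maximal independent set is the
lexicographically first one after few deletions. -/
theorem exists_prune_isLex (j : ℕ) (A M : Finset (Fin n)) (hMA : M ⊆ A) (hM : G.IsIndepSet M)
    (hmax : ∀ x ∈ A, x ∉ M → ∃ y ∈ M, G.Adj y x)
    (hA : ¬ HasIndMatching G (A : Set (Fin n)) (j + 1)) :
    ∃ L : List (Fin n × Fin n), L.length ≤ 2 * j ∧ (∀ q ∈ L, q.1 ∈ A) ∧
      IsLex G (prune G A L) M := by
  classical
  induction j using Nat.strong_induction_on generalizing A M with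
  | _ j ih =>
  have hM' := indep_iff.1 hM
  -- `bad v`: some excluded vertex below `v` has no neighbour in `M` below `v`. The largest bad
  -- value is a vertex `y` of `M` adjacent to some excluded `u` without earlier neighbours in `M`.
  -- From `y` on the greedy choice is right, and the edge `uy` extends every induced matching of
  -- `A'`, so the recursion to `A'` loses one edge.
  let bad : ℕ → Prop := fun v => ∃ x ∈ A, x.1 < v ∧ x ∉ M ∧ ∀ y ∈ M, y.1 < v → ¬ G.Adj y x
  have hgood : ∀ x ∈ A, ¬ bad (x.1 + 1) → (∀ y ∈ M, y < x → ¬ G.Adj y x) → x ∈ M := by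
    intro x hx hb h1
    by_contra hxM
    refine hb ⟨x, hx, by omega, hxM, fun y hy hyx e => ?_⟩
    have hne : y.1 ≠ x.1 := fun h => e.ne (Fin.ext h)
    exact h1 y hy (by rw [Fin.lt_def]; omega) e
  by_cases hbad : ∃ v, bad v
  swap
  · push Not at hbad
    refine ⟨[], by simp, by simp, fun x hx => mem_prune.2 ⟨hMA hx, by simp⟩, fun x hx => ?_⟩
    exact ⟨fun h y hy _ => hM' y hy x h, hgood x (mem_prune.1 hx).1 (hbad _)⟩
  have hbn : ∀ v, bad v → v ≤ n := by
    rintro v ⟨x, hx, hxv, hxM, h1⟩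
    obtain ⟨y, hy, e⟩ := hmax x hx hxM
    by_contra hlt
    exact h1 y hy (by omega) e
  obtain ⟨v, hv, hvmax⟩ : ∃ v, bad v ∧ ∀ w, v < w → ¬ bad w := by
    obtain ⟨w, hw⟩ := hbad
    refine ⟨Nat.findGreatest bad n, Nat.findGreatest_spec (hbn w hw) hw, fun w h1 h2 => ?_⟩
    exact Nat.findGreatest_is_greatest h1 (hbn w h2) h2
  obtain ⟨u, huA, huv, huM, hu⟩ := hv
  obtain ⟨y, hyM, hyv, e⟩ : ∃ y ∈ M, y.1 < v + 1 ∧ G.Adj y u := by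
    by_contra! hcon
    exact hvmax (v + 1) (by omega) ⟨u, huA, by omega, huM, hcon⟩
  obtain rfl : y.1 = v := by
    by_contra hne
    exact hu y hyM (by omega) e
  let A' := A.filter fun z => z < y ∧ ¬ G.Adj y z ∧ ¬ G.Adj u z
  let M' := M.filter fun z => z < y
  have hA' : ∀ z, z ∈ A' ↔ z ∈ A ∧ z < y ∧ ¬ G.Adj y z ∧ ¬ G.Adj u z := fun z => by simp [A']
  have hMM' : ∀ z, z ∈ M' ↔ z ∈ M ∧ z < y := fun z => by simp [M']
  cases j with
  | zero =>
    refine absurd ⟨fun _ => u, fun _ => y, fun _ => ⟨huA, hMA hyM, e.symm⟩,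
      fun i k hik => absurd ?_ hik⟩ hA
    exact Fin.ext (by omega)
  | succ j =>
    have hMA' : M' ⊆ A' := by
      intro z hz
      obtain ⟨h1, h2⟩ := (hMM' z).1 hz
      exact (hA' z).2 ⟨hMA h1, h2, hM' y hyM z h1, fun h => hu z h1 h2 h.symm⟩
    have hindM : G.IsIndepSet M' := by
      exact indep_iff.2 fun a ha b hb => hM' a ((hMM' a).1 ha).1 b ((hMM' b).1 hb).1
    have hmaxM : ∀ x ∈ A', x ∉ M' → ∃ y ∈ M', G.Adj y x := by
      intro x hx hxM'
      obtain ⟨hxA, hxy, h3, h4⟩ := (hA' x).1 hx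
      have hxM : x ∉ M := fun h => hxM' ((hMM' x).2 ⟨h, hxy⟩)
      by_contra! hcon
      refine hvmax (y.1 + 1) (by omega) ⟨x, hxA, by rw [Fin.lt_def] at hxy; omega, hxM,
        fun z hz hzy e' => ?_⟩
      have hzy' : z ≠ y := fun h => h3 (h ▸ e')
      have : z.1 ≠ y.1 := fun h => hzy' (Fin.ext h)
      exact hcon z ((hMM' z).2 ⟨hz, by rw [Fin.lt_def]; omega⟩) e'
    have hnoM : ¬ HasIndMatching G (A' : Set (Fin n)) (j + 1) := by
      rintro ⟨a, b, h1, h2⟩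
      refine hA ⟨Fin.cons u a, Fin.cons y b, ?_, ?_⟩
      · intro i
        refine Fin.cases ?_ (fun i => ?_) i
        · exact ⟨huA, hMA hyM, e.symm⟩
        · simp only [Fin.cons_succ]
          exact ⟨((hA' _).1 (h1 i).1).1, ((hA' _).1 (h1 i).2.1).1, (h1 i).2.2⟩
      · intro i k
        refine Fin.cases ?_ (fun i => ?_) i <;> refine Fin.cases ?_ (fun k => ?_) k
        · exact fun h => absurd rfl h
        · intro _
          simp only [Fin.cons_succ, Fin.cons_zero]
          exact ⟨((hA' _).1 (h1 k).1).2.2.2, ((hA' _).1 (h1 k).2.1).2.2.2,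
            ((hA' _).1 (h1 k).2.1).2.2.1⟩
        · intro _
          simp only [Fin.cons_succ, Fin.cons_zero]
          exact ⟨fun h => ((hA' _).1 (h1 i).1).2.2.2 h.symm,
            fun h => ((hA' _).1 (h1 i).1).2.2.1 h.symm,
            fun h => ((hA' _).1 (h1 i).2.1).2.2.1 h.symm⟩
        · intro hik
          simp only [Fin.cons_succ]
          exact h2 i k fun h => hik (by rw [h])
    obtain ⟨L, hL, hLA, hlex⟩ := ih j (by omega) A' M' hMA' hindM hmaxM hnoM
    -- The two new pairs cut the part of `A` below `y` down to `A'`. The pairs of `L` act only below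
    -- `y`, because their bounds lie in `A'`.
    have hmem : ∀ z, z ∈ prune G A ((y, y) :: (y, u) :: L) ↔
        z ∈ A ∧ (z < y → z ∈ prune G A' L) := by
      intro z
      rw [mem_prune, mem_prune, hA']
      constructor
      · rintro ⟨h1, h2⟩
        refine ⟨h1, fun hzy => ⟨⟨h1, hzy, fun h => h2 (y, y) (by simp) ⟨hzy, h⟩,
          fun h => h2 (y, u) (by simp) ⟨hzy, h⟩⟩, fun q hq => h2 q (by simp [hq])⟩⟩
      · rintro ⟨h1, h2⟩
        refine ⟨h1, fun q hq hqz => ?_⟩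
        have hzy : z < y := by
          rcases List.mem_cons.1 hq with rfl | hq
          · exact hqz.1
          · rcases List.mem_cons.1 hq with rfl | hq
            · exact hqz.1
            · exact hqz.1.trans ((hA' _).1 (hLA q hq)).2.1
        obtain ⟨⟨-, -, h3, h4⟩, h5⟩ := h2 hzy
        rcases List.mem_cons.1 hq with rfl | hq
        · exact h3 hqz.2
        · rcases List.mem_cons.1 hq with rfl | hq
          exacts [h4 hqz.2, h5 q hq hqz]
    refine ⟨(y, y) :: (y, u) :: L, by simp; omega, ?_, ?_, ?_⟩
    · intro q hq
      rcases List.mem_cons.1 hq with rfl | hq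
      · exact hMA hyM
      · rcases List.mem_cons.1 hq with rfl | hq
        exacts [hMA hyM, ((hA' _).1 (hLA q hq)).1]
    · intro z hz
      exact (hmem z).2 ⟨hMA hz, fun hzy => hlex.1 ((hMM' z).2 ⟨hz, hzy⟩)⟩
    · intro x hx
      refine ⟨fun h z hz _ => hM' z hz x h, fun h => ?_⟩
      obtain ⟨hxA, hxL⟩ := (hmem x).1 hx
      by_cases hxy : x < y
      · exact ((hMM' x).1 ((hlex.2 x (hxL hxy)).2 fun z hz => h z ((hMM' z).1 hz).1)).1
      · exact hgood x hxA (hvmax _ (by rw [Fin.lt_def] at hxy; omega)) h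

/-- The vertices `w` and `z`, given by numbers, are adjacent. -/
def NAdj (G : SimpleGraph (Fin n)) (w z : ℕ) : Prop :=
  ∃ (hw : w < n) (hz : z < n), G.Adj ⟨w, hw⟩ ⟨z, hz⟩

theorem nAdj_coe {w z : Fin n} : NAdj G w z ↔ G.Adj w z :=
  ⟨fun ⟨_, _, h⟩ => h, fun h => ⟨w.2, z.2, h⟩⟩

open Classical in
/-- Delete from `U` the vertex `y` and the neighbours of `w` below `x`. -/
noncomputable def trim (G : SimpleGraph (Fin n)) (U : Finset (Fin n)) (x y w : ℕ) :
    Finset (Fin n) :=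
  U.filter fun z => z.1 ≠ y ∧ ¬ (z.1 < x ∧ NAdj G w z)

theorem mem_trim {U : Finset (Fin n)} {x y w : ℕ} {z : Fin n} :
    z ∈ trim G U x y w ↔ z ∈ U ∧ z.1 ≠ y ∧ ¬ (z.1 < x ∧ NAdj G w z) := by
  classical
  simp [trim]

theorem trim_subset {U : Finset (Fin n)} {x y w : ℕ} : trim G U x y w ⊆ U :=
  fun _ h => (mem_trim.1 h).1

/-- The sets handled correctly by the best of all trimmings, if `Good` sets are handled. -/
def BranchGood (G : SimpleGraph (Fin n)) (Good : Finset (Fin n) → Prop) (U : Finset (Fin n)) :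
    Prop :=
  ∃ x ≤ n, ∃ y ≤ n, ∃ w ≤ n, Good (trim G U x y w) ∧ ∃ I ⊆ trim G U x y w, IsMaxIn G U I

/-- The sets on which the lexicographically first maximal independent set is maximum. -/
def LexGood (G : SimpleGraph (Fin n)) (U : Finset (Fin n)) : Prop :=
  ∀ M, IsLex G U M → IsMaxIn G U M

/-- The sets handled correctly by peeling off leaf blocks, if `Good` sets are handled. -/
def PeelGood (G : SimpleGraph (Fin n)) (Good : Finset (Fin n) → Prop) (U : Finset (Fin n)) : Prop :=
  ∀ (D : Finset (Fin n)) (c : Fin n), D ⊆ U → c ∈ U → c ∉ D →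
    TwoConn G (insert c (D : Set (Fin n))) → ∀ D' ⊆ D, Good D'

/-- Each round of branching performs one deletion from `L`, with `y = n` so that no single vertex is
removed; surplus rounds use the trimming `0, n, 0`, which deletes nothing. -/
theorem branchGood_iterate (k : ℕ) (L : List (Fin n × Fin n)) (hL : L.length ≤ k)
    (U M : Finset (Fin n)) (hM : IsMaxIn G U M) (hlex : IsLex G (prune G U L) M) :
    (BranchGood G)^[k] (LexGood G) U := by
  induction k generalizing L U with
  | zero =>
    obtain rfl : L = [] := List.length_eq_zero_iff.1 (by omega)
    have hU : prune G U [] = U := by ext z; simp [mem_prune]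
    rw [hU] at hlex
    intro M' hM'
    rw [hM'.unique hlex]
    exact hM
  | succ k ih =>
    rw [Function.iterate_succ_apply']
    cases L with
    | nil =>
      have hU : trim G U 0 n 0 = U := by
        ext z
        have := z.2.ne
        simp [mem_trim, this]
      refine ⟨0, by omega, n, le_rfl, 0, by omega, ?_, M, ?_⟩ <;> rw [hU]
      · exact ih [] (by simp) U hM hlex
      · exact ⟨hM.1, hM⟩
    | cons q L =>
      have hU : prune G (trim G U q.1 n q.2) L = prune G U (q :: L) := by
        ext z
        have := z.2.ne
        simp only [mem_prune, mem_trim, nAdj_coe, List.forall_mem_cons, Fin.lt_def]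
        tauto
      have hMU : M ⊆ trim G U q.1 n q.2 := fun z hz => by
        have := hlex.1 hz
        rw [← hU] at this
        exact (mem_prune.1 this).1
      refine ⟨q.1, q.1.2.le, n, le_rfl, q.2, q.2.2.le, ?_, M, hMU, hM⟩
      exact ih L (by simpa using hL) _ (hM.mono trim_subset hMU) (hU ▸ hlex)

/-- The sets handled by `k` rounds of peeling and branching. -/
def LevelGood (G : SimpleGraph (Fin n)) (j : ℕ) : ℕ → Finset (Fin n) → Prop
  | 0 => (BranchGood G)^[2 * j] (LexGood G)
  | k + 1 => PeelGood G (BranchGood G (LevelGood G j k))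

/-- An isolated vertex lies in no 2-connected set and on no matching edge. This lets a vertex
guessed to be in the solution stay in the set once its neighbours are gone. -/
theorem Cls.insert_isolated {V : Type} {G : SimpleGraph V} {m k : ℕ} {U : Set V} {z : V}
    (h : Cls G m k U) (hz : ∀ u ∈ U, ¬ G.Adj z u) : Cls G m k (insert z U) := by
  have hz' : ∀ u ∈ insert z U, ¬ G.Adj z u := by
    rintro u (rfl | hu)
    exacts [G.irrefl, hz u hu]
  cases k with
  | zero =>
    rintro ⟨x, y, h1, h2⟩
    refine h ⟨x, y, fun i => ⟨?_, ?_, (h1 i).2.2⟩, h2⟩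
    · exact (h1 i).1.resolve_left fun e => hz' _ (h1 i).2.1 (e ▸ (h1 i).2.2)
    · exact (h1 i).2.1.resolve_left fun e => hz' _ (h1 i).1 (e ▸ (h1 i).2.2.symm)
  | succ k =>
    intro B hB hB2
    refine h B (fun x hx => (hB hx).resolve_left ?_) hB2
    rintro rfl
    obtain ⟨y, hy, hyx⟩ := hB2.1.exists_ne x
    obtain ⟨u, -, hu, v, hv, -, e⟩ := hB2.2.1.exists_adj hx (Set.mem_singleton x) hy hyx
    rw [Set.mem_singleton_iff.1 hu] at e
    exact hz' v (hB hv) e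

theorem Cls.levelGood {j k : ℕ} {U : Finset (Fin n)} (h : Cls G (j + 1) k (U : Set (Fin n))) :
    LevelGood G j k U := by
  classical
  induction k generalizing U with
  | zero =>
    obtain ⟨M, hM⟩ := exists_isMaxIn G U
    obtain ⟨L, hL, -, hlex⟩ := exists_prune_isLex j U M hM.1 hM.2.1
      (fun x hx hxM => hM.exists_adj hx hxM) h
    exact branchGood_iterate _ L hL U M hM hlex
  | succ k ih =>
    intro D c hD hc hcD hB D' hD'
    obtain ⟨z, hz, hcls⟩ := h _ (by
      rintro x (rfl | hx)
      exacts [hc, hD hx]) hB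
    obtain ⟨I, hI⟩ := exists_isMaxIn G D'
    by_cases hzI : z ∈ I
    -- If `z` is in the solution, the trimming deletes all its neighbours and leaves `z` isolated.
    · refine ⟨n, le_rfl, n, le_rfl, z, z.2.le, ih ?_, I, fun x hx => ?_, hI⟩
      · have := Cls.insert_isolated (z := z)
          (U := ((trim G D' n n z : Finset (Fin n)) : Set (Fin n)) \ {z})
          (hcls.mono fun x hx => ⟨Or.inr (hD' (trim_subset hx.1)), hx.2⟩)
          fun u hu e => (mem_trim.1 hu.1).2.2 ⟨u.2, nAdj_coe.2 e⟩
        exact this.mono fun x hx => by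
          by_cases hxz : x = z
          exacts [Or.inl hxz, Or.inr ⟨hx, hxz⟩]
      · exact mem_trim.2 ⟨hI.1 hx, x.2.ne, fun h => indep_iff.1 hI.2.1 z hzI x hx (nAdj_coe.1 h.2)⟩
    -- Otherwise `z` itself is deleted; the bound 0 spares all neighbours.
    · refine ⟨0, by omega, z, z.2.le, 0, by omega, ih ?_, I, fun x hx => ?_, hI⟩
      · refine hcls.mono fun x hx => ⟨Or.inr (hD' (trim_subset hx)), fun e => ?_⟩
        exact (mem_trim.1 hx).2.1 (by rw [Set.mem_singleton_iff.1 e])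
      · exact mem_trim.2 ⟨hI.1 hx, fun e => hzI (Fin.ext e ▸ hx), by simp⟩

end Certificates

/-! ### Time bounds, frames, greedy selection and branching on the machine -/

namespace RAM

@[simp] theorem Memory.setReg_reg (σ : Memory) (x v y : ℕ) :
    (σ.setReg x v).reg y = if y = x then v else σ.reg y := by
  simp [Memory.setReg, Function.update_apply]

@[simp] theorem Memory.setReg_arr (σ : Memory) (x v : ℕ) : (σ.setReg x v).arr = σ.arr := rfl

@[simp] theorem Memory.setArr_reg (σ : Memory) (a i v : ℕ) : (σ.setArr a i v).reg = σ.reg := rfl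

@[simp] theorem Memory.setArr_arr (σ : Memory) (a i v b k : ℕ) :
    (σ.setArr a i v).arr b k = if b = a ∧ k = i then v else σ.arr b k := by
  by_cases hb : b = a
  · subst hb
    simp [Memory.setArr, Function.update_apply]
  · simp [Memory.setArr, hb]

/-- Started in `σ`, the program `P` halts after at most `(n + 2) ^ a` steps, and the final memory
satisfies `Q`. -/
def Runs (n : ℕ) (P : Program) (a : ℕ) (σ : Memory) (Q : Memory → Prop) : Prop :=
  ∃ τ k, Exec P σ τ k ∧ k ≤ (n + 2) ^ a ∧ Q τ

variable {n : ℕ}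

theorem Runs.mono {P : Program} {a a' : ℕ} {σ : Memory} {Q Q' : Memory → Prop}
    (h : Runs n P a σ Q) (ha : a ≤ a') (hQ : ∀ τ, Q τ → Q' τ) : Runs n P a' σ Q' := by
  obtain ⟨τ, k, h1, h2, h3⟩ := h
  exact ⟨τ, k, h1, h2.trans (Nat.pow_le_pow_right (by omega) ha), hQ τ h3⟩

theorem two_pow_le (n a : ℕ) : 2 ^ a ≤ (n + 2) ^ a := Nat.pow_le_pow_left (by omega) a

theorem two_mul_pow_le (n a : ℕ) : 2 * (n + 2) ^ a ≤ (n + 2) ^ (a + 1) := by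
  rw [pow_succ, mul_comm]
  exact Nat.mul_le_mul_left _ (by omega)

/-- Time is tracked only through exponents of `n + 2`: since the base is at least 2, a sum of two
bounds costs one more in the exponent. -/
theorem Runs.seq {P P' : Program} {a b c : ℕ} {σ : Memory} {Q R : Memory → Prop}
    (h : Runs n P a σ Q) (h' : ∀ τ, Q τ → Runs n P' b τ R) (ha : a < c) (hb : b < c) :
    Runs n (.seq P P') c σ R := by
  obtain ⟨τ, k, h1, h2, h3⟩ := h
  obtain ⟨ρ, l, h4, h5, h6⟩ := h' τ h3
  obtain ⟨c, rfl⟩ : ∃ d, c = d + 1 := ⟨c - 1, by omega⟩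
  refine ⟨ρ, k + l, h1.seq h4, ?_, h6⟩
  have h7 := Nat.pow_le_pow_right (n := n + 2) (by omega) (show a ≤ c by omega)
  have h8 := Nat.pow_le_pow_right (n := n + 2) (by omega) (show b ≤ c by omega)
  have := two_mul_pow_le n c
  omega

theorem runs_skip {a : ℕ} {σ : Memory} {Q : Memory → Prop} (h : Q σ) : Runs n .skip a σ Q :=
  ⟨σ, 1, .skip σ, Nat.one_le_pow _ _ (by omega), h⟩

/-- The bounds 63 and 6 match: `63 + 1 = 2 ^ 6`. -/
theorem runs_assign {x : ℕ} {e : Expr} {σ : Memory} {Q : Memory → Prop} (he : e.cost ≤ 63)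
    (h : Q (σ.setReg x (e.eval σ))) : Runs n (.assign x e) 6 σ Q :=
  ⟨_, _, .assign x e σ, le_trans (by omega) (two_pow_le n 6), h⟩

theorem runs_store {a : ℕ} {i e : Expr} {σ : Memory} {Q : Memory → Prop}
    (he : i.cost + e.cost ≤ 63) (h : Q (σ.setArr a (i.eval σ) (e.eval σ))) :
    Runs n (.store a i e) 6 σ Q :=
  ⟨_, _, .store a i e σ, le_trans (by omega) (two_pow_le n 6), h⟩

theorem runs_ite {e f : Expr} {P P' : Program} {a : ℕ} {σ : Memory} {Q : Memory → Prop}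
    (ha : 6 ≤ a) (hc : e.cost + f.cost ≤ 63) (h1 : e.eval σ < f.eval σ → Runs n P a σ Q)
    (h2 : ¬ e.eval σ < f.eval σ → Runs n P' a σ Q) : Runs n (.ite e f P P') (a + 1) σ Q := by
  have h3 := two_pow_le n 6
  have h4 := Nat.pow_le_pow_right (n := n + 2) (by omega) ha
  have h5 := two_mul_pow_le n a
  by_cases h : e.eval σ < f.eval σ
  · obtain ⟨τ, k, h6, h7, h8⟩ := h1 h
    exact ⟨τ, _, .ite_true h h6, by omega, h8⟩
  · obtain ⟨τ, k, h6, h7, h8⟩ := h2 h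
    exact ⟨τ, _, .ite_false h h6, by omega, h8⟩

/-- Run `P` with the register `x` taking the values `0, …, N - 1`, where `N` is the value of `e`. -/
def forLoop (x : ℕ) (e : Expr) (P : Program) : Program :=
  .seq (.assign x (.const 0)) (.while (.reg x) e (.seq P (.assign x (.add (.reg x) (.const 1)))))

/-- One unit of the exponent pays for the rounds and five for the overhead, by `32 ≤ (n + 2) ^ 5`.
The bound `n + 1` admits loops that include the dummy value `n`. -/
theorem runs_forLoop {x : ℕ} {e : Expr} {P : Program} {N a : ℕ} {σ : Memory}
    {Q : Memory → Prop} (Inv : ℕ → Memory → Prop) (hN : N ≤ n + 1) (hc : e.cost ≤ 3)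
    (h0 : Inv 0 (σ.setReg x 0)) (he : ∀ i ρ, Inv i ρ → ρ.reg x = i ∧ e.eval ρ = N)
    (hP : ∀ i < N, ∀ ρ, Inv i ρ →
      Runs n P a ρ fun τ => τ.reg x = i ∧ Inv (i + 1) (τ.setReg x (i + 1)))
    (hQ : ∀ ρ, Inv N ρ → Q ρ) : Runs n (forLoop x e P) (a + 6) σ Q := by
  have key : ∀ d i ρ, i + d = N → Inv i ρ → ∃ τ k,
      Exec (.while (.reg x) e (.seq P (.assign x (.add (.reg x) (.const 1))))) ρ τ k ∧
      k ≤ d * ((n + 2) ^ a + 9) + 5 ∧ Inv N τ := by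
    intro d
    induction d with
    | zero =>
      intro i ρ hi hρ
      obtain rfl : i = N := by omega
      obtain ⟨h1, h2⟩ := he i ρ hρ
      refine ⟨ρ, _, .while_false (by simp [Expr.eval, h1, h2]), ?_, hρ⟩
      simp only [Expr.cost]
      omega
    | succ d ih =>
      intro i ρ hi hρ
      obtain ⟨h1, h2⟩ := he i ρ hρ
      obtain ⟨τ, k, h3, h4, h5, h6⟩ := hP i (by omega) ρ hρ
      obtain ⟨υ, l, h7, h8, h9⟩ := ih (i + 1) _ (by omega) h6
      have h10 : Exec (.assign x (.add (.reg x) (.const 1))) τ (τ.setReg x (i + 1)) 4 := by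
        have := Exec.assign x (.add (.reg x) (.const 1)) τ
        simpa [Expr.eval, Expr.cost, h5] using this
      refine ⟨υ, _, .while_true (by simp [Expr.eval, h1, h2]; omega) (h3.seq h10) h7, ?_, h9⟩
      have : (d + 1) * ((n + 2) ^ a + 9) = d * ((n + 2) ^ a + 9) + ((n + 2) ^ a + 9) := by ring
      simp only [Expr.cost]
      omega
  obtain ⟨τ, k, h1, h2, h3⟩ := key N 0 _ (by omega) h0
  refine ⟨τ, _, (Exec.assign x (.const 0) σ).seq h1, ?_, hQ τ h3⟩
  have h4 : N * ((n + 2) ^ a + 9) ≤ (n + 2) * ((n + 2) ^ a + 9) := Nat.mul_le_mul_right _ (by omega)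
  have h5 : 1 ≤ (n + 2) ^ a := Nat.one_le_pow _ _ (by omega)
  have h6 : (n + 2) * ((n + 2) ^ a + 9) ≤ (n + 2) * (10 * (n + 2) ^ a) :=
    Nat.mul_le_mul_left _ (by omega)
  have h7 : (n + 2) ^ (a + 6) = (n + 2) ^ 5 * ((n + 2) * (n + 2) ^ a) := by ring
  have h8 : 32 * ((n + 2) * (n + 2) ^ a) ≤ (n + 2) ^ 5 * ((n + 2) * (n + 2) ^ a) :=
    Nat.mul_le_mul_right _ (two_pow_le n 5)
  have h9 : 2 * 1 ≤ (n + 2) * (n + 2) ^ a := Nat.mul_le_mul (by omega) h5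
  have h10 : (n + 2) * (10 * (n + 2) ^ a) = 10 * ((n + 2) * (n + 2) ^ a) := by ring
  simp only [Expr.cost]
  omega

/-- Only the registers in `R` and the arrays in `A` may differ between the two memories. -/
def Mod (R A : ℕ → Prop) (σ τ : Memory) : Prop :=
  (∀ x, ¬ R x → τ.reg x = σ.reg x) ∧ ∀ a, ¬ A a → τ.arr a = σ.arr a

theorem Mod.refl (R A : ℕ → Prop) (σ : Memory) : Mod R A σ σ := ⟨fun _ _ => rfl, fun _ _ => rfl⟩

theorem Mod.trans {R A : ℕ → Prop} {σ τ ρ : Memory} (h : Mod R A σ τ) (h' : Mod R A τ ρ) :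
    Mod R A σ ρ :=
  ⟨fun x hx => (h'.1 x hx).trans (h.1 x hx), fun a ha => (h'.2 a ha).trans (h.2 a ha)⟩

theorem Mod.weaken {R A R' A' : ℕ → Prop} {σ τ : Memory} (h : Mod R A σ τ) (hR : ∀ x, R x → R' x)
    (hA : ∀ a, A a → A' a) : Mod R' A' σ τ :=
  ⟨fun x hx => h.1 x fun h' => hx (hR x h'), fun a ha => h.2 a fun h' => ha (hA a h')⟩

theorem Mod.setReg {R A : ℕ → Prop} {σ τ : Memory} (h : Mod R A σ τ) {x : ℕ} (hx : R x) (v : ℕ) :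
    Mod R A σ (τ.setReg x v) := by
  refine ⟨fun y hy => ?_, h.2⟩
  have : y ≠ x := fun e => hy (e ▸ hx)
  simp [this, h.1 y hy]

theorem Mod.setArr {R A : ℕ → Prop} {σ τ : Memory} (h : Mod R A σ τ) {a : ℕ} (ha : A a) (i v : ℕ) :
    Mod R A σ (τ.setArr a i v) := by
  refine ⟨h.1, fun b hb => ?_⟩
  have : b ≠ a := fun e => hb (e ▸ ha)
  funext k
  simp [this, h.2 b hb]

/-- For each `i < n`, in this order, store the value of `e` with `z = i` in cell `i` of `a`. -/
def fill (a z : ℕ) (e : Expr) : Program := forLoop z (.reg 0) (.store a (.reg z) e)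

/-- Cells from `i` on are known to be untouched when cell `i` is computed, so `e` may read the cell
it is about to overwrite. This permits updates in place. -/
theorem runs_fill {a z : ℕ} {e : Expr} {σ : Memory} (val : ℕ → ℕ) (h0 : σ.reg 0 = n) (hz : z ≠ 0)
    (hc : e.cost ≤ 62)
    (he : ∀ i < n, ∀ ρ, Mod (· = z) (· = a) σ ρ → ρ.reg z = i →
      (∀ k, i ≤ k → ρ.arr a k = σ.arr a k) →
      e.eval ρ = val i) :
    Runs n (fill a z e) 12 σ fun τ => Mod (· = z) (· = a) σ τ ∧ ∀ i < n, τ.arr a i = val i := by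
  refine runs_forLoop (N := n) (a := 6) (fun i ρ => ρ.reg z = i ∧ Mod (· = z) (· = a) σ ρ ∧
    (∀ k < i, ρ.arr a k = val k) ∧ ∀ k, i ≤ k → ρ.arr a k = σ.arr a k) (by omega)
    (by simp [Expr.cost]) ?_ ?_ ?_ ?_
  · exact ⟨by simp, Mod.setReg (R := (· = z)) (Mod.refl _ _ σ) rfl 0, by simp, fun k _ => rfl⟩
  · rintro i ρ ⟨h1, h2, -, -⟩
    exact ⟨h1, (h2.1 0 hz.symm).trans h0⟩
  · rintro i hi ρ ⟨h1, h2, h3, h4⟩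
    refine runs_store (by simp only [Expr.cost]; omega) ⟨by simpa using h1, by simp,
      (h2.setArr rfl _ _).setReg rfl _, fun k hk => ?_, fun k hk => ?_⟩
    · rw [Memory.setReg_arr, Memory.setArr_arr]
      by_cases hki : k = i
      · simp [Expr.eval, h1, hki, he i hi ρ h2 h1 h4]
      · simp only [Expr.eval, h1, hki, and_false, if_false]
        exact h3 k (by omega)
    · rw [Memory.setReg_arr, Memory.setArr_arr]
      have hki : k ≠ i := by omega
      simp only [Expr.eval, h1, hki, and_false, if_false]
      exact h4 k (by omega)
  · rintro ρ ⟨-, h2, h3, -⟩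
    exact ⟨h2, h3⟩

open Classical in
/-- The number `1` if `i` is a member of `U`, otherwise `0`. -/
noncomputable def ind (U : Finset (Fin n)) (i : ℕ) : ℕ := if ∃ h : i < n, ⟨i, h⟩ ∈ U then 1 else 0

open Classical in
theorem ind_of_lt (U : Finset (Fin n)) {i : ℕ} (h : i < n) :
    ind U i = if (⟨i, h⟩ : Fin n) ∈ U then 1 else 0 := by
  simp [ind, h]

theorem ind_le_one (U : Finset (Fin n)) (i : ℕ) : ind U i ≤ 1 := by
  unfold ind; split_ifs <;> omega

theorem ind_eq_one {U : Finset (Fin n)} {i : ℕ} : ind U i = 1 ↔ ∃ h : i < n, ⟨i, h⟩ ∈ U := by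
  unfold ind; split_ifs with h <;> simp [h]

theorem ind_coe_eq_one {U : Finset (Fin n)} {i : Fin n} : ind U i = 1 ↔ i ∈ U := by
  simp [ind_eq_one]

theorem ind_eq_iff {U : Finset (Fin n)} {i : ℕ} {v : ℕ} (h : i < n) (hv : v ≤ 1)
    (hU : v = 1 ↔ (⟨i, h⟩ : Fin n) ∈ U) : v = ind U i := by
  have h1 := ind_le_one U i
  have h2 : ind U i = 1 ↔ (⟨i, h⟩ : Fin n) ∈ U := by simp [ind_eq_one, h]
  rw [← h2] at hU
  omega

/-- The array `a` holds the indicator function of the set `U`. -/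
def Enc (σ : Memory) (a : ℕ) (U : Finset (Fin n)) : Prop := ∀ i < n, σ.arr a i = ind U i

theorem Enc.congr {σ τ : Memory} {a : ℕ} {U : Finset (Fin n)} (h : Enc σ a U)
    (e : τ.arr a = σ.arr a) : Enc τ a U := fun i hi => by rw [e, h i hi]

open Classical in
/-- The adjacency indicator. -/
noncomputable def adjInd (G : SimpleGraph (Fin n)) (u v : ℕ) : ℕ := if NAdj G u v then 1 else 0

theorem adjInd_le_one (G : SimpleGraph (Fin n)) (u v : ℕ) : adjInd G u v ≤ 1 := by
  unfold adjInd; split_ifs <;> omega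

theorem adjInd_eq_one {G : SimpleGraph (Fin n)} {u v : ℕ} : adjInd G u v = 1 ↔ NAdj G u v := by
  unfold adjInd; split_ifs with h <;> simp [h]

/-- Register `0` holds `n`, and the adjacency matrix of `G` can be read through the table of row
offsets in array `2`. -/
def Ready (G : SimpleGraph (Fin n)) (σ : Memory) : Prop :=
  σ.reg 0 = n ∧ ∀ u ≤ n, ∀ v < n, σ.arr 0 (σ.arr 2 u + v) = adjInd G u v

theorem Ready.mod {G : SimpleGraph (Fin n)} {σ τ : Memory} {R A : ℕ → Prop} (h : Ready G σ)
    (hm : Mod R A σ τ) (h0 : ¬ R 0) (h1 : ¬ A 0) (h2 : ¬ A 2) : Ready G τ := by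
  unfold Ready
  rw [hm.1 0 h0, hm.2 0 h1, hm.2 2 h2]
  exact h

/-- The expression for the adjacency of the vertices held by two registers. -/
def adjE (u v : ℕ) : Expr := .arr 0 (.add (.arr 2 (.reg u)) (.reg v))

theorem Ready.eval_adjE {G : SimpleGraph (Fin n)} {σ : Memory} (h : Ready G σ) {u v : ℕ}
    (hu : σ.reg u ≤ n) (hv : σ.reg v < n) : (adjE u v).eval σ = adjInd G (σ.reg u) (σ.reg v) :=
  h.2 _ hu _ hv

/-- Count the members of the set held by the array `a`, with result in `s`. -/
def count (s z a : ℕ) : Program :=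
  .seq (.assign s (.const 0)) (forLoop z (.reg 0) (.assign s (.add (.reg s) (.arr a (.reg z)))))

theorem runs_count {s z a : ℕ} {σ : Memory} {U : Finset (Fin n)} (h0 : σ.reg 0 = n) (hz : z ≠ 0)
    (hs : s ≠ 0) (hsz : s ≠ z) (hU : Enc σ a U) :
    Runs n (count s z a) 13 σ fun τ => Mod (fun x => x = s ∨ x = z) (fun _ => False) σ τ ∧
      τ.reg s = U.card := by
  classical
  refine Runs.seq (runs_assign (Q := fun τ => τ = σ.setReg s 0) (by simp [Expr.cost]) rfl) ?_
    (show 6 < 13 by omega) (show 12 < 13 by omega)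
  rintro _ rfl
  refine runs_forLoop (N := n) (a := 6) (fun i ρ => ρ.reg z = i ∧
    Mod (fun x => x = s ∨ x = z) (fun _ => False) σ ρ ∧
    ρ.reg s = (U.filter fun v => v.1 < i).card) (by omega) (by simp [Expr.cost]) ?_ ?_ ?_ ?_
  · exact ⟨by simp, ((Mod.refl _ _ σ).setReg (Or.inl rfl) 0).setReg (Or.inr rfl) 0, by simp [hsz]⟩
  · rintro i ρ ⟨h1, h2, -⟩
    exact ⟨h1, (h2.1 0 (by omega)).trans h0⟩
  · rintro i hi ρ ⟨h1, h2, h3⟩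
    refine runs_assign (by simp [Expr.cost]) ⟨by simpa [hsz.symm] using h1, by simp,
      (h2.setReg (Or.inl rfl) _).setReg (Or.inr rfl) _, ?_⟩
    have h4 : ρ.arr a i = ind U i := by rw [h2.2 a (by simp), hU i hi]
    have h5 : (U.filter fun v => v.1 < i + 1).card =
        (U.filter fun v => v.1 < i).card + ind U i := by
      rw [ind_of_lt U hi]
      split_ifs with h
      · have : (U.filter fun v => v.1 < i + 1) = insert ⟨i, hi⟩ (U.filter fun v => v.1 < i) := by
          ext v
          simp only [Finset.mem_filter, Finset.mem_insert, Fin.ext_iff]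
          constructor
          · rintro ⟨h1, h2⟩
            by_cases hv : v.1 = i
            exacts [Or.inl hv, Or.inr ⟨h1, by omega⟩]
          · rintro (h1 | ⟨h1, h2⟩)
            · exact ⟨by rwa [show v = ⟨i, hi⟩ from Fin.ext h1], by omega⟩
            · exact ⟨h1, by omega⟩
        rw [this, Finset.card_insert_of_notMem (by simp)]
      · congr 1
        refine Finset.filter_congr fun v hv => ?_
        have : v.1 ≠ i := fun e => h (by rwa [show (⟨i, hi⟩ : Fin n) = v from Fin.ext e.symm])
        omega
    rw [h5]
    simp [hsz, Expr.eval, h1, h3, h4]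
  · rintro ρ ⟨-, h2, h3⟩
    refine ⟨h2, h3.trans ?_⟩
    congr 1
    exact Finset.filter_true_of_mem fun v _ => v.2

/-- The program `P` treats the set in the array `b` as input, puts an independent subset of it in
the array `b + 1`, which is maximum for `Good` sets, and modifies nothing below `b`. -/
def Solves (G : SimpleGraph (Fin n)) (P : Program) (b a : ℕ) (Good : Finset (Fin n) → Prop) :
    Prop :=
  ∀ (σ : Memory) (U : Finset (Fin n)), Ready G σ → Enc σ b U →
    Runs n P a σ fun τ => Mod (b ≤ ·) (b ≤ ·) σ τ ∧
      ∃ S, Enc τ (b + 1) S ∧ S ⊆ U ∧ G.IsIndepSet S ∧ (Good U → IsMaxIn G U S)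

variable {G : SimpleGraph (Fin n)}

/-- Compute the lexicographically first maximal independent subset. -/
def lexProgram (b : ℕ) : Program :=
  .seq (fill (b + 1) (b + 1) (.const 0)) <| forLoop b (.reg 0) <|
    .seq (.assign (b + 2) (.arr b (.reg b))) <|
    .seq (forLoop (b + 1) (.reg 0) (.assign (b + 2) (.sub (.reg (b + 2))
      (.sub (.arr (b + 1) (.reg (b + 1))) (.sub (.const 1) (adjE (b + 1) b)))))) <|
    .store (b + 1) (.reg b) (.reg (b + 2))

/-- The inner loop inspects all vertices instead of the smaller ones only: undecided cells still
hold 0 and have no effect, which is why the invariant keeps track of them. -/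
theorem solves_lexProgram (G : SimpleGraph (Fin n)) {b : ℕ} (hb : 3 ≤ b) :
    Solves G (lexProgram b) b 21 (LexGood G) := by
  classical
  intro σ U hσ hU
  refine Runs.seq (a := 12) (b := 20) (runs_fill (fun _ => 0) hσ.1 (by omega) (by simp [Expr.cost])
    (fun i _ ρ _ _ _ => rfl)) ?_ (by omega) (by omega)
  rintro σ1 ⟨hm1, hz1⟩
  have hmod1 : Mod (b ≤ ·) (b + 1 ≤ ·) σ σ1 := hm1.weaken (by intros; omega) (by intros; omega)
  refine runs_forLoop (N := n) (a := 14) (fun i ρ => ρ.reg b = i ∧ Mod (b ≤ ·) (b + 1 ≤ ·) σ ρ ∧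
    (∀ j < n, i ≤ j → ρ.arr (b + 1) j = 0) ∧ ∀ j < i, ρ.arr (b + 1) j ≤ 1 ∧
      (ρ.arr (b + 1) j = 1 ↔ ind U j = 1 ∧ ∀ k < j, ρ.arr (b + 1) k = 1 → ¬ NAdj G k j))
    (by omega) (by simp [Expr.cost]) ?_ ?_ ?_ ?_
  · exact ⟨by simp, hmod1.setReg le_rfl 0, fun j hj _ => hz1 j hj, by simp⟩
  · rintro i ρ ⟨h1, h2, -⟩
    exact ⟨h1, (h2.1 0 (by omega)).trans hσ.1⟩
  · rintro i hi ρ ⟨h1, h2, h3, h4⟩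
    have hρ : Ready G ρ := hσ.mod h2 (by omega) (by omega) (by omega)
    have hUi : ρ.arr b i = ind U i := by rw [h2.2 b (by omega), hU i hi]
    have hle : ∀ j < n, ρ.arr (b + 1) j ≤ 1 := fun j hj => by
      by_cases hji : j < i
      · exact (h4 j hji).1
      · rw [h3 j hj (by omega)]; omega
    refine Runs.seq (a := 6) (b := 13) (runs_assign (Q := fun τ => τ = ρ.setReg (b + 2) (ind U i))
      (by simp [Expr.cost]) (by simp [Expr.eval, h1, hUi])) ?_ (by omega) (by omega)
    rintro _ rfl
    refine Runs.seq (a := 12) (b := 6) (Q := fun τ =>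
      Mod (fun x => x = b + 1 ∨ x = b + 2) (fun _ => False) ρ τ ∧ τ.reg (b + 2) ≤ 1 ∧
      (τ.reg (b + 2) = 1 ↔ ind U i = 1 ∧ ∀ k < n, ρ.arr (b + 1) k = 1 → ¬ NAdj G k i)) ?_ ?_
      (by omega) (by omega)
    · refine runs_forLoop (N := n) (a := 6) (fun y τ => τ.reg (b + 1) = y ∧
        Mod (fun x => x = b + 1 ∨ x = b + 2) (fun _ => False) ρ τ ∧ τ.reg (b + 2) ≤ 1 ∧
        (τ.reg (b + 2) = 1 ↔ ind U i = 1 ∧ ∀ k < y, ρ.arr (b + 1) k = 1 → ¬ NAdj G k i))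
        (by omega) (by simp [Expr.cost]) ?_ ?_ ?_ ?_
      · refine ⟨by simp, ((Mod.refl _ _ ρ).setReg (Or.inr rfl) _).setReg (Or.inl rfl) _, ?_⟩
        simpa using ind_le_one U i
      · rintro y τ ⟨h5, h6, -⟩
        exact ⟨h5, (h6.1 0 (by omega)).trans hρ.1⟩
      · rintro y hy τ ⟨h5, h6, h7, h8⟩
        have hτ : Ready G τ := hρ.mod h6 (by omega) (by simp) (by simp)
        have h9 : τ.reg b = i := (h6.1 b (by omega)).trans h1
        refine runs_assign (by simp [Expr.cost, adjE]) ⟨by simpa using h5, by simp,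
          (h6.setReg (Or.inr rfl) _).setReg (Or.inl rfl) _, ?_⟩
        have h10 := hτ.eval_adjE (u := b + 1) (v := b) (by omega) (by omega)
        have h11 := hle y hy
        have h12 := adjInd_le_one G y i
        have h13 := adjInd_eq_one (G := G) (u := y) (v := i)
        rw [h5, h9] at h10
        have h14 : (∀ k < y + 1, ρ.arr (b + 1) k = 1 → ¬ NAdj G k i) ↔
            (∀ k < y, ρ.arr (b + 1) k = 1 → ¬ NAdj G k i) ∧
            ¬ (ρ.arr (b + 1) y = 1 ∧ adjInd G y i = 1) := by
          rw [h13]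
          constructor
          · exact fun h => ⟨fun k hk => h k (by omega), fun h' => h y (by omega) h'.1 h'.2⟩
          · rintro ⟨h, h'⟩ k hk e
            by_cases hky : k = y
            · subst hky; exact fun h'' => h' ⟨e, h''⟩
            · exact h k (by omega) e
        rw [h14, ← and_assoc, ← h8]
        simp only [Memory.setReg_reg, Expr.eval, h10, h5, h6.2 (b + 1) (by simp)]
        rw [if_neg (by omega), if_pos trivial]
        omega
      · rintro τ ⟨-, h6⟩
        exact h6
    · rintro τ ⟨h6, h7, h8⟩
      have h9 : τ.reg b = i := (h6.1 b (by omega)).trans h1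
      have h10 : Mod (b ≤ ·) (b + 1 ≤ ·) σ τ :=
        h2.trans (h6.weaken (by intros; omega) (by intros; contradiction))
      refine runs_store (by simp [Expr.cost]) ⟨by simpa using h9, by simp,
        (h10.setArr le_rfl _ _).setReg le_rfl _, ?_, ?_⟩
      · intro j hj hij
        rw [Memory.setReg_arr, Memory.setArr_arr, if_neg (by simp only [Expr.eval]; omega),
          h6.2 (b + 1) (by simp), h3 j hj (by omega)]
      · have h11 : ∀ k, k ≠ i → (τ.setArr (b + 1) (Expr.eval τ (.reg b))
            (Expr.eval τ (.reg (b + 2)))).arr (b + 1) k = ρ.arr (b + 1) k := by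
          intro k hk
          rw [Memory.setArr_arr, if_neg (by simp only [Expr.eval]; omega), h6.2 (b + 1) (by simp)]
        intro j hj
        rw [Memory.setReg_arr]
        have h12 : (∀ k < j, (τ.setArr (b + 1) (Expr.eval τ (.reg b))
            (Expr.eval τ (.reg (b + 2)))).arr (b + 1) k = 1 → ¬ NAdj G k j) ↔
            ∀ k < j, ρ.arr (b + 1) k = 1 → ¬ NAdj G k j := by
          refine forall_congr' fun k => forall_congr' fun hk => ?_
          rw [h11 k (by omega)]
        rw [h12]
        by_cases hji : j = i
        · subst hji
          rw [Memory.setArr_arr, if_pos (by simp [Expr.eval, h9])]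
          refine ⟨h7, h8.trans (and_congr_right fun _ => ?_)⟩
          refine ⟨fun h k hk => h k (by omega), fun h k hk e => h k ?_ e⟩
          by_contra hlt
          rw [h3 k hk (by omega)] at e
          omega
        · rw [h11 j hji]
          exact h4 j (by omega)
  · rintro τ ⟨-, h2, -, h4⟩
    refine ⟨h2.weaken (fun _ h => h) (by intros; omega), Finset.univ.filter fun v : Fin n =>
      τ.arr (b + 1) v = 1, fun i hi => ind_eq_iff hi (h4 i hi).1 (by simp), ?_⟩
    have hlex : IsLex G U (Finset.univ.filter fun v : Fin n => τ.arr (b + 1) v = 1) := by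
      constructor
      · intro v hv
        simp only [Finset.mem_filter, Finset.mem_univ, true_and] at hv
        exact ind_coe_eq_one.1 ((h4 v v.2).2.1 hv).1
      · intro x hx
        simp only [Finset.mem_filter, Finset.mem_univ, true_and]
        rw [(h4 x x.2).2, and_iff_right (ind_coe_eq_one.2 hx)]
        constructor
        · exact fun h y hy hyx e => h y hyx hy (nAdj_coe.2 e)
        · exact fun h k hk hk1 e => h ⟨k, by omega⟩ hk1 hk (nAdj_coe.1 e)
    exact ⟨hlex.1, hlex.indep, fun h => h _ hlex⟩

/-- Run `P` on one trimming of the input, and keep the result if it is the largest so far. -/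
def branchBody (b : ℕ) (P : Program) : Program :=
  .seq (fill (b + 10) (b + 3) (.sub (.arr b (.reg (b + 3)))
    (.add (.sub (.sub (.const 1) (.sub (.reg (b + 3)) (.reg (b + 1))))
        (.sub (.reg (b + 1)) (.reg (b + 3))))
      (.sub (adjE (b + 2) (b + 3)) (.sub (.const 1) (.sub (.reg b) (.reg (b + 3)))))))) <|
  .seq P <| .seq (count (b + 5) (b + 3) (b + 11)) <|
  .ite (.reg (b + 4)) (.reg (b + 5))
    (.seq (.assign (b + 4) (.reg (b + 5))) (fill (b + 1) (b + 3) (.arr (b + 11) (.reg (b + 3)))))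
    .skip

/-- Run `P` on all trimmings of the input, and return the largest result. -/
def branch (b : ℕ) (P : Program) : Program :=
  .seq (.assign (b + 4) (.const 0)) <| .seq (fill (b + 1) (b + 3) (.const 0)) <|
  forLoop b (.add (.reg 0) (.const 1)) <| forLoop (b + 1) (.add (.reg 0) (.const 1)) <|
  forLoop (b + 2) (.add (.reg 0) (.const 1)) (branchBody b P)

/-- The state of `branch`: the largest result so far is stored, and it is at least as large as all
independent subsets of the `Good` trimmings in `K`. -/
def BranchState (G : SimpleGraph (Fin n)) (Good : Finset (Fin n) → Prop) (U : Finset (Fin n))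
    (b : ℕ) (σ : Memory) (K : ℕ → ℕ → ℕ → Prop) (ρ : Memory) : Prop :=
  Mod (b ≤ ·) (b + 1 ≤ ·) σ ρ ∧ ∃ S, Enc ρ (b + 1) S ∧ S ⊆ U ∧ G.IsIndepSet S ∧
    ρ.reg (b + 4) = S.card ∧ ∀ x y w, K x y w → Good (trim G U x y w) →
      ∀ I ⊆ trim G U x y w, G.IsIndepSet I → I.card ≤ S.card

theorem BranchState.setReg {Good : Finset (Fin n) → Prop} {U : Finset (Fin n)} {b : ℕ}
    {σ ρ : Memory} {K : ℕ → ℕ → ℕ → Prop} (h : BranchState G Good U b σ K ρ) {x : ℕ} (hx : b ≤ x)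
    (hx4 : x ≠ b + 4) (v : ℕ) : BranchState G Good U b σ K (ρ.setReg x v) := by
  obtain ⟨h1, S, h2, h3, h4, h5, h6⟩ := h
  exact ⟨h1.setReg hx v, S, h2, h3, h4, by simpa [hx4.symm] using h5, h6⟩

theorem BranchState.mono {Good : Finset (Fin n) → Prop} {U : Finset (Fin n)} {b : ℕ}
    {σ ρ : Memory} {K K' : ℕ → ℕ → ℕ → Prop} (h : BranchState G Good U b σ K ρ)
    (hK : ∀ x y w, K' x y w → K x y w) : BranchState G Good U b σ K' ρ := by
  obtain ⟨h1, S, h2, h3, h4, h5, h6⟩ := h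
  exact ⟨h1, S, h2, h3, h4, h5, fun x y w h => h6 x y w (hK x y w h)⟩

/-- Wrong guesses are harmless: `P` still returns independent subsets of `U` for them, and one good
trimming containing an optimum makes the largest result optimal. -/
theorem solves_branch {b a : ℕ} {P : Program} {Good : Finset (Fin n) → Prop} (hb : 3 ≤ b)
    (ha : 20 ≤ a) (hP : Solves G P (b + 10) a Good) :
    Solves G (branch b P) b (a + 23) (BranchGood G Good) := by
  classical
  intro σ U hσ hU
  have hready : ∀ K ρ, BranchState G Good U b σ K ρ → Ready G ρ := fun K ρ h =>
    hσ.mod h.1 (by omega) (by omega) (by omega)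
  refine Runs.seq (a := 6) (b := a + 22) (runs_assign (Q := fun τ => τ = σ.setReg (b + 4) 0)
    (by simp [Expr.cost]) rfl) ?_ (by omega) (by omega)
  rintro _ rfl
  refine Runs.seq (a := 12) (b := a + 21) (runs_fill (fun _ => 0)
    (by rw [Memory.setReg_reg, if_neg (by omega)]; exact hσ.1) (by omega)
    (by simp [Expr.cost]) (fun i _ ρ _ _ _ => rfl)) ?_ (by omega) (by omega)
  rintro σ1 ⟨hm1, hz1⟩
  have hst0 : BranchState G Good U b σ (fun _ _ _ => False) σ1 := by
    refine ⟨Mod.trans (Mod.setReg (Mod.refl _ _ σ) (by omega) 0)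
      (hm1.weaken (by intros; omega) (by intros; omega)), ∅, fun i hi => ?_, by simp, by simp, ?_,
      by simp⟩
    · rw [hz1 i hi]; simp [ind]
    · rw [hm1.1 _ (by omega)]; simp
  have hbody : ∀ K ρ i j k, i ≤ n → j ≤ n → k ≤ n → BranchState G Good U b σ K ρ → ρ.reg b = i →
      ρ.reg (b + 1) = j → ρ.reg (b + 2) = k →
      Runs n (branchBody b P) (a + 2) ρ fun τ => τ.reg b = i ∧ τ.reg (b + 1) = j ∧
        τ.reg (b + 2) = k ∧
        BranchState G Good U b σ (fun x y w => K x y w ∨ (x = i ∧ y = j ∧ w = k)) τ := by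
    intro K ρ i j k hi hj hk hst h1 h2 h3
    have hρ := hready K ρ hst
    obtain ⟨hm, S, hS, hSU, hSi, hSc, hSK⟩ := hst
    refine Runs.seq (a := 12) (b := a + 1) (runs_fill (fun z => ind (trim G U i j k) z) hρ.1
      (by omega) (by simp [Expr.cost, adjE]) ?_) ?_ (by omega) (by omega)
    · intro z hz τ hτ hτz _
      have hτr : Ready G τ := hρ.mod hτ (by omega) (by omega) (by omega)
      have h4 : τ.reg b = i := (hτ.1 b (by omega)).trans h1
      have h5 : τ.reg (b + 1) = j := (hτ.1 _ (by omega)).trans h2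
      have h6 : τ.reg (b + 2) = k := (hτ.1 _ (by omega)).trans h3
      have h7 := hτr.eval_adjE (u := b + 2) (v := b + 3) (by omega) (by omega)
      rw [h6, hτz] at h7
      have h8 : τ.arr b z = ind U z := by
        rw [hτ.2 b (by omega), hm.2 b (by omega), hU z hz]
      have h9 := ind_le_one U z
      have h10 := adjInd_le_one G k z
      -- In truncated arithmetic the stored value is the indicator of `U` minus those of `z = j` and
      -- of `z < i` with `z` adjacent to `k`.
      simp only [Expr.eval, hτz, h4, h5, h7, h8]
      refine ind_eq_iff hz (by omega) ?_
      rw [mem_trim, ← ind_coe_eq_one, ← adjInd_eq_one]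
      simp only
      omega
    rintro τ1 ⟨hm1, hE1⟩
    have hτ1 : Ready G τ1 := hρ.mod hm1 (by omega) (by omega) (by omega)
    refine Runs.seq (a := a) (b := 15) (hP τ1 _ hτ1 hE1) ?_ (by omega) (by omega)
    rintro τ2 ⟨hm2, S', hS', hS'U, hS'i, hS'G⟩
    have hτ2 : Ready G τ2 := hτ1.mod hm2 (by omega) (by omega) (by omega)
    refine Runs.seq (a := 13) (b := 14) (runs_count hτ2.1 (by omega) (by omega) (by omega) hS') ?_
      (by omega) (by omega)
    rintro τ3 ⟨hm3, hc3⟩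
    have hτ3 : Ready G τ3 := hτ2.mod hm3 (by omega) (by simp) (by simp)
    have hreg : ∀ x, x < b + 3 ∨ x = b + 4 → τ3.reg x = ρ.reg x := fun x hx => by
      rw [hm3.1 x (by omega), hm2.1 x (by omega), hm1.1 x (by omega)]
    have harr : ∀ x, x < b + 10 → τ3.arr x = ρ.arr x := fun x hx => by
      rw [hm3.2 x (by simp), hm2.2 x (by omega), hm1.2 x (by omega)]
    have hm' : Mod (b ≤ ·) (b + 1 ≤ ·) σ τ3 := hm.trans
      ⟨fun x hx => hreg x (by omega), fun x hx => harr x (by omega)⟩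
    have hmax : Good (trim G U i j k) → ∀ I ⊆ trim G U i j k, G.IsIndepSet I →
        I.card ≤ S'.card := fun h => (hS'G h).2.2
    refine runs_ite (a := 13) (by omega) (by simp [Expr.cost]) ?_ ?_
    · intro hlt
      simp only [Expr.eval, hreg (b + 4) (by omega), hc3, hSc] at hlt
      refine Runs.seq (a := 6) (b := 12) (runs_assign
        (Q := fun τ => τ = τ3.setReg (b + 4) S'.card) (by simp [Expr.cost])
        (by simp [Expr.eval, hc3])) ?_ (by omega) (by omega)
      rintro _ rfl
      refine (runs_fill (fun z => ind S' z)
        (by rw [Memory.setReg_reg, if_neg (by omega)]; exact hτ3.1)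
        (by omega) (by simp [Expr.cost]) ?_).mono le_rfl ?_
      · intro z hz τ hτ hτz _
        simp only [Expr.eval, hτz]
        rw [hτ.2 _ (by omega), Memory.setReg_arr, hm3.2 _ (by simp)]
        exact hS' z hz
      · rintro τ4 ⟨hm4, hE4⟩
        have hreg4 : ∀ x, x < b + 3 → τ4.reg x = ρ.reg x := fun x hx => by
          rw [hm4.1 x (by omega), Memory.setReg_reg, if_neg (by omega), hreg x (by omega)]
        refine ⟨(hreg4 b (by omega)).trans h1, (hreg4 _ (by omega)).trans h2,
          (hreg4 _ (by omega)).trans h3, (hm'.setReg (by omega) _).trans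
          (hm4.weaken (by intros; omega) (by intros; omega)), S', hE4, hS'U.trans trim_subset, hS'i,
          ?_, ?_⟩
        · rw [hm4.1 _ (by omega)]; simp
        · rintro x y w (hK | ⟨rfl, rfl, rfl⟩) hG I hI hIi
          · exact (hSK x y w hK hG I hI hIi).trans hlt.le
          · exact hmax hG I hI hIi
    · intro hlt
      simp only [Expr.eval, hreg (b + 4) (by omega), hc3, hSc] at hlt
      refine runs_skip ⟨(hreg b (by omega)).trans h1, (hreg _ (by omega)).trans h2,
          (hreg _ (by omega)).trans h3, hm', S, hS.congr (harr _ (by omega)), hSU, hSi,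
          (hreg _ (by omega)).trans hSc, ?_⟩
      rintro x y w (hK | ⟨rfl, rfl, rfl⟩) hG I hI hIi
      · exact hSK x y w hK hG I hI hIi
      · have := hmax hG I hI hIi
        omega
  have heval : ∀ ρ, Ready G ρ → Expr.eval ρ (.add (.reg 0) (.const 1)) = n + 1 := fun ρ h => by
    simp [Expr.eval, h.1]
  refine (runs_forLoop (N := n + 1) (a := a + 14) (fun i ρ => ρ.reg b = i ∧
    BranchState G Good U b σ (fun x y w => x < i ∧ y ≤ n ∧ w ≤ n) ρ) le_rfl (by simp [Expr.cost])
    ?_ ?_ ?_ (fun ρ h => h.2)).mono (by omega) ?_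
  · exact ⟨by simp, (hst0.setReg le_rfl (by omega) 0).mono (by simp)⟩
  · rintro i ρ ⟨h1, h2⟩
    exact ⟨h1, heval ρ (hready _ ρ h2)⟩
  · rintro i hi ρ ⟨h1, h2⟩
    refine (runs_forLoop (N := n + 1) (a := a + 8) (fun j ρ => ρ.reg b = i ∧ ρ.reg (b + 1) = j ∧
      BranchState G Good U b σ (fun x y w => (x < i ∧ y ≤ n ∧ w ≤ n) ∨ (x = i ∧ y < j ∧ w ≤ n)) ρ)
      le_rfl (by simp [Expr.cost]) ?_ ?_ ?_ (fun ρ h => h)).mono (by omega) ?_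
    · exact ⟨by simpa using h1, by simp, (h2.setReg (by omega) (by omega) 0).mono (by simp)⟩
    · rintro j ρ ⟨h1, h2, h3⟩
      exact ⟨h2, heval ρ (hready _ ρ h3)⟩
    · rintro j hj ρ ⟨h1, h2, h3⟩
      refine (runs_forLoop (N := n + 1) (a := a + 2) (fun k ρ => ρ.reg b = i ∧
        ρ.reg (b + 1) = j ∧ ρ.reg (b + 2) = k ∧ BranchState G Good U b σ (fun x y w =>
          ((x < i ∧ y ≤ n ∧ w ≤ n) ∨ (x = i ∧ y < j ∧ w ≤ n)) ∨ (x = i ∧ y = j ∧ w < k)) ρ)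
        le_rfl (by simp [Expr.cost]) ?_ ?_ ?_ (fun ρ h => h)).mono (by omega) ?_
      · exact ⟨by simpa using h1, by simpa using h2, by simp,
          (h3.setReg (by omega) (by omega) 0).mono (by simp)⟩
      · rintro k ρ ⟨h1, h2, h3, h4⟩
        exact ⟨h3, heval ρ (hready _ ρ h4)⟩
      · rintro k hk ρ ⟨h1, h2, h3, h4⟩
        refine (hbody _ ρ i j k (by omega) (by omega) (by omega) h4 h1 h2 h3).mono le_rfl ?_
        rintro τ ⟨h5, h6, h7, h8⟩
        refine ⟨h7, by simpa using h5, by simpa using h6, by simp,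
          (h8.setReg (by omega) (by omega) _).mono ?_⟩
        intro x y w h
        omega
      · rintro τ ⟨h5, h6, h7, h8⟩
        refine ⟨h6, by simpa using h5, by simp, (h8.setReg (by omega) (by omega) _).mono ?_⟩
        intro x y w h
        omega
    · rintro τ ⟨h5, h6, h7⟩
      refine ⟨h5, by simp, (h7.setReg (by omega) (by omega) _).mono ?_⟩
      intro x y w h
      omega
  · rintro τ ⟨h1, S, h2, h3, h4, -, h5⟩
    refine ⟨h1.weaken (fun _ h => h) (by intros; omega), S, h2, h3, h4, ?_⟩
    rintro ⟨x, hx, y, hy, w, hw, hG, I, hI, hImax⟩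
    refine ⟨h3, h4, fun T hT hTi => (hImax.2.2 T hT hTi).trans ?_⟩
    exact h5 x y w ⟨by omega, hy, hw⟩ hG I hI hImax.2.1

end RAM

/-! ### Leaf blocks and the exchange argument -/

section Peeling

theorem compIn_eq_of_closed {V : Type} {G : SimpleGraph V} {S D : Set V} {r : V} (hD : D ⊆ S)
    (hr : r ∈ D) (hc : Conn G D) (hcl : ∀ x ∈ D, ∀ y ∈ S, G.Adj x y → y ∈ D) :
    compIn G S r = D := by
  refine Set.Subset.antisymm ?_ fun y hy => ⟨D, hD, hc, hr, hy⟩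
  exact (conn_compIn (hD hr)).subset_of_closed ⟨r, mem_compIn_self (hD hr), hr⟩
    fun x hx y hy _ e => hcl x hx y (compIn_subset _ _ hy) e

/-- A smallest component left by the deletion of an adjacent vertex `c` forms a block with `c`. -/
theorem twoConn_insert_compIn {V : Type} [Finite V] {G : SimpleGraph V} {S : Set V} {c r : V}
    (hc : c ∈ S) (hr : r ∈ S) (e : G.Adj c r)
    (hmin : ∀ c' ∈ S, ∀ r' ∈ S, G.Adj c' r' →
      (compIn G (S \ {c}) r).ncard ≤ (compIn G (S \ {c'}) r').ncard) :
    TwoConn G (insert c (compIn G (S \ {c}) r)) := by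
  have hr' : r ∈ S \ {c} := ⟨hr, fun h => e.ne h.symm⟩
  set D := compIn G (S \ {c}) r with hD
  have hrD : r ∈ D := mem_compIn_self hr'
  have hcD : c ∉ D := fun h => (compIn_subset _ _ h).2 rfl
  have hDS : ∀ x ∈ D, x ∈ S := fun x hx => (compIn_subset _ _ hx).1
  have hconn : Conn G D := conn_compIn hr'
  refine ⟨⟨c, Or.inl rfl, r, Or.inr hrD, e.ne⟩, hconn.insert_adj hrD e.symm, ?_⟩
  rintro x (rfl | hx)
  · rwa [Set.insert_sdiff_self_of_notMem hcD]
  have hxc : x ≠ c := fun h => hcD (h ▸ hx)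
  -- If deleting `x` cut off a part `A` without `c`, some neighbour `y` of `x` in `A` would have its
  -- component of `S \ {x}` inside `A`. That component misses `x`, so it is smaller than `D`,
  -- against minimality.
  have key : ∀ A ⊆ insert c D \ {x}, A.Nonempty → c ∉ A →
      ¬ ∀ a ∈ A, ∀ y ∈ insert c D \ {x}, G.Adj a y → y ∈ A := by
    rintro A hA ⟨a, ha⟩ hcA hcl
    have hAD : A ⊆ D := fun z hz => (hA hz).1.resolve_left fun h => hcA (h ▸ hz)
    have hxA : x ∉ A := fun h => (hA h).2 rfl
    obtain ⟨y, -, hyA, z, hz, hzA, e'⟩ := hconn.exists_adj (hAD ha) ha hx hxA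
    obtain rfl : z = x := by
      by_contra hzx
      exact hzA (hcl y hyA z ⟨Or.inr hz, hzx⟩ e')
    have hy : y ∈ S \ {z} := ⟨hDS y (hAD hyA), (hA hyA).2⟩
    have hsub : compIn G (S \ {z}) y ⊆ A := by
      refine (conn_compIn hy).subset_of_closed ⟨y, mem_compIn_self hy, hyA⟩ ?_
      intro u hu v hv _ e''
      have hvS := compIn_subset _ _ hv
      refine hcl u hu v ⟨?_, hvS.2⟩ e''
      by_cases hvc : v = c
      · exact Or.inl hvc
      · exact Or.inr (compIn_closed (hAD hu) ⟨hvS.1, hvc⟩ e'')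
    have h1 := hmin z (hDS z hx) y hy.1 e'.symm
    have h2 : (compIn G (S \ {z}) y).ncard < D.ncard :=
      Set.ncard_lt_ncard ⟨hsub.trans hAD, fun h => hxA (hsub (h hx))⟩ (Set.toFinite _)
    omega
  refine ⟨⟨c, Or.inl rfl, hxc.symm⟩, fun A hA hne hcl => hA.antisymm fun y hy => ?_⟩
  by_cases hcA : c ∈ A
  · by_contra hyA
    refine key ((insert c D \ {x}) \ A) Set.sdiff_subset ⟨y, hy, hyA⟩ (fun h => h.2 hcA) ?_
    exact fun u hu v hv e' => ⟨hv, fun h => hu.2 (hcl v h u hu.1 e'.symm)⟩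
  · exact absurd hcl (key A hA hne hcA)

variable {n : ℕ} {G : SimpleGraph (Fin n)}

/-- The intermediate states of peeling: `S` has been selected, the vertices in `C` are still to be
processed. -/
structure PeelState (G : SimpleGraph (Fin n)) (Good : Finset (Fin n) → Prop)
    (U S C : Finset (Fin n)) : Prop where
  sub : S ⊆ U
  rest : C ⊆ U
  disj : Disjoint S C
  indep : G.IsIndepSet S
  sep : ∀ x ∈ S, ∀ y ∈ C, ¬ G.Adj x y
  bound : PeelGood G Good U → ∀ T ⊆ U, G.IsIndepSet T →
    ∃ T' ⊆ C, G.IsIndepSet T' ∧ T.card ≤ S.card + T'.card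

theorem PeelState.start (Good : Finset (Fin n) → Prop) (U : Finset (Fin n)) :
    PeelState G Good U ∅ U :=
  ⟨by simp, subset_rfl, by simp, by simp, by simp, fun _ T hT hTi => ⟨T, hT, hTi, by simp⟩⟩

theorem PeelState.finish {Good : Finset (Fin n) → Prop} {U S C : Finset (Fin n)}
    (h : PeelState G Good U S C) (hC : ∀ x ∈ C, ∀ y ∈ C, ¬ G.Adj x y) :
    S ∪ C ⊆ U ∧ G.IsIndepSet (S ∪ C : Finset (Fin n)) ∧
      (PeelGood G Good U → IsMaxIn G U (S ∪ C)) := by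
  have h1 : S ∪ C ⊆ U := Finset.union_subset h.sub h.rest
  have h2 : G.IsIndepSet (S ∪ C : Finset (Fin n)) := by
    rw [indep_iff]
    intro x hx y hy e
    rcases Finset.mem_union.1 hx with hx | hx <;> rcases Finset.mem_union.1 hy with hy | hy
    · exact indep_iff.1 h.indep x hx y hy e
    · exact h.sep x hx y hy e
    · exact h.sep y hy x hx e.symm
    · exact hC x hx y hy e
  refine ⟨h1, h2, fun hg => ⟨h1, h2, fun T hT hTi => ?_⟩⟩
  obtain ⟨T', hT', -, hc⟩ := h.bound hg T hT hTi
  have := Finset.card_le_card hT'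
  rw [Finset.card_union_of_disjoint h.disj]
  omega

theorem indep_subset {S T : Finset (Fin n)} (h : G.IsIndepSet T) (hS : S ⊆ T) : G.IsIndepSet S :=
  indep_iff.2 fun x hx y hy => indep_iff.1 h x (hS hx) y (hS hy)

/-- Select an independent subset `R` of the part `A` of the unprocessed vertices. -/
theorem PeelState.extend {Good : Finset (Fin n) → Prop} {U S C R A : Finset (Fin n)}
    (h : PeelState G Good U S C) (hA : A ⊆ C) (hR : R ⊆ A) (hRi : G.IsIndepSet R)
    (hsep : ∀ x ∈ R, ∀ y ∈ C, y ∉ A → ¬ G.Adj x y)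
    (hbound : PeelGood G Good U → ∀ T ⊆ A, G.IsIndepSet T → T.card ≤ R.card) :
    PeelState G Good U (S ∪ R) (C \ A) := by
  have hdisj : Disjoint S R := h.disj.mono_right (hR.trans hA)
  constructor
  · exact Finset.union_subset h.sub ((hR.trans hA).trans h.rest)
  · exact Finset.sdiff_subset.trans h.rest
  · refine Finset.disjoint_union_left.2 ⟨h.disj.mono_right Finset.sdiff_subset, ?_⟩
    exact Finset.disjoint_sdiff.mono_left hR
  · rw [indep_iff]
    intro x hx y hy e
    rcases Finset.mem_union.1 hx with hx | hx <;> rcases Finset.mem_union.1 hy with hy | hy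
    · exact indep_iff.1 h.indep x hx y hy e
    · exact h.sep x hx y (hA (hR hy)) e
    · exact h.sep y hy x (hA (hR hx)) e.symm
    · exact indep_iff.1 hRi x hx y hy e
  · intro x hx y hy
    obtain ⟨hy1, hy2⟩ := Finset.mem_sdiff.1 hy
    rcases Finset.mem_union.1 hx with hx | hx
    · exact h.sep x hx y hy1
    · exact hsep x hx y hy1 hy2
  · intro hg T hT hTi
    obtain ⟨T', hT', hTi', hc⟩ := h.bound hg T hT hTi
    refine ⟨T' \ A, Finset.sdiff_subset_sdiff hT' subset_rfl,
      indep_subset hTi' Finset.sdiff_subset, ?_⟩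
    have h1 := hbound hg (T' ∩ A) Finset.inter_subset_right
      (indep_subset hTi' Finset.inter_subset_left)
    have h2 := Finset.card_inter_add_card_sdiff T' A
    rw [Finset.card_union_of_disjoint hdisj]
    omega

open Classical in
/-- The members of `D` that are not neighbours of `c`. -/
noncomputable def nonNbrs (G : SimpleGraph (Fin n)) (c : Fin n) (D : Finset (Fin n)) :
    Finset (Fin n) :=
  D.filter fun z => ¬ G.Adj c z

theorem mem_nonNbrs {c z : Fin n} {D : Finset (Fin n)} :
    z ∈ nonNbrs G c D ↔ z ∈ D ∧ ¬ G.Adj c z := by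
  classical
  simp [nonNbrs]

/-- The vertex set `D` is a smallest component left by the deletion of an adjacent vertex `c`. -/
def IsLeaf (G : SimpleGraph (Fin n)) (C : Finset (Fin n)) (c : Fin n) (D : Finset (Fin n)) : Prop :=
  c ∈ C ∧ ∃ r ∈ C, G.Adj c r ∧ compIn G ((C : Set (Fin n)) \ {c}) r = D

theorem IsLeaf.subset {C D : Finset (Fin n)} {c : Fin n} (h : IsLeaf G C c D) : D ⊆ C := by
  obtain ⟨-, r, -, -, h⟩ := h
  exact fun x hx => (compIn_subset _ _ (h.ge hx : x ∈ compIn G ((C : Set (Fin n)) \ {c}) r)).1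

theorem IsLeaf.notMem {C D : Finset (Fin n)} {c : Fin n} (h : IsLeaf G C c D) : c ∉ D := by
  obtain ⟨-, r, -, -, h⟩ := h
  exact fun hx => (compIn_subset _ _ (h.ge hx : c ∈ compIn G ((C : Set (Fin n)) \ {c}) r)).2 rfl

theorem IsLeaf.nonempty {C D : Finset (Fin n)} {c : Fin n} (h : IsLeaf G C c D) : D.Nonempty := by
  obtain ⟨-, r, hr, e, h⟩ := h
  exact ⟨r, h.le (mem_compIn_self ⟨hr, fun h => e.ne h.symm⟩)⟩

theorem IsLeaf.closed {C D : Finset (Fin n)} {c x y : Fin n} (h : IsLeaf G C c D) (hx : x ∈ D)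
    (hy : y ∈ C) (hyc : y ≠ c) (e : G.Adj x y) : y ∈ D := by
  obtain ⟨-, r, -, -, h⟩ := h
  exact h.le (compIn_closed (h.ge hx) ⟨hy, hyc⟩ e)

theorem IsLeaf.twoConn {C D : Finset (Fin n)} {c : Fin n} (h : IsLeaf G C c D)
    (hmin : ∀ c' ∈ C, ∀ r' ∈ C, G.Adj c' r' →
      D.card ≤ (compIn G ((C : Set (Fin n)) \ {c'}) r').ncard) :
    TwoConn G (insert c (D : Set (Fin n))) := by
  obtain ⟨hc, r, hr, e, h⟩ := h
  rw [← h]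
  refine twoConn_insert_compIn hc hr e fun c' hc' r' hr' e' => ?_
  rw [h, Set.ncard_coe_finset]
  exact hmin c' hc' r' hr' e'

/-- Using `c` gains one vertex but restricts the choice in `D` to non-neighbours of `c`. If this
costs at least one vertex, `R` is optimal for `D` together with `c`, and `c` is dropped. Otherwise
`R'` is optimal for `D` and leaves `c` free for later rounds. -/
theorem PeelState.step {Good : Finset (Fin n) → Prop} {U S C D R R' : Finset (Fin n)} {c : Fin n}
    (h : PeelState G Good U S C) (hD : IsLeaf G C c D)
    (hmin : ∀ c' ∈ C, ∀ r' ∈ C, G.Adj c' r' →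
      D.card ≤ (compIn G ((C : Set (Fin n)) \ {c'}) r').ncard)
    (hRD : R ⊆ D) (hRi : G.IsIndepSet R) (hRG : Good D → IsMaxIn G D R)
    (hRD' : R' ⊆ nonNbrs G c D) (hRi' : G.IsIndepSet R')
    (hRG' : Good (nonNbrs G c D) → IsMaxIn G (nonNbrs G c D) R') :
    if R'.card < R.card then PeelState G Good U (S ∪ R) (C \ insert c D)
      else PeelState G Good U (S ∪ R') (C \ D) := by
  have hsub : nonNbrs G c D ⊆ D := fun z hz => (mem_nonNbrs.1 hz).1
  have hgood : PeelGood G Good U → IsMaxIn G D R ∧ IsMaxIn G (nonNbrs G c D) R' := fun hg => by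
    have := hg D c (hD.subset.trans h.rest) (h.rest hD.1) hD.notMem (hD.twoConn hmin)
    exact ⟨hRG (this D subset_rfl), hRG' (this _ hsub)⟩
  split_ifs with hlt
  · refine h.extend (Finset.insert_subset hD.1 hD.subset) (hRD.trans (Finset.subset_insert _ _)) hRi
      ?_ ?_
    · intro x hx y hy hyn e
      rw [Finset.mem_insert, not_or] at hyn
      exact hyn.2 (hD.closed (hRD hx) hy hyn.1 e)
    · intro hg T hT hTi
      obtain ⟨h1, h2⟩ := hgood hg
      by_cases hcT : c ∈ T
      · have h3 := h2.2.2 (T.erase c) (fun z hz => mem_nonNbrs.2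
          ⟨(Finset.mem_insert.1 (hT (Finset.mem_of_mem_erase hz))).resolve_left
            (Finset.ne_of_mem_erase hz),
          indep_iff.1 hTi c hcT z (Finset.mem_of_mem_erase hz)⟩)
          (indep_subset hTi (Finset.erase_subset _ _))
        have h4 := Finset.card_erase_add_one hcT
        omega
      · exact h1.2.2 T (fun z hz => (Finset.mem_insert.1 (hT hz)).resolve_left
          fun h => hcT (h ▸ hz)) hTi
  · refine h.extend hD.subset (hRD'.trans hsub) hRi' ?_ ?_
    · intro x hx y hy hyn e
      by_cases hyc : y = c
      · subst hyc
        exact (mem_nonNbrs.1 (hRD' hx)).2 e.symm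
      · exact hyn (hD.closed (hsub (hRD' hx)) hy hyc e)
    · intro hg T hT hTi
      have := (hgood hg).1.2.2 T hT hTi
      omega

end Peeling

/-! ### Programs for components, leaf search, peeling and the full recursion -/

namespace RAM

variable {n : ℕ} {G : SimpleGraph (Fin n)}

theorem runs_fill_set {a z : ℕ} {e : Expr} {σ : Memory} (S : Finset (Fin n)) (h0 : σ.reg 0 = n)
    (hz : z ≠ 0) (hc : e.cost ≤ 62)
    (he : ∀ i : Fin n, ∀ ρ, Mod (· = z) (· = a) σ ρ → ρ.reg z = i →
      (∀ k, i.1 ≤ k → ρ.arr a k = σ.arr a k) → e.eval ρ ≤ 1 ∧ (e.eval ρ = 1 ↔ i ∈ S)) :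
    Runs n (fill a z e) 12 σ fun τ => Mod (· = z) (· = a) σ τ ∧ Enc τ a S :=
  runs_fill (ind S) h0 hz hc fun i hi ρ h1 h2 h3 =>
    ind_eq_iff hi (he ⟨i, hi⟩ ρ h1 h2 h3).1 (he ⟨i, hi⟩ ρ h1 h2 h3).2

/-- The expression with value `1` if the registers `x` and `z` agree, otherwise `0`. -/
def eqE (x z : ℕ) : Expr :=
  .sub (.const 1) (.add (.sub (.reg x) (.reg z)) (.sub (.reg z) (.reg x)))

theorem eval_eqE (σ : Memory) (x z : ℕ) :
    (eqE x z).eval σ ≤ 1 ∧ ((eqE x z).eval σ = 1 ↔ σ.reg z = σ.reg x) := by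
  simp only [eqE, Expr.eval]
  omega

/-- Compute in the array `b + 4` the component of the vertex in the register `b + 2` in the set held
by the array `b + 3`. -/
def component (b : ℕ) : Program :=
  .seq (fill (b + 4) (b + 7) (eqE (b + 2) (b + 7))) <|
  forLoop (b + 5) (.reg 0) <| forLoop (b + 6) (.reg 0) <|
  .seq (.assign (b + 11) (.arr (b + 4) (.reg (b + 6)))) <|
  fill (b + 4) (b + 7) (.sub (.const 1) (.sub (.const 1) (.add (.arr (b + 4) (.reg (b + 7)))
    (.sub (.add (.reg (b + 11)) (.add (adjE (b + 6) (b + 7)) (.arr (b + 3) (.reg (b + 7)))))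
      (.const 2)))))

/-- The frame of `component`. -/
abbrev ComponentMod (b : ℕ) : Memory → Memory → Prop :=
  Mod (fun x => x = b + 5 ∨ x = b + 6 ∨ x = b + 7 ∨ x = b + 11) (· = b + 4)

/-- A round that changes nothing proves the set closed, and any other round adds a vertex. After `n`
rounds without closure there would be more than `n` vertices. -/
theorem runs_component {b : ℕ} (hb : 3 ≤ b) {σ : Memory} (hσ : Ready G σ) {W : Finset (Fin n)}
    (hW : Enc σ (b + 3) W) {r : Fin n} (hr : r ∈ W) (hrσ : σ.reg (b + 2) = r) :
    Runs n (component b) 26 σ fun τ => ComponentMod b σ τ ∧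
      ∃ D : Finset (Fin n), Enc τ (b + 4) D ∧ compIn G (W : Set (Fin n)) r = D := by
  classical
  refine Runs.seq (a := 12) (b := 25) (runs_fill_set {r} hσ.1 (by omega)
    (by simp [Expr.cost, eqE]) ?_) ?_ (by omega) (by omega)
  · intro i ρ h1 h2 _
    have h3 := eval_eqE ρ (b + 2) (b + 7)
    rw [h2, h1.1 (b + 2) (by omega), hrσ] at h3
    rw [Finset.mem_singleton, Fin.ext_iff]
    exact h3
  rintro σ1 ⟨hm1, hE1⟩
  have hready : ∀ ρ, ComponentMod b σ ρ → Ready G ρ := fun ρ h =>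
    hσ.mod h (by omega) (by omega) (by omega)
  refine runs_forLoop (N := n) (a := 19) (fun k ρ => ρ.reg (b + 5) = k ∧ ComponentMod b σ ρ ∧
    ∃ D : Finset (Fin n), Enc ρ (b + 4) D ∧ D ⊆ W ∧ r ∈ D ∧ Conn G (D : Set (Fin n)) ∧
      ((∀ x ∈ D, ∀ y ∈ W, G.Adj x y → y ∈ D) ∨ k + 1 ≤ D.card)) (by omega) (by simp [Expr.cost])
    ?_ ?_ ?_ ?_
  · refine ⟨by simp, Mod.setReg (R := fun x => x = b + 5 ∨ x = b + 6 ∨ x = b + 7 ∨ x = b + 11)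
      (hm1.weaken (by intros; omega) (fun _ h => h)) (by omega) 0, {r}, hE1, by simpa using hr,
      by simp, ?_, by simp⟩
    simpa using conn_singleton r
  · rintro k ρ ⟨h1, h2, -⟩
    exact ⟨h1, (hready ρ h2).1⟩
  · rintro k hk ρ ⟨h1, h2, D0, hD0, hD0W, hrD0, hD0c, hD0k⟩
    refine runs_forLoop (N := n) (a := 13) (fun u τ => τ.reg (b + 5) = k ∧ τ.reg (b + 6) = u ∧
      ComponentMod b σ τ ∧ ∃ D : Finset (Fin n), Enc τ (b + 4) D ∧ D ⊆ W ∧ D0 ⊆ D ∧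
        Conn G (D : Set (Fin n)) ∧ ∀ x ∈ D0, x.1 < u → ∀ y ∈ W, G.Adj x y → y ∈ D) (by omega)
      (by simp [Expr.cost]) ?_ ?_ ?_ ?_
    · exact ⟨by simpa using h1, by simp, h2.setReg (by omega) 0, D0, hD0, hD0W, subset_rfl, hD0c,
        by simp⟩
    · rintro u τ ⟨-, h3, h4, -⟩
      exact ⟨h3, (hready τ h4).1⟩
    · rintro u hu τ ⟨h3, h4, h5, D, hD, hDW, hD0D, hDc, hDu⟩
      let D' : Finset (Fin n) := D ∪ W.filter fun v => (⟨u, hu⟩ : Fin n) ∈ D ∧ G.Adj ⟨u, hu⟩ v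
      have hD' : ∀ v, v ∈ D' ↔ v ∈ D ∨ v ∈ W ∧ (⟨u, hu⟩ : Fin n) ∈ D ∧ G.Adj ⟨u, hu⟩ v :=
        fun v => by simp [D']
      refine Runs.seq (a := 6) (b := 12) (runs_assign
        (Q := fun υ => υ = τ.setReg (b + 11) (ind D u)) (by simp [Expr.cost])
        (by simp [Expr.eval, h4, hD u hu])) ?_ (by omega) (by omega)
      rintro _ rfl
      have hm5 : ComponentMod b σ (τ.setReg (b + 11) (ind D u)) := h5.setReg (by omega) _
      refine (runs_fill_set D' (hready _ hm5).1 (by omega) (by simp [Expr.cost, adjE]) ?_).mono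
        le_rfl ?_
      · intro i υ h6 h7 h8
        have h9 : ComponentMod b σ υ := hm5.trans (h6.weaken (by intros; omega) fun _ h => h)
        have h10 : υ.arr (b + 4) i = ind D i := (h8 i le_rfl).trans (hD i i.2)
        have h11 : υ.arr (b + 3) i = ind W i := by rw [h9.2 _ (by omega), hW i i.2]
        have h12 : υ.reg (b + 6) = u := by
          rw [h6.1 _ (by omega), Memory.setReg_reg, if_neg (by omega), h4]
        have h13 : υ.reg (b + 11) = ind D u := by
          rw [h6.1 _ (by omega), Memory.setReg_reg, if_pos rfl]
        have h14 := (hready υ h9).eval_adjE (u := b + 6) (v := b + 7) (by omega) (by omega)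
        rw [h12, h7] at h14
        have h15 := ind_le_one D u
        have h16 := ind_le_one W i
        have h17 := ind_le_one D i
        have h18 := adjInd_le_one G u i
        have h19 : ind D u = 1 ↔ (⟨u, hu⟩ : Fin n) ∈ D := by simp [ind_eq_one, hu]
        have h20 : adjInd G u i = 1 ↔ G.Adj ⟨u, hu⟩ i := by
          rw [adjInd_eq_one]; exact nAdj_coe (w := ⟨u, hu⟩)
        rw [hD', ← h19, ← h20, ← ind_coe_eq_one, ← ind_coe_eq_one (U := W)]
        -- A sum of three indicators minus 2 is their conjunction, and `1 - (1 - ·)` caps the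
        -- disjunction at 1.
        simp only [Expr.eval, h7, h10, h11, h13, h14]
        omega
      · rintro υ ⟨h6, h7⟩
        have hreg : ∀ x, x = b + 5 ∨ x = b + 6 → υ.reg x = τ.reg x := fun x hx => by
          rw [h6.1 x (by omega), Memory.setReg_reg, if_neg (by omega)]
        have hDD' : D ⊆ D' := fun v hv => (hD' v).2 (Or.inl hv)
        refine ⟨(hreg _ (by omega)).trans h4, ?_, by simp, Mod.setReg
          (R := fun x => x = b + 5 ∨ x = b + 6 ∨ x = b + 7 ∨ x = b + 11)
          (hm5.trans (h6.weaken (by intros; omega) fun _ h => h)) (by omega) _, D', h7, ?_,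
          hD0D.trans hDD', ?_, ?_⟩
        · rw [Memory.setReg_reg, if_neg (by omega)]
          exact (hreg _ (by omega)).trans h3
        · intro v hv
          rcases (hD' v).1 hv with h | h
          exacts [hDW h, h.1]
        · refine conn_of_cover hDc (by exact_mod_cast hDD') fun v hv => ?_
          rcases (hD' v).1 hv with h | ⟨h, h', e⟩
          · exact ⟨D, by exact_mod_cast hDD', hDc, h, v, h, h⟩
          · refine ⟨{⟨u, hu⟩, v}, ?_, conn_pair e, by simp, ⟨u, hu⟩, by simp, h'⟩
            rintro w (rfl | rfl)
            exacts [hDD' h', hv]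
        · intro x hx hxu y hy e
          by_cases hxu' : x = ⟨u, hu⟩
          · subst hxu'
            exact (hD' y).2 (Or.inr ⟨hy, hD0D hx, e⟩)
          · refine hDD' (hDu x hx ?_ y hy e)
            have : x.1 ≠ u := fun h => hxu' (Fin.ext h)
            omega
    · rintro τ ⟨h3, -, h4, D, hD, hDW, hD0D, hDc, hDu⟩
      refine ⟨h3, by simp, h4.setReg (by omega) _, D, hD, hDW, hD0D hrD0, hDc, ?_⟩
      by_cases hDD : D = D0
      · subst hDD
        exact Or.inl fun x hx => hDu x hx x.2
      · right
        have h5 := Finset.card_lt_card (Finset.ssubset_iff_subset_ne.2 ⟨hD0D, Ne.symm hDD⟩)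
        rcases hD0k with h6 | h6
        · refine absurd ?_ hDD
          refine (Finset.Subset.antisymm ?_ hD0D)
          have := hDc.subset_of_closed (A := (D0 : Set (Fin n))) ⟨r, hD0D hrD0, hrD0⟩
            fun x hx y hy _ e => h6 x hx y (hDW hy) e
          exact_mod_cast this
        · omega
  · rintro τ ⟨-, h2, D, hD, hDW, hrD, hDc, hDk⟩
    refine ⟨h2, D, hD, compIn_eq_of_closed (by exact_mod_cast hDW) hrD hDc ?_⟩
    refine hDk.resolve_right fun h => ?_
    have := Finset.card_le_univ D
    rw [Fintype.card_fin] at this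
    omega

/-- Inspect the component of the vertex `r` in the register `b + 2` after the deletion of the vertex
`c` in the register `b + 1`, if both are adjacent members of the set held by the array `b + 2`. -/
def leafBody (b : ℕ) : Program :=
  .ite (.const 2) (.add (.arr (b + 2) (.reg (b + 1))) (.add (.arr (b + 2) (.reg (b + 2)))
      (adjE (b + 1) (b + 2))))
    (.seq (fill (b + 3) (b + 7) (.sub (.arr (b + 2) (.reg (b + 7))) (eqE (b + 1) (b + 7)))) <|
      .seq (component b) <| .seq (count (b + 8) (b + 7) (b + 4)) <|
      .ite (.reg (b + 8)) (.reg (b + 3))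
        (.seq (.assign (b + 3) (.reg (b + 8))) <| .seq (.assign (b + 4) (.reg (b + 1))) <|
          fill (b + 5) (b + 7) (.arr (b + 4) (.reg (b + 7))))
        .skip)
    .skip

/-- Find a smallest component left by the deletion of an adjacent vertex. -/
def findLeaf (b : ℕ) : Program :=
  .seq (.assign (b + 3) (.reg 0)) <|
  forLoop (b + 1) (.reg 0) <| forLoop (b + 2) (.reg 0) <| leafBody b

/-- The frame of `findLeaf`. -/
abbrev LeafMod (b : ℕ) : Memory → Memory → Prop :=
  Mod (fun x => b + 1 ≤ x) (fun a => a = b + 3 ∨ a = b + 4 ∨ a = b + 5)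

/-- The state of `findLeaf` after the pairs in `K` have been inspected. -/
def LeafState (G : SimpleGraph (Fin n)) (C : Finset (Fin n)) (b : ℕ) (σ : Memory)
    (K : ℕ → ℕ → Prop) (ρ : Memory) : Prop :=
  LeafMod b σ ρ ∧ ρ.reg (b + 3) ≤ n ∧
    (ρ.reg (b + 3) < n → ∃ (D : Finset (Fin n)) (c : Fin n), Enc ρ (b + 5) D ∧
      ρ.reg (b + 4) = c ∧ ρ.reg (b + 3) = D.card ∧ IsLeaf G C c D) ∧
    ∀ c ∈ C, ∀ r ∈ C, K c r → G.Adj c r →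
      ρ.reg (b + 3) ≤ (compIn G ((C : Set (Fin n)) \ {c}) r).ncard

theorem LeafState.setReg {C : Finset (Fin n)} {b : ℕ} {σ ρ : Memory} {K : ℕ → ℕ → Prop}
    (h : LeafState G C b σ K ρ) {x : ℕ} (hx : b + 1 ≤ x) (h3 : x ≠ b + 3) (h4 : x ≠ b + 4)
    (v : ℕ) : LeafState G C b σ K (ρ.setReg x v) := by
  unfold LeafState
  rw [Memory.setReg_reg, if_neg h3.symm, Memory.setReg_reg, if_neg h4.symm]
  exact ⟨h.1.setReg hx v, h.2⟩

theorem LeafState.mono {C : Finset (Fin n)} {b : ℕ} {σ ρ : Memory} {K K' : ℕ → ℕ → Prop}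
    (h : LeafState G C b σ K ρ) (hK : ∀ c r, K' c r → K c r) : LeafState G C b σ K' ρ :=
  ⟨h.1, h.2.1, h.2.2.1, fun c hc r hr h' => h.2.2.2 c hc r hr (hK c r h')⟩

theorem runs_leafBody {b : ℕ} (hb : 3 ≤ b) {σ ρ : Memory} (hσ : Ready G σ) {C : Finset (Fin n)}
    (hC : Enc σ (b + 2) C) {K : ℕ → ℕ → Prop} (hρ : LeafState G C b σ K ρ) {i j : ℕ} (hi : i < n)
    (hj : j < n) (h1 : ρ.reg (b + 1) = i) (h2 : ρ.reg (b + 2) = j) :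
    Runs n (leafBody b) 29 ρ fun τ => τ.reg (b + 1) = i ∧ τ.reg (b + 2) = j ∧
      LeafState G C b σ (fun x y => K x y ∨ (x = i ∧ y = j)) τ := by
  classical
  obtain ⟨hm, hn, hbest, hK⟩ := hρ
  have hready : ∀ τ, LeafMod b σ τ → Ready G τ := fun τ h =>
    hσ.mod h (by omega) (by omega) (by omega)
  have hCρ : Enc ρ (b + 2) C := hC.congr (hm.2 _ (by omega))
  have hadj := (hready ρ hm).eval_adjE (u := b + 1) (v := b + 2) (by omega) (by omega)
  rw [h1, h2] at hadj
  have hci : ind C i = 1 ↔ (⟨i, hi⟩ : Fin n) ∈ C := by simp [ind_eq_one, hi]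
  have hcj : ind C j = 1 ↔ (⟨j, hj⟩ : Fin n) ∈ C := by simp [ind_eq_one, hj]
  have hA : adjInd G i j = 1 ↔ G.Adj ⟨i, hi⟩ ⟨j, hj⟩ := by
    rw [adjInd_eq_one]; exact nAdj_coe (w := ⟨i, hi⟩) (z := ⟨j, hj⟩)
  have hc1 := ind_le_one C i
  have hc2 := ind_le_one C j
  have hc3 := adjInd_le_one G i j
  -- The test asks whether three indicators sum to more than 2: both vertices lie in `C` and they
  -- are adjacent.
  refine runs_ite (a := 28) (by omega) (by simp [Expr.cost, adjE]) ?_ ?_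
  swap
  · intro h
    simp only [Expr.eval, h1, h2, hadj, hCρ i hi, hCρ j hj] at h
    refine runs_skip ⟨h1, h2, hm, hn, hbest, ?_⟩
    rintro c hc r hr (hcr | ⟨rfl, rfl⟩) e
    · exact hK c hc r hr hcr e
    · have := hci.2 hc
      have := hcj.2 hr
      have := hA.2 e
      omega
  intro h
  simp only [Expr.eval, h1, h2, hadj, hCρ i hi, hCρ j hj] at h
  have hiC : (⟨i, hi⟩ : Fin n) ∈ C := hci.1 (by omega)
  have hjC : (⟨j, hj⟩ : Fin n) ∈ C := hcj.1 (by omega)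
  have hij : G.Adj ⟨i, hi⟩ ⟨j, hj⟩ := hA.1 (by omega)
  refine Runs.seq (a := 12) (b := 27) (runs_fill_set (C.erase ⟨i, hi⟩) (hready ρ hm).1
    (by omega) (by simp [Expr.cost, eqE]) ?_) ?_ (by omega) (by omega)
  · intro v τ h3 h4 _
    have h5 := eval_eqE τ (b + 1) (b + 7)
    rw [h4, h3.1 (b + 1) (by omega), h1] at h5
    have h6 : τ.arr (b + 2) v = ind C v := by rw [h3.2 _ (by omega), hCρ v v.2]
    have h7 := ind_le_one C v
    rw [Finset.mem_erase, Ne, Fin.ext_iff, ← ind_coe_eq_one]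
    simp only [Expr.eval, h4, h6]
    omega
  rintro τ1 ⟨hm1, hE1⟩
  have hm1' : LeafMod b σ τ1 := hm.trans (hm1.weaken (by intros; omega) (by intros; omega))
  refine Runs.seq (a := 26) (b := 16) (runs_component hb (hready _ hm1') hE1
    (r := ⟨j, hj⟩) ?_ ?_) ?_ (by omega) (by omega)
  · exact Finset.mem_erase.2 ⟨fun h => hij.ne h.symm, hjC⟩
  · rw [hm1.1 _ (by omega), h2]
  rintro τ2 ⟨hm2, D, hD, hcomp⟩
  have hm2' : LeafMod b σ τ2 := hm1'.trans (hm2.weaken (by intros; omega) (by intros; omega))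
  refine Runs.seq (a := 13) (b := 15) (runs_count (hready _ hm2').1 (by omega) (by omega) (by omega)
    hD) ?_ (by omega) (by omega)
  rintro τ3 ⟨hm3, hc⟩
  have hm3' : LeafMod b σ τ3 :=
    hm2'.trans (hm3.weaken (by intros; omega) (by intros; contradiction))
  have hreg : ∀ x, x < b + 5 → τ3.reg x = ρ.reg x := fun x hx => by
    rw [hm3.1 x (by omega), hm2.1 x (by omega), hm1.1 x (by omega)]
  rw [Finset.coe_erase] at hcomp
  have hleaf : IsLeaf G C ⟨i, hi⟩ D := ⟨hiC, ⟨j, hj⟩, hjC, hij, hcomp⟩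
  refine runs_ite (a := 14) (by omega) (by simp [Expr.cost]) ?_ ?_
  · intro hlt
    simp only [Expr.eval, hreg (b + 3) (by omega), hc] at hlt
    refine Runs.seq (a := 6) (b := 13) (runs_assign (Q := fun τ => τ = τ3.setReg (b + 3) D.card)
      (by simp [Expr.cost]) (by simp [Expr.eval, hc])) ?_ (by omega) (by omega)
    rintro _ rfl
    refine Runs.seq (a := 6) (b := 12) (runs_assign (Q := fun τ => τ =
      (τ3.setReg (b + 3) D.card).setReg (b + 4) i) (by simp [Expr.cost])
      (by simp [Expr.eval, hreg, h1])) ?_ (by omega) (by omega)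
    rintro _ rfl
    have hm4 : LeafMod b σ ((τ3.setReg (b + 3) D.card).setReg (b + 4) i) :=
      (hm3'.setReg (by omega) _).setReg (by omega) _
    refine (runs_fill_set D (hready _ hm4).1 (by omega) (by simp [Expr.cost]) ?_).mono le_rfl ?_
    · intro v τ h3 h4 _
      have h5 : τ.arr (b + 4) v = ind D v := by
        rw [h3.2 _ (by omega), Memory.setReg_arr, Memory.setReg_arr, hm3.2 _ (by simp), hD v v.2]
      simp only [Expr.eval, h4, h5]
      exact ⟨ind_le_one D v, ind_coe_eq_one⟩
    · rintro τ ⟨h3, h4⟩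
      have hreg' : ∀ x, x < b + 3 → τ.reg x = ρ.reg x := fun x hx => by
        rw [h3.1 x (by omega), Memory.setReg_reg, if_neg (by omega), Memory.setReg_reg,
          if_neg (by omega), hreg x (by omega)]
      have hr3 : τ.reg (b + 3) = D.card := by rw [h3.1 _ (by omega)]; simp
      have hr4 : τ.reg (b + 4) = i := by rw [h3.1 _ (by omega)]; simp
      refine ⟨(hreg' _ (by omega)).trans h1, (hreg' _ (by omega)).trans h2,
        hm4.trans (h3.weaken (by intros; omega) (by intros; omega)), by omega,
        fun _ => ⟨D, ⟨i, hi⟩, h4, hr4, hr3, hleaf⟩, ?_⟩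
      rw [hr3]
      rintro c hc r hr (hcr | ⟨rfl, rfl⟩) e
      · exact hlt.le.trans (hK c hc r hr hcr e)
      · rw [hcomp, Set.ncard_coe_finset]
  · intro hlt
    simp only [Expr.eval, hreg (b + 3) (by omega), hc] at hlt
    refine runs_skip ⟨(hreg _ (by omega)).trans h1, (hreg _ (by omega)).trans h2, hm3', ?_⟩
    rw [hreg _ (by omega), hreg _ (by omega)]
    refine ⟨hn, fun h => ?_, ?_⟩
    · obtain ⟨D', c, h3, h4⟩ := hbest h
      refine ⟨D', c, h3.congr ?_, h4⟩
      rw [hm3.2 _ (by simp), hm2.2 _ (by omega), hm1.2 _ (by omega)]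
    · rintro c hc r hr (hcr | ⟨rfl, rfl⟩) e
      · exact hK c hc r hr hcr e
      · rw [hcomp, Set.ncard_coe_finset]
        omega

/-- The initial value `n` of the size register means that no leaf has been found; a component misses
the deleted vertex, so its size is always smaller. -/
theorem runs_findLeaf {b : ℕ} (hb : 3 ≤ b) {σ : Memory} (hσ : Ready G σ) {C : Finset (Fin n)}
    (hC : Enc σ (b + 2) C) :
    Runs n (findLeaf b) 42 σ (LeafState G C b σ fun _ _ => True) := by
  have hready : ∀ K τ, LeafState G C b σ K τ → Ready G τ := fun K τ h =>
    hσ.mod h.1 (by omega) (by omega) (by omega)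
  refine Runs.seq (a := 6) (b := 41) (runs_assign (Q := fun τ => τ = σ.setReg (b + 3) n)
    (by simp [Expr.cost]) (by simp [Expr.eval, hσ.1])) ?_ (by omega) (by omega)
  rintro _ rfl
  have h0 : LeafState G C b σ (fun _ _ => False) (σ.setReg (b + 3) n) :=
    ⟨(Mod.refl _ _ σ).setReg (by omega) _, by simp, by simp, by simp⟩
  refine runs_forLoop (N := n) (a := 35) (fun i ρ => ρ.reg (b + 1) = i ∧
    LeafState G C b σ (fun x y => x < i ∧ y < n) ρ) (by omega) (by simp [Expr.cost]) ?_ ?_ ?_ ?_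
  · exact ⟨by simp, (h0.setReg (by omega) (by omega) (by omega) 0).mono (by simp)⟩
  · rintro i ρ ⟨h1, h2⟩
    exact ⟨h1, (hready _ ρ h2).1⟩
  · rintro i hi ρ ⟨h1, h2⟩
    refine runs_forLoop (N := n) (a := 29) (fun j ρ => ρ.reg (b + 1) = i ∧ ρ.reg (b + 2) = j ∧
      LeafState G C b σ (fun x y => (x < i ∧ y < n) ∨ (x = i ∧ y < j)) ρ) (by omega)
      (by simp [Expr.cost]) ?_ ?_ ?_ ?_
    · exact ⟨by simpa using h1, by simp,
        (h2.setReg (by omega) (by omega) (by omega) 0).mono (by simp)⟩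
    · rintro j ρ ⟨h1, h2, h3⟩
      exact ⟨h2, (hready _ ρ h3).1⟩
    · rintro j hj ρ ⟨h1, h2, h3⟩
      refine (runs_leafBody hb hσ hC h3 hi hj h1 h2).mono le_rfl ?_
      rintro τ ⟨h4, h5, h6⟩
      refine ⟨h5, by simpa using h4, by simp,
        (h6.setReg (by omega) (by omega) (by omega) _).mono ?_⟩
      intro x y h
      omega
    · rintro τ ⟨h4, h5, h6⟩
      refine ⟨h4, by simp, (h6.setReg (by omega) (by omega) (by omega) _).mono ?_⟩
      intro x y h
      omega
  · rintro τ ⟨-, h1, h2, h3, h4⟩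
    exact ⟨h1, h2, h3, fun c hc r hr _ => h4 c hc r hr ⟨c.2, r.2⟩⟩

theorem runs_copy {a a' z : ℕ} {σ : Memory} {S : Finset (Fin n)} (h0 : σ.reg 0 = n)
    (hz : z ≠ 0) (ha : a' ≠ a) (hS : Enc σ a' S) :
    Runs n (fill a z (.arr a' (.reg z))) 12 σ fun τ => Mod (· = z) (· = a) σ τ ∧ Enc τ a S :=
  runs_fill (ind S) h0 hz (by simp [Expr.cost]) fun i hi ρ h1 h2 _ => by
    simp only [Expr.eval, h2, h1.2 a' ha]
    exact hS i hi

theorem runs_union {a a' z : ℕ} {σ : Memory} {S S' : Finset (Fin n)} (h0 : σ.reg 0 = n)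
    (hz : z ≠ 0) (ha : a' ≠ a) (hS : Enc σ a S) (hS' : Enc σ a' S') :
    Runs n (fill a z (.sub (.const 1) (.sub (.sub (.const 1) (.arr a (.reg z)))
      (.arr a' (.reg z))))) 12 σ fun τ => Mod (· = z) (· = a) σ τ ∧ Enc τ a (S ∪ S') :=
  runs_fill_set _ h0 hz (by simp [Expr.cost]) fun i ρ h1 h2 h3 => by
    have h4 : ρ.arr a i = ind S i := (h3 i le_rfl).trans (hS i i.2)
    have h5 : ρ.arr a' i = ind S' i := by rw [h1.2 a' ha, hS' i i.2]
    have h6 := ind_le_one S i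
    have h7 := ind_le_one S' i
    rw [Finset.mem_union, ← ind_coe_eq_one, ← ind_coe_eq_one (U := S')]
    simp only [Expr.eval, h2, h4, h5]
    omega

/-- Process the leaf in the array `b + 5`, using `P` for the two subproblems. -/
def processLeaf (b : ℕ) (P : Program) : Program :=
  .seq (fill (b + 20) (b + 7) (.arr (b + 5) (.reg (b + 7)))) <| .seq P <|
  .seq (fill (b + 6) (b + 7) (.arr (b + 21) (.reg (b + 7)))) <|
  .seq (count (b + 9) (b + 7) (b + 6)) <|
  .seq (fill (b + 20) (b + 7) (.sub (.arr (b + 5) (.reg (b + 7))) (adjE (b + 4) (b + 7)))) <|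
  .seq P <| .seq (count (b + 10) (b + 7) (b + 21)) <|
  .ite (.reg (b + 10)) (.reg (b + 9))
    (.seq (fill (b + 1) (b + 7) (.sub (.const 1) (.sub (.sub (.const 1)
        (.arr (b + 1) (.reg (b + 7)))) (.arr (b + 6) (.reg (b + 7))))))
      (fill (b + 2) (b + 7) (.sub (.arr (b + 2) (.reg (b + 7)))
        (.add (eqE (b + 4) (b + 7)) (.arr (b + 5) (.reg (b + 7)))))))
    (.seq (fill (b + 1) (b + 7) (.sub (.const 1) (.sub (.sub (.const 1)
        (.arr (b + 1) (.reg (b + 7)))) (.arr (b + 21) (.reg (b + 7))))))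
      (fill (b + 2) (b + 7) (.sub (.arr (b + 2) (.reg (b + 7))) (.arr (b + 5) (.reg (b + 7))))))

/-- Peel off leaf blocks one by one, using `P` for the subproblems. -/
def peel (b : ℕ) (P : Program) : Program :=
  .seq (fill (b + 1) (b + 7) (.const 0)) <|
  .seq (fill (b + 2) (b + 7) (.arr b (.reg (b + 7)))) <|
  .seq (forLoop b (.reg 0)
    (.seq (findLeaf b) (.ite (.reg (b + 3)) (.reg 0) (processLeaf b P) .skip))) <|
  fill (b + 1) (b + 7) (.sub (.const 1) (.sub (.sub (.const 1)
    (.arr (b + 1) (.reg (b + 7)))) (.arr (b + 2) (.reg (b + 7)))))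

/-- The frame of one round of peeling. -/
abbrev PeelMod (b : ℕ) : Memory → Memory → Prop := Mod (b + 1 ≤ ·) (b + 1 ≤ ·)

/-- Both subproblems use the same workspace from `b + 20` on, so the first answer is saved in array
`b + 6` before the second run. The comparison is that of `PeelState.step`. -/
theorem runs_processLeaf {b a : ℕ} {P : Program} {Good : Finset (Fin n) → Prop} (hb : 3 ≤ b)
    (ha : 20 ≤ a) (hP : Solves G P (b + 20) a Good) {σ : Memory} (hσ : Ready G σ)
    {U S C D : Finset (Fin n)} {c : Fin n} (hS : Enc σ (b + 1) S) (hC : Enc σ (b + 2) C)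
    (hD : Enc σ (b + 5) D) (hc : σ.reg (b + 4) = c) (hpeel : PeelState G Good U S C)
    (hleaf : IsLeaf G C c D) (hmin : ∀ c' ∈ C, ∀ r' ∈ C, G.Adj c' r' →
      D.card ≤ (compIn G ((C : Set (Fin n)) \ {c'}) r').ncard) :
    Runs n (processLeaf b P) (a + 7) σ fun τ => PeelMod b σ τ ∧ ∃ S' C' : Finset (Fin n),
      Enc τ (b + 1) S' ∧ Enc τ (b + 2) C' ∧ PeelState G Good U S' C' ∧ C'.card < C.card := by
  classical
  have hready : ∀ τ, PeelMod b σ τ → Ready G τ := fun τ h =>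
    hσ.mod h (by omega) (by omega) (by omega)
  have hfill : ∀ {a : ℕ} {ρ τ : Memory}, b + 1 ≤ a → PeelMod b σ ρ →
      Mod (· = b + 7) (· = a) ρ τ → PeelMod b σ τ := fun h h1 h2 =>
    h1.trans (h2.weaken (by intros; omega) (by intros; omega))
  refine Runs.seq (a := 12) (b := a + 6) (runs_copy hσ.1 (by omega) (by omega) hD) ?_
    (by omega) (by omega)
  rintro τ1 ⟨hm1, hE1⟩
  have hM1 := hfill (by omega) (Mod.refl _ _ σ) hm1
  refine Runs.seq (a := a) (b := a + 5) (hP τ1 D (hready _ hM1) hE1) ?_ (by omega) (by omega)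
  rintro τ2 ⟨hm2, R, hR, hRD, hRi, hRG⟩
  have hM2 : PeelMod b σ τ2 := hM1.trans (hm2.weaken (by intros; omega) (by intros; omega))
  refine Runs.seq (a := 12) (b := a + 4) (runs_copy (hready _ hM2).1 (by omega) (by omega) hR) ?_
    (by omega) (by omega)
  rintro τ3 ⟨hm3, hR3⟩
  have hM3 := hfill (by omega) hM2 hm3
  refine Runs.seq (a := 13) (b := a + 3) (runs_count (hready _ hM3).1 (by omega) (by omega)
    (by omega) hR3) ?_ (by omega) (by omega)
  rintro τ4 ⟨hm4, hR4⟩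
  have hM4 : PeelMod b σ τ4 := hM3.trans (hm4.weaken (by intros; omega) (by intros; contradiction))
  have hc4 : τ4.reg (b + 4) = c := by
    rw [hm4.1 _ (by omega), hm3.1 _ (by omega), hm2.1 _ (by omega), hm1.1 _ (by omega), hc]
  have harr4 : ∀ x, x < b + 6 → τ4.arr x = σ.arr x := fun x hx => by
    rw [hm4.2 _ (by simp), hm3.2 _ (by omega), hm2.2 _ (by omega), hm1.2 _ (by omega)]
  refine Runs.seq (a := 12) (b := a + 2) (runs_fill_set (nonNbrs G c D) (hready _ hM4).1 (by omega)
    (by simp [Expr.cost, adjE]) ?_) ?_ (by omega) (by omega)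
  · intro i ρ h1 h2 _
    have h3 : ρ.arr (b + 5) i = ind D i := by
      rw [h1.2 _ (by omega), harr4 _ (by omega), hD i i.2]
    have h4 : ρ.reg (b + 4) = c := by rw [h1.1 _ (by omega), hc4]
    have h5 := (hready _ (hfill (by omega) hM4 h1)).eval_adjE (u := b + 4) (v := b + 7) (by omega)
      (by omega)
    rw [h2, h4] at h5
    have h6 := ind_le_one D i
    have h7 := adjInd_le_one G c i
    rw [mem_nonNbrs, ← ind_coe_eq_one, ← nAdj_coe, ← adjInd_eq_one]
    simp only [Expr.eval, h2, h3, h5]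
    omega
  rintro τ5 ⟨hm5, hE5⟩
  have hM5 := hfill (by omega) hM4 hm5
  refine Runs.seq (a := a) (b := a + 1) (hP τ5 _ (hready _ hM5) hE5) ?_ (by omega) (by omega)
  rintro τ6 ⟨hm6, R', hR', hRD', hRi', hRG'⟩
  have hM6 : PeelMod b σ τ6 := hM5.trans (hm6.weaken (by intros; omega) (by intros; omega))
  refine Runs.seq (a := 13) (b := 15) (runs_count (hready _ hM6).1 (by omega) (by omega)
    (by omega) hR') ?_ (by omega) (by omega)
  rintro τ7 ⟨hm7, hR7⟩
  have hM7 : PeelMod b σ τ7 := hM6.trans (hm7.weaken (by intros; omega) (by intros; contradiction))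
  have harr7 : ∀ x, x < b + 20 → τ7.arr x = τ4.arr x := fun x hx => by
    rw [hm7.2 _ (by simp), hm6.2 _ (by omega), hm5.2 _ (by omega)]
  have hreg7 : ∀ x, x < b + 7 ∨ x = b + 9 → τ7.reg x = τ4.reg x := fun x hx => by
    rw [hm7.1 _ (by omega), hm6.1 _ (by omega), hm5.1 _ (by omega)]
  have hc7 : τ7.reg (b + 4) = c := (hreg7 _ (by omega)).trans hc4
  have hold : ∀ {x T}, x < b + 6 → Enc σ x T → Enc (n := n) τ7 x T := fun hx h =>
    h.congr (by rw [harr7 _ (by omega), harr4 _ (by omega)])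
  have hS7 := hold (by omega) hS
  have hC7 := hold (by omega) hC
  have hD7 := hold (by omega) hD
  have hR6 : Enc τ7 (b + 6) R := hR3.congr (by rw [harr7 _ (by omega), hm4.2 _ (by simp)])
  have hR21 : Enc τ7 (b + 21) R' := hR'.congr (hm7.2 _ (by simp))
  have hstep := hpeel.step hleaf hmin hRD hRi hRG hRD' hRi' hRG'
  refine runs_ite (a := 14) (by omega) (by simp [Expr.cost]) ?_ ?_
  · intro hlt
    simp only [Expr.eval, hR7, hreg7 (b + 9) (by omega), hR4] at hlt
    rw [if_pos hlt] at hstep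
    refine Runs.seq (a := 12) (b := 12) (runs_union (hready _ hM7).1 (by omega) (by omega) hS7 hR6)
      ?_ (by omega) (by omega)
    rintro τ8 ⟨hm8, hE8⟩
    have hM8 := hfill (by omega) hM7 hm8
    refine (runs_fill_set (C \ insert c D) (hready _ hM8).1 (by omega)
      (by simp [Expr.cost, eqE]) ?_).mono le_rfl ?_
    · intro i ρ h1 h2 h3
      have h4 : ρ.arr (b + 2) i = ind C i := by
        rw [h3 i le_rfl, hm8.2 _ (by omega), hC7 i i.2]
      have h5 : ρ.arr (b + 5) i = ind D i := by
        rw [h1.2 _ (by omega), hm8.2 _ (by omega), hD7 i i.2]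
      have h6 := eval_eqE ρ (b + 4) (b + 7)
      rw [h2, h1.1 _ (by omega), hm8.1 _ (by omega), hc7] at h6
      have h7 := ind_le_one D i
      have h8 := ind_le_one C i
      rw [Finset.mem_sdiff, Finset.mem_insert, Fin.ext_iff, ← ind_coe_eq_one,
        ← ind_coe_eq_one (U := D)]
      simp only [Expr.eval, h2, h4, h5]
      omega
    · rintro τ9 ⟨hm9, hE9⟩
      refine ⟨hfill (by omega) hM8 hm9, _, _, hE8.congr (hm9.2 _ (by omega)), hE9, hstep, ?_⟩
      refine Finset.card_lt_card (Finset.sdiff_ssubset (Finset.insert_subset hleaf.1 hleaf.subset)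
        (Finset.insert_nonempty _ _))
  · intro hlt
    simp only [Expr.eval, hR7, hreg7 (b + 9) (by omega), hR4] at hlt
    rw [if_neg hlt] at hstep
    refine Runs.seq (a := 12) (b := 12) (runs_union (hready _ hM7).1 (by omega) (by omega) hS7 hR21)
      ?_ (by omega) (by omega)
    rintro τ8 ⟨hm8, hE8⟩
    have hM8 := hfill (by omega) hM7 hm8
    refine (runs_fill_set (C \ D) (hready _ hM8).1 (by omega)
      (by simp [Expr.cost]) ?_).mono le_rfl ?_
    · intro i ρ h1 h2 h3
      have h4 : ρ.arr (b + 2) i = ind C i := by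
        rw [h3 i le_rfl, hm8.2 _ (by omega), hC7 i i.2]
      have h5 : ρ.arr (b + 5) i = ind D i := by
        rw [h1.2 _ (by omega), hm8.2 _ (by omega), hD7 i i.2]
      have h7 := ind_le_one D i
      have h8 := ind_le_one C i
      rw [Finset.mem_sdiff, ← ind_coe_eq_one, ← ind_coe_eq_one (U := D)]
      simp only [Expr.eval, h2, h4, h5]
      omega
    · rintro τ9 ⟨hm9, hE9⟩
      exact ⟨hfill (by omega) hM8 hm9, _, _, hE8.congr (hm9.2 _ (by omega)), hE9, hstep,
        Finset.card_lt_card (Finset.sdiff_ssubset hleaf.subset hleaf.nonempty)⟩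

/-- Every processed leaf shrinks `C`, so after `n` rounds `C` is empty unless it became edgeless
before. An edgeless remainder is added to the solution as a whole. -/
theorem solves_peel {b a : ℕ} {P : Program} {Good : Finset (Fin n) → Prop} (hb : 3 ≤ b)
    (ha : 42 ≤ a) (hP : Solves G P (b + 20) a Good) :
    Solves G (peel b P) b (a + 18) (PeelGood G Good) := by
  classical
  intro σ U hσ hU
  have hready : ∀ τ, Mod (b ≤ ·) (b + 1 ≤ ·) σ τ → Ready G τ := fun τ h =>
    hσ.mod h (by omega) (by omega) (by omega)
  have hfill : ∀ {a : ℕ} {ρ τ : Memory}, b + 1 ≤ a → Mod (b ≤ ·) (b + 1 ≤ ·) σ ρ →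
      Mod (· = b + 7) (· = a) ρ τ → Mod (b ≤ ·) (b + 1 ≤ ·) σ τ := fun h h1 h2 =>
    h1.trans (h2.weaken (by intros; omega) (by intros; omega))
  refine Runs.seq (a := 12) (b := a + 17) (runs_fill_set ∅ hσ.1 (by omega) (by simp [Expr.cost])
    (fun i ρ _ _ _ => by simp [Expr.eval])) ?_ (by omega) (by omega)
  rintro σ1 ⟨hm1, hE1⟩
  have hM1 := hfill (by omega) (Mod.refl _ _ σ) hm1
  refine Runs.seq (a := 12) (b := a + 16) (runs_copy (hready _ hM1).1 (by omega) (by omega)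
    (hU.congr (hm1.2 _ (by omega)))) ?_ (by omega) (by omega)
  rintro σ2 ⟨hm2, hE2⟩
  have hM2 := hfill (by omega) hM1 hm2
  refine Runs.seq (a := a + 15) (b := 12) (Q := fun ρ => Mod (b ≤ ·) (b + 1 ≤ ·) σ ρ ∧
    ∃ S C : Finset (Fin n), Enc ρ (b + 1) S ∧ Enc ρ (b + 2) C ∧ PeelState G Good U S C ∧
      ∀ x ∈ C, ∀ y ∈ C, ¬ G.Adj x y) ?_ ?_ (by omega) (by omega)
  · refine runs_forLoop (N := n) (a := a + 9) (fun i ρ => ρ.reg b = i ∧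
      Mod (b ≤ ·) (b + 1 ≤ ·) σ ρ ∧ ∃ S C : Finset (Fin n), Enc ρ (b + 1) S ∧ Enc ρ (b + 2) C ∧
        PeelState G Good U S C ∧ ((∀ x ∈ C, ∀ y ∈ C, ¬ G.Adj x y) ∨ C.card + i ≤ n)) (by omega)
      (by simp [Expr.cost]) ?_ ?_ ?_ ?_
    · refine ⟨by simp, hM2.setReg le_rfl 0, ∅, U, hE1.congr (hm2.2 _ (by omega)), hE2, .start _ _,
        Or.inr ?_⟩
      simpa using Finset.card_le_univ U
    · rintro i ρ ⟨h1, h2, -⟩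
      exact ⟨h1, (hready _ h2).1⟩
    · rintro i hi ρ ⟨h1, h2, S, C, hS, hC, hpeel, hcard⟩
      refine Runs.seq (a := 42) (b := a + 8) (runs_findLeaf hb (hready _ h2) hC) ?_ (by omega)
        (by omega)
      rintro τ ⟨h3, h4, h5, h6⟩
      have h7 : Mod (b ≤ ·) (b + 1 ≤ ·) σ τ :=
        h2.trans (h3.weaken (by intros; omega) (by intros; omega))
      have hS' : Enc τ (b + 1) S := hS.congr (h3.2 _ (by omega))
      have hC' : Enc τ (b + 2) C := hC.congr (h3.2 _ (by omega))
      have hτ : τ.reg b = i := (h3.1 _ (by omega)).trans h1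
      refine runs_ite (a := a + 7) (by omega) (by simp [Expr.cost]) ?_ ?_
      · intro hlt
        simp only [Expr.eval, (hready _ h7).1] at hlt
        obtain ⟨D, c, hD, hc, hDc, hleaf⟩ := h5 hlt
        refine (runs_processLeaf hb (by omega) hP (hready _ h7) hS' hC' hD hc hpeel hleaf
          fun c' hc' r' hr' e => hDc ▸ h6 c' hc' r' hr' trivial e).mono le_rfl ?_
        rintro υ ⟨h8, S', C', h9, h10, h11, h12⟩
        refine ⟨(h8.1 _ (by omega)).trans hτ, by simp, (h7.trans (h8.weaken (by intros; omega)
          (fun _ h => h))).setReg le_rfl _, S', C', h9, h10, h11, ?_⟩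
        rcases hcard with h | h
        · obtain ⟨hc, r, hr, e, -⟩ := hleaf
          exact absurd e (h c hc r hr)
        · exact Or.inr (by omega)
      · intro hlt
        simp only [Expr.eval, (hready _ h7).1] at hlt
        refine runs_skip ⟨hτ, by simp, h7.setReg le_rfl _, S, C, hS', hC', hpeel, Or.inl ?_⟩
        intro x hx y hy e
        have h8 := h6 x hx y hy trivial e
        have h9 : (compIn G ((C : Set (Fin n)) \ {x}) y).ncard < (Set.univ : Set (Fin n)).ncard :=
          Set.ncard_lt_ncard ⟨Set.subset_univ _, fun h =>
            (compIn_subset _ _ (h (Set.mem_univ x))).2 rfl⟩ (Set.toFinite _)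
        rw [Set.ncard_univ, Nat.card_fin] at h9
        omega
    · rintro ρ ⟨-, h2, S, C, hS, hC, hpeel, hcard⟩
      refine ⟨h2, S, C, hS, hC, hpeel, hcard.elim id fun h => ?_⟩
      obtain rfl : C = ∅ := Finset.card_eq_zero.1 (by omega)
      simp
  · rintro ρ ⟨h1, S, C, hS, hC, hpeel, hedge⟩
    refine (runs_union (hready _ h1).1 (by omega) (by omega) hS hC).mono le_rfl ?_
    rintro τ ⟨h2, h3⟩
    obtain ⟨h4, h5, h6⟩ := hpeel.finish hedge
    exact ⟨(hfill (by omega) h1 h2).weaken (fun _ h => h) (by intros; omega), _, h3, h4, h5, h6⟩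

/-- Branching `k` times before the greedy selection. -/
def branches : ℕ → ℕ → Program
  | 0, b => lexProgram b
  | k + 1, b => branch b (branches k (b + 10))

theorem solves_branches (G : SimpleGraph (Fin n)) (k : ℕ) {b : ℕ} (hb : 3 ≤ b) :
    Solves G (branches k b) b (42 + 23 * k) ((BranchGood G)^[k] (LexGood G)) := by
  induction k generalizing b with
  | zero =>
    intro σ U h1 h2
    exact (solves_lexProgram G hb σ U h1 h2).mono (by omega) fun _ h => h
  | succ k ih =>
    rw [Function.iterate_succ_apply']
    exact solves_branch (a := 42 + 23 * k) hb (by omega) (ih (by omega))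

/-- Alternately peeling and branching, `k` times. -/
def levels (j : ℕ) : ℕ → ℕ → Program
  | 0, b => branches (2 * j) b
  | k + 1, b => peel b (branch (b + 20) (levels j k (b + 30)))

/-- The `2 * j` branchings at the bottom contribute 23 each to the exponent, and every higher level
contributes 18 for peeling and 23 for branching. -/
theorem solves_levels (G : SimpleGraph (Fin n)) (j k : ℕ) {b : ℕ} (hb : 3 ≤ b) :
    Solves G (levels j k b) b (42 + 46 * j + 41 * k) (LevelGood G j k) := by
  induction k generalizing b with
  | zero =>
    intro σ U h1 h2
    exact (solves_branches G (2 * j) hb σ U h1 h2).mono (by omega) fun _ h => h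
  | succ k ih =>
    have h1 := solves_branch (b := b + 20) (a := 42 + 46 * j + 41 * k) (by omega) (by omega)
      (ih (b := b + 20 + 10) (by omega))
    exact solves_peel (a := 42 + 46 * j + 41 * k + 23) hb (by omega) h1

/-- Compute the table of row offsets of the adjacency matrix. -/
def offsets : Program :=
  forLoop 3 (.reg 0) (.store 2 (.add (.reg 3) (.const 1)) (.add (.arr 2 (.reg 3)) (.reg 0)))

/-- The table replaces multiplication by repeated addition. It includes the row `n` past the matrix,
where all cells are 0, because `branch` also tries `w = n`. -/
theorem runs_offsets (G : SimpleGraph (Fin n)) : Runs n offsets 12 (input G) (Ready G) := by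
  classical
  refine runs_forLoop (N := n) (a := 6) (fun i ρ => ρ.reg 3 = i ∧
    Mod (· = 3) (· = 2) (input G) ρ ∧ ∀ u ≤ i, ρ.arr 2 u = u * n) (by omega) (by simp [Expr.cost])
    ?_ ?_ ?_ ?_
  · refine ⟨by simp, Mod.setReg (R := (· = 3)) (Mod.refl _ _ _) rfl 0, ?_⟩
    intro u hu
    obtain rfl : u = 0 := by omega
    simp [input]
  · rintro i ρ ⟨h1, h2, -⟩
    exact ⟨h1, (h2.1 0 (by omega)).trans (by simp [input])⟩
  · rintro i hi ρ ⟨h1, h2, h3⟩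
    have h0 : ρ.reg 0 = n := (h2.1 0 (by omega)).trans (by simp [input])
    refine runs_store (by simp [Expr.cost]) ⟨by simpa using h1, by simp,
      (h2.setArr rfl _ _).setReg rfl _, fun u hu => ?_⟩
    rw [Memory.setReg_arr, Memory.setArr_arr]
    simp only [Expr.eval, h1, true_and]
    split_ifs with h
    · subst h
      rw [h3 i le_rfl, h0]
      ring
    · exact h3 u (by omega)
  · rintro ρ ⟨-, h2, h3⟩
    refine ⟨(h2.1 0 (by omega)).trans (by simp [input]), fun u hu v hv => ?_⟩
    rw [h2.2 0 (by omega), h3 u hu]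
    simp only [input, adjInd, true_and]
    refine if_congr ⟨?_, ?_⟩ rfl rfl
    · rintro ⟨x, y, e, h⟩
      have hn : 0 < n := by omega
      have h4 : u = x := by
        have := congrArg (· / n) h
        simpa [mul_comm _ n, Nat.mul_add_div hn, Nat.div_eq_of_lt hv, Nat.div_eq_of_lt y.2]
          using this
      subst h4
      have h5 : v = y := by omega
      subst h5
      exact nAdj_coe.2 e
    · rintro ⟨hu, hv, e⟩
      exact ⟨⟨u, hu⟩, ⟨v, hv⟩, e, rfl⟩

/-- Compute a maximum independent set of the input graph. -/
def solver (j k : ℕ) : Program :=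
  .seq offsets <| .seq (fill 3 3 (.const 1)) <| .seq (levels j k 3) (fill 1 3 (.arr 4 (.reg 3)))

theorem solvesMISWithin_solver {j k : ℕ} (h : LevelGood G j k Finset.univ) :
    SolvesMISWithin (solver j k) G ((n + 2) ^ (45 + 46 * j + 41 * k)) := by
  have key : Runs n (solver j k) (45 + 46 * j + 41 * k) (input G) fun τ =>
      ∃ S, Enc τ 1 S ∧ IsMaxIn G Finset.univ S := by
    refine Runs.seq (a := 12) (b := 44 + 46 * j + 41 * k) (runs_offsets G) ?_ (by omega) (by omega)
    intro σ hσ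
    refine Runs.seq (a := 12) (b := 43 + 46 * j + 41 * k) (runs_fill_set Finset.univ hσ.1
      (by omega) (by simp [Expr.cost]) (fun i ρ _ _ _ => by simp [Expr.eval])) ?_
      (by omega) (by omega)
    rintro τ ⟨h1, h2⟩
    have hτ : Ready G τ := hσ.mod h1 (by omega) (by omega) (by omega)
    refine Runs.seq (a := 42 + 46 * j + 41 * k) (b := 12) (solves_levels G j k le_rfl τ _ hτ h2) ?_
      (by omega) (by omega)
    rintro ρ ⟨h3, S, hS, -, -, hmax⟩
    refine (runs_copy (hτ.mod h3 (by omega) (by omega) (by omega)).1 (by omega) (by omega) hS).mono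
      le_rfl fun υ h4 => ⟨S, h4.2, hmax h⟩
  obtain ⟨τ, l, h1, h2, S, h3, h4⟩ := key
  refine ⟨τ, l, h1, h2, ?_⟩
  have h5 : output n τ = S := by
    ext v
    simp [output, h3 v v.2, ind_coe_eq_one]
  rw [h5]
  exact ⟨h4.2.1, fun T hT => h4.2.2 T (Finset.subset_univ T) hT⟩

theorem SolvesMISWithin.mono {P : Program} {T T' : ℕ} (h : SolvesMISWithin P G T) (hT : T ≤ T') :
    SolvesMISWithin P G T' := by
  obtain ⟨τ, k, h1, h2, h3⟩ := h
  exact ⟨τ, k, h1, h2.trans hT, h3⟩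

end RAM

theorem theorem1 :
    ∃ c : ℕ, ∀ t : ℕ, 1 ≤ t →
      ∃ P : RAM.Program, ∀ (n : ℕ) (G : SimpleGraph (Fin n)),
        ¬ IsInducedMinor (friendshipGraph t) G →
        RAM.SolvesMISWithin P G ((max n 2) ^ (c * t ^ 5)) := by
  -- 26668 = 2 · (45 + 46 · 288 + 41): the exponent of `RAM.solvesMISWithin_solver` with all powers
  -- of `t` raised to `t ^ 5`, doubled because `n + 2 ≤ max n 2 ^ 2`.
  refine ⟨26668, fun t ht => ⟨RAM.solver (288 * t ^ 4 - 1) t, fun n G hG => ?_⟩⟩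
  have h4 : 1 ≤ t ^ 4 := Nat.one_le_pow _ _ ht
  have h5 : t ^ 4 ≤ t ^ 5 := Nat.pow_le_pow_right ht (by omega)
  have h1 : t ≤ t ^ 5 := Nat.le_self_pow (by omega) t
  have hcls : Cls G (288 * t ^ 4 - 1 + 1) t ((Finset.univ : Finset (Fin n)) : Set (Fin n)) := by
    rw [Finset.coe_univ]
    exact (fanFree_of_not_isInducedMinor hG).cls_univ ht (by omega)
  refine (RAM.solvesMISWithin_solver hcls.levelGood).mono ?_
  have h2 : n + 2 ≤ max n 2 ^ 2 := by
    have h6 : 2 ≤ max n 2 := le_max_right _ _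
    have h7 : n ≤ max n 2 := le_max_left _ _
    nlinarith
  refine (Nat.pow_le_pow_left h2 _).trans ?_
  rw [← pow_mul]
  exact Nat.pow_le_pow_right (by omega) (by omega)
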